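/- Let $S^2$ be the unit sphere with round metric $q_{AB}$, Levi-Civita derivative $D_A$, $D^2=D^AD_A$; all integrals are over $S^2$ with the area measure of $q_{AB}$. Consider vacuum data at future null infinity in Bondi coordinates $(u,x^A)\in\mathbb R\times S^2$: a symmetric traceless shear tensor $C_{AB}(u,x)$, a mass aspect $m(u,x)$ and an angular momentum aspect $N_A(u,x)$, all smooth, with news $N_{AB}=\partial_uC_{AB}$, satisfying the leading-order vacuum Einstein equations $$\partial_u m=\tfrac14D^AD^BN_{AB}-\tfrac18N_{AB}N^{AB},$$ $$\partial_uN_A=D_Am+\tfrac14D^B\big(D_AD^CC_{BC}-D_BD^CC_{CA}\big)+\tfrac14D_B(N^{BC}C_{CA})+\tfrac12(D_BN^{BC})C_{CA}.$$ For smooth $f:S^2\to\mathbb R$, the data on the cross-section $u=f$ in the Bondi coordinates $u'=u-f$, $x'^A=x^A$ are (undifferentiated and differentiated $C,m,N$ being evaluated at $u=f$ after differentiation at fixed $u$) $$C'_{AB}=C_{AB}-2D_AD_Bf+q_{AB}D^2f,$$ $$m'=m+\tfrac14N^{AB}D_AD_Bf+\tfrac12(D_BN^{AB})D_Af+\tfrac14(\partial_uN^{AB})D_AfD_Bf,$$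 $$N'_A=N_A+3mD_Af+\tfrac34\big(D_AD^CC_{CB}-D_BD^CC_{CA}\big)D^Bf+\tfrac34N_B{}^CC_{CA}D^Bf+\tfrac32(D^CN_{BC}D^Bf)D_Af-\tfrac34|Df|^2D^BN_{AB}+\tfrac12(\partial_uN_{BC}D^BfD^Cf)D_Af-\tfrac14|Df|^2\,\partial_uN_{AB}D^Bf.$$ Let $Y^A$ be a Killing field of $(S^2,q)$. The Dray–Streubel (DS) angular momentum on $u=f$ is $$J^{DS}|_{u=f}=\frac1{8\pi}\int Y^A\Big(N'_A-\tfrac14C'_{AB}D_CC'^{CB}\Big)-\frac1{4\pi}\int m'\,Y^AD_Af,$$ and the Chen–Wang–Yau (CWY) angular momentum is $$J^{CWY}|_{u=f}=J^{DS}|_{u=f}+\frac1{8\pi}\int m'\,Y^AD_Ac'+\frac1{4\pi}\int m'\,Y^AD_Af,$$ where $c'$ is the smooth solution of $\tfrac12D^2(D^2+2)c'=D^AD^BC'_{AB}$ that is $L^2$-orthogonal to the spherical harmonics with $\ell=0,1$. Then: (1) for every smooth $f$ the function $c'$ exists and is unique, so that $J^{CWY}|_{u=f}$ is well defined; (2)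 (cross-section continuity) if $f_n$ is a sequence of smooth functions on $S^2$ with $f_n\to0$ uniformly, then $J^{CWY}|_{u=f_n}\to J^{CWY}|_{u=0}$; (3) the correction $\delta(f)$ defined by $J^{CWY}|_{u=f}-J^{CWY}|_{u=0}=J^{DS}|_{u=f}-J^{DS}|_{u=0}+\delta(f)$ satisfies: for every $R$ there is a constant $C$ (depending on the data, $Y$ and $R$) with $|\delta(f)|\le C\|f\|_{C^0}$ for all smooth $f$ with $\|f\|_{C^0}\le R$. -/

import Mathlib

open Set Filter Topology MeasureTheory
open scoped Manifold ContDiff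

noncomputable section

namespace NullInfinity

/-- Euclidean three-space. -/
abbrev E3 : Type := EuclideanSpace ℝ (Fin 3)

/-- The unit two-sphere in Euclidean three-space. -/
abbrev S2 : Type := Metric.sphere (0 : E3) 1

/-- A covector field on the sphere, given by its components along the Cartesian axes of `E3`. -/
abbrev Field1 : Type := S2 → Fin 3 → ℝ

/-- A covariant two-tensor field on the sphere, given by its Cartesian components. -/
abbrev Field2 : Type := S2 → Fin 3 → Fin 3 → ℝ

/-- Smooth functions on the sphere. -/
def SmoothFn (f : S2 → ℝ) : Prop := ContMDiff (𝓡 2) 𝓘(ℝ, ℝ) ∞ f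

/-- Smooth functions of retarded time `u` and of the point of the sphere. -/
def SmoothInTime (F : ℝ → S2 → ℝ) : Prop :=
  ContMDiff (𝓘(ℝ, ℝ).prod (𝓡 2)) 𝓘(ℝ, ℝ) ∞ (fun p : ℝ × S2 => F p.1 p.2)

/-- The integral over the sphere with respect to the area measure of the round metric. -/
def sphereIntegral (f : S2 → ℝ) : ℝ := ∫ x, f x ∂((volume : Measure E3).toSphere)

/-! Tensors on the sphere are represented by their Cartesian components; a tensor is tangential
when its contraction with the position vector in each slot vanishes.  The round metric is the
restriction of the Euclidean metric, so that indices are raised, lowered and contracted by plain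
sums over `Fin 3`, and its Levi-Civita connection is the tangential projection of the
Euclidean derivative. -/

/-- The round metric `q_ij = δ_ij - x_i x_j`, which is also the tangential projection. -/
def q : Field2 := fun x i j => (if i = j then 1 else 0) - (x : E3) i * (x : E3) j

/-- The extension `y ↦ f (y / |y|)` of a function on the sphere, constant along rays
(with value `0` at the origin). -/
def radialExt (f : S2 → ℝ) (y : E3) : ℝ :=
  if h : y = 0 then 0
  else f ⟨‖y‖⁻¹ • y, by
    have : ‖y‖ ≠ 0 := norm_ne_zero_iff.mpr h
    simp [norm_smul, this]⟩

/-- The gradient `D_i f`. The radial derivative of `radialExt f` is zero, so that these are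
the Cartesian components of a tangential covector. -/
def grad (f : S2 → ℝ) : Field1 := fun x i =>
  fderiv ℝ (radialExt f) (x : E3) (EuclideanSpace.single i 1)

/-- The covariant derivative `D_k V_i` of a tangential covector field, as `covD1 V x k i`. -/
def covD1 (V : Field1) : Field2 := fun x k i =>
  ∑ a, q x i a * grad (fun y => V y a) x k

/-- The covariant derivative `D_k T_ij` of a tangential two-tensor field, as
`covD2 T x k i j`. -/
def covD2 (T : Field2) (x : S2) (k i j : Fin 3) : ℝ :=
  ∑ a, ∑ b, q x i a * q x j b * grad (fun y => T y a b) x k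

/-- The divergence `D^A V_A`. -/
def div1 (V : Field1) (x : S2) : ℝ := ∑ i, covD1 V x i i

/-- The divergence `D^A T_AB` on the first index. -/
def div2 (T : Field2) : Field1 := fun x j => ∑ i, covD2 T x i i j

/-- The Hessian `D_A D_B f`. -/
def hess (f : S2 → ℝ) : Field2 := covD1 (grad f)

/-- The Laplacian `D² f = D^A D_A f`. -/
def lap (f : S2 → ℝ) : S2 → ℝ := div1 (grad f)

/-- The derivative `Y^A D_A f`. -/
def alongD (Y : Field1) (f : S2 → ℝ) (x : S2) : ℝ := ∑ i, Y x i * grad f x i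

/-- Smooth tangential vector fields `Y` with `D_A Y_B + D_B Y_A = 0`. -/
structure IsKilling (Y : Field1) : Prop where
  smooth : ∀ i, SmoothFn (fun x => Y x i)
  tangential : ∀ x, ∑ i, Y x i * (x : E3) i = 0
  killing : ∀ x i j, covD1 Y x i j + covD1 Y x j i = 0

/-- The tensor `D_A V_B - D_B V_A`, as `curlD V x A B`. -/
def curlD (V : Field1) : Field2 := fun x i j => covD1 V x i j - covD1 V x j i

/-- The derivative with respect to `u` of a time-dependent two-tensor. -/
def dot2 (T : ℝ → Field2) : ℝ → Field2 := fun u x i j => deriv (fun t => T t x i j) u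

/-- The tensor `N_B^C C_CA`, as `mul2 N C x B A`. -/
def mul2 (S T : Field2) : Field2 := fun x i j => ∑ k, S x i k * T x k j

/-- Vacuum data at future null infinity, in Bondi coordinates `(u, x)`: the shear tensor
`C_AB`, the mass aspect `m` and the angular momentum aspect `N_A`, smooth on `ℝ × S²`, where
`C_AB` is symmetric and traceless, subject to the leading-order vacuum Einstein equations
for `∂_u m` and `∂_u N_A`, with news tensor `N_AB = ∂_u C_AB`. -/
structure BondiData where
  /-- the shear tensor `C_AB` -/
  C : ℝ → Field2
  /-- the mass aspect `m` -/
  m : ℝ → S2 → ℝ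
  /-- the angular momentum aspect `N_A` -/
  L : ℝ → Field1
  C_smooth : ∀ i j, SmoothInTime (fun u x => C u x i j)
  C_symm : ∀ u x i j, C u x i j = C u x j i
  C_tangential : ∀ u x i, ∑ j, C u x i j * (x : E3) j = 0
  C_traceless : ∀ u x, ∑ i, C u x i i = 0
  m_smooth : SmoothInTime m
  L_smooth : ∀ i, SmoothInTime (fun u x => L u x i)
  L_tangential : ∀ u x, ∑ i, L u x i * (x : E3) i = 0
  /-- `∂_u m = (1/4) D^A D^B N_AB - (1/8) N_AB N^AB` -/
  evol_m : ∀ u x, deriv (fun t => m t x) u =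
    1 / 4 * div1 (div2 (dot2 C u)) x - 1 / 8 * ∑ i, ∑ j, dot2 C u x i j ^ 2
  /-- `∂_u N_A = D_A m + (1/4) D^B (D_A D^C C_BC - D_B D^C C_CA)
    + (1/4) D_B (N^BC C_CA) + (1/2) (D_B N^BC) C_CA` -/
  evol_L : ∀ u x i, deriv (fun t => L t x i) u =
    grad (m u) x i
      - 1 / 4 * div2 (curlD (div2 (C u))) x i
      + 1 / 4 * div2 (mul2 (dot2 C u) (C u)) x i
      + 1 / 2 * ∑ k, div2 (dot2 C u) x k * C u x k i

namespace BondiData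

variable (D : BondiData)

/-- The news tensor `N_AB = ∂_u C_AB`. -/
def news : ℝ → Field2 := dot2 D.C

/-- The shear tensor `C'_AB` on the cross-section `u = f`, in the Bondi coordinates
`u' = u - f`: `C'_AB = C_AB|_{u=f} - 2 D_A D_B f + q_AB D² f`. -/
def shearOn (f : S2 → ℝ) : Field2 := fun x i j =>
  D.C (f x) x i j - 2 * hess f x i j + q x i j * lap f x

/-- The mass aspect `m'` on the cross-section `u = f`:
`m' = m|_{u=f} + (1/4) N^AB|_{u=f} D_A D_B f + (1/2) [D_B N^AB]|_{u=f} D_A f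
  + (1/4) [∂_u N^AB]|_{u=f} D_A f D_B f`. -/
def massOn (f : S2 → ℝ) (x : S2) : ℝ :=
  D.m (f x) x
    + 1 / 4 * ∑ i, ∑ j, D.news (f x) x i j * hess f x i j
    + 1 / 2 * ∑ i, div2 (D.news (f x)) x i * grad f x i
    + 1 / 4 * ∑ i, ∑ j, dot2 D.news (f x) x i j * grad f x i * grad f x j

/-- The angular momentum aspect `N'_A` on the cross-section `u = f`, all data being evaluated
at `u = f` after differentiation:
`N'_A = N_A + 3 m D_A f + (3/4) (D_A D^C C_CB - D_B D^C C_CA) D^B f + (3/4) N_B^C C_CA D^B f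
  + (3/2) (D^C N_BC D^B f) D_A f - (3/4) |D f|² D^B N_AB
  + (1/2) (∂_u N_BC D^B f D^C f) D_A f - (1/4) |D f|² ∂_u N_AB D^B f`. -/
def angOn (f : S2 → ℝ) : Field1 := fun x i =>
  D.L (f x) x i
    + 3 * D.m (f x) x * grad f x i
    + 3 / 4 * ∑ j, curlD (div2 (D.C (f x))) x i j * grad f x j
    + 3 / 4 * ∑ j, mul2 (D.news (f x)) (D.C (f x)) x j i * grad f x j
    + 3 / 2 * (∑ j, div2 (D.news (f x)) x j * grad f x j) * grad f x i
    - 3 / 4 * (∑ j, grad f x j ^ 2) * div2 (D.news (f x)) x i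
    + 1 / 2 * (∑ j, ∑ k, dot2 D.news (f x) x j k * grad f x j * grad f x k) * grad f x i
    - 1 / 4 * (∑ j, grad f x j ^ 2) * ∑ j, dot2 D.news (f x) x i j * grad f x j

/-- The Dray-Streubel angular momentum on the cross-section `u = f`:
`(1/8π) ∫ Y^A (N'_A - (1/4) C'_AB D_C C'^CB) - (1/4π) ∫ m' Y^A D_A f`. -/
def JDS (Y : Field1) (f : S2 → ℝ) : ℝ :=
  1 / (8 * Real.pi) * sphereIntegral (fun x => ∑ i, Y x i *
      (D.angOn f x i - 1 / 4 * ∑ j, D.shearOn f x i j * div2 (D.shearOn f) x j))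
    - 1 / (4 * Real.pi) * sphereIntegral (fun x => D.massOn f x * alongD Y f x)

end BondiData

/-- `c` is a smooth solution of `(1/2) D² (D² + 2) c = D^A D^B C_AB` without `ℓ = 0, 1` parts,
that is, `L²`-orthogonal to the constants and to the coordinate functions. -/
structure IsPotential (C : Field2) (c : S2 → ℝ) : Prop where
  smooth : SmoothFn c
  eqn : ∀ x, 1 / 2 * lap (fun y => lap c y + 2 * c y) x = div1 (div2 C) x
  no_l0 : sphereIntegral c = 0
  no_l1 : ∀ i, sphereIntegral (fun x => c x * (x : E3) i) = 0

/-- The solution `c` associated with a shear tensor. -/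
def potential (C : Field2) : S2 → ℝ := Classical.epsilon (IsPotential C)

namespace BondiData

variable (D : BondiData)

/-- The Chen-Wang-Yau angular momentum on the cross-section `u = f`:
`J^DS|_{u=f} + (1/8π) ∫ m' Y^A D_A c' + (1/4π) ∫ m' Y^A D_A f`, where `c'` is the potential
of `C'_AB`. -/
def JCWY (Y : Field1) (f : S2 → ℝ) : ℝ :=
  D.JDS Y f
    + 1 / (8 * Real.pi) * sphereIntegral
        (fun x => D.massOn f x * alongD Y (potential (D.shearOn f)) x)
    + 1 / (4 * Real.pi) * sphereIntegral (fun x => D.massOn f x * alongD Y f x)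

/-- The correction `δ(f)`, with
`J^CWY|_{u=f} - J^CWY|_{u=0} = J^DS|_{u=f} - J^DS|_{u=0} + δ(f)`. -/
def correction (Y : Field1) (f : S2 → ℝ) : ℝ :=
  (D.JCWY Y f - D.JCWY Y (fun _ => 0)) - (D.JDS Y f - D.JDS Y (fun _ => 0))

end BondiData

/-- Cross-section continuity at `u = 0` of a quantity `J` defined on the smooth cross-sections
`u = f`. -/
def CrossSectionContinuous (J : (S2 → ℝ) → ℝ) : Prop :=
  ∀ f : ℕ → S2 → ℝ, (∀ n, SmoothFn (f n)) → TendstoUniformly f (fun _ => 0) atTop →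
    Tendsto (fun n => J (f n)) atTop (𝓝 (J (fun _ => 0)))

end NullInfinity

end

/-!
The Dray-Streubel angular momentum of the cross-section `u = f` involves up to three derivatives of
`f`, and the potential `c'` solves a fourth-order elliptic equation whose right-hand side involves
four. Continuity in the `C⁰` norm holds because all these derivatives can be removed by integration
by parts.

*Dray-Streubel part.* The Killing field `Y` is an infinitesimal rotation
(`IsKilling.exists_isRot`). The terms of the integrand with second derivatives of `f`, or quadratic
in `D f`, form a combination of divergences of tangential vector fields, up to the term
`Y^A F_AB D_C F^BC` with `F = -2 D D f + q D² f`, whose integral vanishes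
(`IsRot.sphereIntegral_stf_stf`), and up to terms linear in `D f` with coefficients evaluated at
`u = f` (`BondiData.ds_integrand_eq`). The algebra rests on the two-dimensional Cayley-Hamilton
identity (`cayley_hamilton`). A linear term `P^A(f) D_A f` is, up to a divergence, the term
`-(D_A 𝓟^A)(f)` with `𝓟` a primitive of `P` in `u`
(`sphereIntegral_onSection_mul_grad`). Hence
`J^DS = ∫ G(f(x), x)` for a smooth function `G` independent of `f` (`BondiData.JDS_eq`), which is
Lipschitz in the `C⁰` norm.

*Correction.* Let `W = C|_{u=f}` and `M = m - (1/4) D^A D^B C_AB`, so that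
`m' = M|_{u=f} + (1/4) D^A D^B W_AB`. The function `k = c' + 2 f` solves
`(1/2) D² (D² + 2) k = D^A D^B W_AB`, without derivatives of `f`. As `Y` commutes with the
Laplacian, the double divergence in `m'` does not contribute to `∫ m' Y k`
(`BondiData.JCWY_eq`), which leaves `∫ M|_{u=f} Y k`. Its change is split into three parts
(`BondiData.correction_eq`). The change of `M|_{u=f}` is `O(‖f‖)` and is paired with `D k`, which is
bounded in `L²` by an energy estimate (`exists_energy_bound`). The change of `k` is paired with
the fixed function `Y M|_{u=0}`; moving the inverse of `D² (D² + 2)` and the double divergence to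
that function leaves the change of `W`, which is again `O(‖f‖)`. The `ℓ = 0, 1` parts of `k` are
those of `2 f`.

*The operator `D² (D² + 2)`.* Its inverse is given by the explicit kernel
`(1 - x·y) log (1 - x·y)` (`greenOp_lap2`, `lap2_greenOp`). That the kernel is an inverse follows by
regularization to `(a - x·y) log (a - x·y)` with `a → 1`; that it preserves smoothness follows from
rotation invariance. This yields existence and uniqueness of the potential.

Tangential tensors are handled through their Cartesian components. The divergence theorem is derived
from the invariance of the area measure under reflections.
-/

open Set Filter Topology MeasureTheory
open scoped Manifold ContDiff

noncomputable section

namespace NullInfinity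

/-! ### Calculus on the sphere -/

/-- The radial projection `y ↦ y / |y|` onto the sphere (with a junk value at the origin). -/
def proj (y : E3) : S2 :=
  if h : y = 0 then ⟨EuclideanSpace.single 0 1, by simp⟩
  else ⟨‖y‖⁻¹ • y, by
    have : ‖y‖ ≠ 0 := norm_ne_zero_iff.mpr h
    simp [norm_smul, this]⟩

/-- The Cartesian basis vectors of `E3`. -/
abbrev e (i : Fin 3) : E3 := EuclideanSpace.single i 1

lemma S2.ne_zero (x : S2) : (x : E3) ≠ 0 := by
  intro h
  have := x.2
  simp [h] at this

lemma S2.norm_eq (x : S2) : ‖(x : E3)‖ = 1 := by simp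

lemma S2.sum_sq (x : S2) : (x : E3) 0 ^ 2 + (x : E3) 1 ^ 2 + (x : E3) 2 ^ 2 = 1 := by
  have h := EuclideanSpace.real_norm_sq_eq (x : E3)
  rw [S2.norm_eq, Fin.sum_univ_three] at h
  linarith

lemma proj_of_ne {y : E3} (hy : y ≠ 0) : (proj y : E3) = ‖y‖⁻¹ • y := by simp [proj, hy]

lemma radialExt_of_ne (f : S2 → ℝ) {y : E3} (hy : y ≠ 0) : radialExt f y = f (proj y) := by
  simp [radialExt, proj, hy]

lemma proj_coe (x : S2) : proj x = x := by
  apply Subtype.ext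
  rw [proj_of_ne x.ne_zero, x.norm_eq]
  simp

lemma radialExt_coe (f : S2 → ℝ) (x : S2) : radialExt f x = f x := by
  rw [radialExt_of_ne f x.ne_zero, proj_coe]

lemma proj_smul {r : ℝ} (hr : 0 < r) (y : E3) : proj (r • y) = proj y := by
  by_cases hy : y = 0
  · simp [hy]
  · apply Subtype.ext
    rw [proj_of_ne hy, proj_of_ne (smul_ne_zero hr.ne' hy), norm_smul, smul_smul]
    congr 1
    rw [Real.norm_of_nonneg hr.le]
    field_simp

lemma radialExt_smul (f : S2 → ℝ) {r : ℝ} (hr : 0 < r) (y : E3) :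
    radialExt f (r • y) = radialExt f y := by
  by_cases hy : y = 0
  · simp [hy]
  · rw [radialExt_of_ne f hy, radialExt_of_ne f (smul_ne_zero hr.ne' hy), proj_smul hr]

lemma fact_finrank_E3 : Fact (Module.finrank ℝ E3 = 2 + 1) := ⟨finrank_euclideanSpace_fin⟩

/-- Together with `radialExt_of_ne`, this reduces smoothness on the sphere to smoothness of radial
extensions on the complement of the origin. -/
lemma contMDiffAt_proj {y : E3} (hy : y ≠ 0) : ContMDiffAt 𝓘(ℝ, E3) (𝓡 2) ∞ proj y := by
  let U : TopologicalSpace.Opens E3 := ⟨{0}ᶜ, isOpen_compl_singleton⟩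
  have hf' : ∀ z : U, ‖(z : E3)‖⁻¹ • (z : E3) ∈ Metric.sphere (0 : E3) 1 := by
    intro z
    have hz : (z : E3) ≠ 0 := z.2
    simp [norm_smul, norm_ne_zero_iff.mpr hz]
  have h1 : ContMDiff 𝓘(ℝ, E3) 𝓘(ℝ, E3) ∞ (fun z : U => ‖(z : E3)‖⁻¹ • (z : E3)) := by
    intro z
    have hz : (z : E3) ≠ 0 := z.2
    have : ContMDiffAt 𝓘(ℝ, E3) 𝓘(ℝ, E3) ∞ (fun z : E3 => ‖z‖⁻¹ • z) (z : E3) := by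
      apply ContDiffAt.contMDiffAt
      exact ((contDiffAt_norm ℝ hz).inv (norm_ne_zero_iff.mpr hz)).smul contDiffAt_id
    exact contMDiffAt_subtype_iff.mpr this
  have := fact_finrank_E3
  have h2 := h1.codRestrict_sphere (n := 2) hf'
  have h3 : (Set.codRestrict (fun z : U => ‖(z : E3)‖⁻¹ • (z : E3)) _ hf') =
      fun z : U => proj z := by
    funext z
    apply Subtype.ext
    have hz : (z : E3) ≠ 0 := z.2
    rw [proj_of_ne hz]
    rfl
  rw [h3] at h2
  exact contMDiffAt_subtype_iff.mp (h2 ⟨y, hy⟩)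

/-- The extension of a time-dependent function on the sphere to `ℝ × E3`, constant along rays. -/
def extT (F : ℝ → S2 → ℝ) (p : ℝ × E3) : ℝ := radialExt (F p.1) p.2

lemma SmoothInTime.ext {F : ℝ → S2 → ℝ} (hF : SmoothInTime F) {p : ℝ × E3} (hp : p.2 ≠ 0) :
    ContDiffAt ℝ ∞ (extT F) p := by
  have hU : {p : ℝ × E3 | p.2 ≠ 0} ∈ 𝓝 p :=
    (isOpen_ne.preimage continuous_snd).mem_nhds hp
  have h1 : ContMDiffAt 𝓘(ℝ, ℝ × E3) 𝓘(ℝ, ℝ) ∞ (fun p : ℝ × E3 => F p.1 (proj p.2)) p := by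
    have h2 : ContMDiffAt 𝓘(ℝ, ℝ × E3) (𝓘(ℝ, ℝ).prod (𝓡 2)) ∞
        (fun p : ℝ × E3 => (p.1, proj p.2)) p := by
      apply ContMDiffAt.prodMk
      · exact contDiffAt_fst.contMDiffAt
      · exact ContMDiffAt.comp (I' := 𝓘(ℝ, E3)) p (contMDiffAt_proj hp)
          contDiffAt_snd.contMDiffAt
    exact ContMDiffAt.comp p (hF (p.1, proj p.2)) h2
  refine h1.contDiffAt.congr_of_eventuallyEq ?_
  filter_upwards [hU] with r hr
  exact radialExt_of_ne _ hr

lemma smoothInTime_of_ext {G : ℝ × E3 → ℝ} (h : ∀ p : ℝ × E3, p.2 ≠ 0 → ContDiffAt ℝ ∞ G p) :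
    SmoothInTime (fun u x => G (u, x)) := by
  intro p
  have := fact_finrank_E3
  have h2 : ContMDiffAt (𝓘(ℝ, ℝ).prod (𝓡 2)) 𝓘(ℝ, ℝ × E3) ∞
      (fun p : ℝ × S2 => (p.1, (p.2 : E3))) p := by
    have a : ContMDiffAt (𝓘(ℝ, ℝ).prod (𝓡 2)) 𝓘(ℝ, ℝ) ∞ (fun p : ℝ × S2 => p.1) p :=
      contMDiffAt_fst
    have b : ContMDiffAt (𝓘(ℝ, ℝ).prod (𝓡 2)) 𝓘(ℝ, E3) ∞ (fun p : ℝ × S2 => (p.2 : E3)) p :=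
      ContMDiffAt.comp (I' := 𝓡 2) p (contMDiff_coe_sphere _) contMDiffAt_snd
    exact a.prodMk_space b
  exact ContMDiffAt.comp (I' := 𝓘(ℝ, ℝ × E3)) p
    ((h (p.1, (p.2 : E3)) p.2.ne_zero).contMDiffAt) h2

attribute [fun_prop] SmoothFn

lemma SmoothFn.time {f : S2 → ℝ} (hf : SmoothFn f) : SmoothInTime (fun _ => f) :=
  ContMDiff.comp (I' := 𝓡 2) hf contMDiff_snd

lemma SmoothInTime.at {F : ℝ → S2 → ℝ} (hF : SmoothInTime F) (u : ℝ) : SmoothFn (F u) :=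
  ContMDiff.comp (I' := 𝓘(ℝ, ℝ).prod (𝓡 2)) (g := fun p : ℝ × S2 => F p.1 p.2)
    (f := fun x => (u, x)) hF (contMDiff_const.prodMk contMDiff_id)

/-- The restriction of smooth time-dependent data to the cross-section `u = f` is smooth. -/
lemma SmoothInTime.onSection {F : ℝ → S2 → ℝ} (hF : SmoothInTime F) {f : S2 → ℝ}
    (hf : SmoothFn f) : SmoothFn (fun x => F (f x) x) :=
  ContMDiff.comp (I' := 𝓘(ℝ, ℝ).prod (𝓡 2)) (g := fun p : ℝ × S2 => F p.1 p.2)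
    (f := fun x => (f x, x)) hF (ContMDiff.prodMk hf contMDiff_id)

lemma SmoothFn.ext {f : S2 → ℝ} (hf : SmoothFn f) {y : E3} (hy : y ≠ 0) :
    ContDiffAt ℝ ∞ (radialExt f) y := by
  have h := hf.time.ext (p := (0, y)) hy
  exact h.comp y (contDiffAt_const.prodMk contDiffAt_id)

lemma smoothFn_of_ext {G : E3 → ℝ} (h : ∀ y : E3, y ≠ 0 → ContDiffAt ℝ ∞ G y) :
    SmoothFn (fun x => G x) := by
  have := smoothInTime_of_ext (G := fun p => G p.2)
    (fun p hp => (h p.2 hp).comp p contDiffAt_snd)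
  exact this.at 0

lemma SmoothFn.diff {f : S2 → ℝ} (hf : SmoothFn f) {y : E3} (hy : y ≠ 0) :
    DifferentiableAt ℝ (radialExt f) y := (hf.ext hy).differentiableAt (by simp)

@[fun_prop]
lemma SmoothFn.continuous {f : S2 → ℝ} (hf : SmoothFn f) : Continuous f := ContMDiff.continuous hf

lemma SmoothInTime.continuous {F : ℝ → S2 → ℝ} (hF : SmoothInTime F) :
    Continuous (fun p : ℝ × S2 => F p.1 p.2) := ContMDiff.continuous hF

@[fun_prop]
lemma smoothFn_const (c : ℝ) : SmoothFn (fun _ => c) := contMDiff_const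

@[fun_prop]
lemma SmoothFn.add {f g : S2 → ℝ} (hf : SmoothFn f) (hg : SmoothFn g) :
    SmoothFn (fun x => f x + g x) := ContMDiff.add hf hg

@[fun_prop]
lemma SmoothFn.mul {f g : S2 → ℝ} (hf : SmoothFn f) (hg : SmoothFn g) :
    SmoothFn (fun x => f x * g x) := ContMDiff.mul hf hg

@[fun_prop]
lemma SmoothFn.neg {f : S2 → ℝ} (hf : SmoothFn f) : SmoothFn (fun x => - f x) := by
  simpa using (smoothFn_const (-1)).mul hf

@[fun_prop]
lemma SmoothFn.sub {f g : S2 → ℝ} (hf : SmoothFn f) (hg : SmoothFn g) :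
    SmoothFn (fun x => f x - g x) := by simpa [sub_eq_add_neg] using hf.add hg.neg

lemma SmoothFn.const_mul {f : S2 → ℝ} (hf : SmoothFn f) (c : ℝ) : SmoothFn (fun x => c * f x) :=
  (smoothFn_const c).mul hf

@[fun_prop]
lemma SmoothFn.pow {f : S2 → ℝ} (hf : SmoothFn f) (n : ℕ) : SmoothFn (fun x => f x ^ n) :=
  ContMDiff.pow hf n

@[fun_prop]
lemma SmoothFn.sum {ι : Type} {s : Finset ι} {f : ι → S2 → ℝ} (hf : ∀ i, SmoothFn (f i)) :
    SmoothFn (fun x => ∑ i ∈ s, f i x) := by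
  classical
  induction s using Finset.induction_on with
  | empty => simpa using smoothFn_const 0
  | insert a s ha ih => simpa [Finset.sum_insert ha] using (hf a).add ih

lemma smoothInTime_const (c : ℝ) : SmoothInTime (fun _ _ => c) := contMDiff_const

lemma SmoothInTime.add {f g : ℝ → S2 → ℝ} (hf : SmoothInTime f) (hg : SmoothInTime g) :
    SmoothInTime (fun u x => f u x + g u x) := ContMDiff.add hf hg

lemma SmoothInTime.mul {f g : ℝ → S2 → ℝ} (hf : SmoothInTime f) (hg : SmoothInTime g) :
    SmoothInTime (fun u x => f u x * g u x) := ContMDiff.mul hf hg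

lemma SmoothInTime.neg {f : ℝ → S2 → ℝ} (hf : SmoothInTime f) :
    SmoothInTime (fun u x => - f u x) := by
  simpa using (smoothInTime_const (-1)).mul hf

lemma SmoothInTime.sub {f g : ℝ → S2 → ℝ} (hf : SmoothInTime f) (hg : SmoothInTime g) :
    SmoothInTime (fun u x => f u x - g u x) := by simpa [sub_eq_add_neg] using hf.add hg.neg

lemma SmoothInTime.const_mul {f : ℝ → S2 → ℝ} (hf : SmoothInTime f) (c : ℝ) :
    SmoothInTime (fun u x => c * f u x) := (smoothInTime_const c).mul hf

lemma SmoothInTime.sum {ι : Type} {s : Finset ι} {f : ι → ℝ → S2 → ℝ}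
    (hf : ∀ i, SmoothInTime (f i)) : SmoothInTime (fun u x => ∑ i ∈ s, f i u x) := by
  classical
  induction s using Finset.induction_on with
  | empty => simpa using smoothInTime_const 0
  | insert a s ha ih => simpa [Finset.sum_insert ha] using (hf a).add ih

lemma contDiff_coord (i : Fin 3) : ContDiff ℝ ∞ (fun y : E3 => y i) := by fun_prop

@[fun_prop]
lemma smoothFn_coord (i : Fin 3) : SmoothFn (fun x => (x : E3) i) :=
  smoothFn_of_ext (G := fun y => y i) (fun _ _ => (contDiff_coord i).contDiffAt)

/-! #### Rules for the gradient -/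

lemma grad_congr_ext {f : S2 → ℝ} {G : E3 → ℝ} {x : S2}
    (h : radialExt f =ᶠ[𝓝 (x : E3)] G) (i : Fin 3) : grad f x i = fderiv ℝ G x (e i) := by
  rw [grad, h.fderiv_eq]

lemma grad_const (c : ℝ) (x : S2) (i : Fin 3) : grad (fun _ => c) x i = 0 := by
  have h : radialExt (fun _ => c) =ᶠ[𝓝 (x : E3)] fun _ => c := by
    filter_upwards [isOpen_ne.mem_nhds x.ne_zero] with y hy
    exact radialExt_of_ne _ hy
  rw [grad_congr_ext h]
  simp

lemma grad_add {f g : S2 → ℝ} (hf : SmoothFn f) (hg : SmoothFn g) (x : S2) (i : Fin 3) :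
    grad (fun y => f y + g y) x i = grad f x i + grad g x i := by
  have h : radialExt (fun y => f y + g y) =ᶠ[𝓝 (x : E3)]
      fun y => radialExt f y + radialExt g y := by
    filter_upwards [isOpen_ne.mem_nhds x.ne_zero] with y hy
    simp [radialExt_of_ne _ hy]
  rw [grad_congr_ext h, fderiv_fun_add (hf.diff x.ne_zero) (hg.diff x.ne_zero)]
  rfl

lemma grad_mul {f g : S2 → ℝ} (hf : SmoothFn f) (hg : SmoothFn g) (x : S2) (i : Fin 3) :
    grad (fun y => f y * g y) x i = grad f x i * g x + f x * grad g x i := by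
  have h : radialExt (fun y => f y * g y) =ᶠ[𝓝 (x : E3)]
      fun y => radialExt f y * radialExt g y := by
    filter_upwards [isOpen_ne.mem_nhds x.ne_zero] with y hy
    simp [radialExt_of_ne _ hy]
  rw [grad_congr_ext h, fderiv_fun_mul (hf.diff x.ne_zero) (hg.diff x.ne_zero)]
  simp only [radialExt_coe, grad, add_apply,
    smul_apply, smul_eq_mul]
  ring

lemma grad_const_mul {f : S2 → ℝ} (hf : SmoothFn f) (c : ℝ) (x : S2) (i : Fin 3) :
    grad (fun y => c * f y) x i = c * grad f x i := by
  rw [grad_mul (smoothFn_const c) hf, grad_const]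
  ring

lemma grad_neg {f : S2 → ℝ} (hf : SmoothFn f) (x : S2) (i : Fin 3) :
    grad (fun y => - f y) x i = - grad f x i := by
  have := grad_const_mul hf (-1) x i
  simpa using this

lemma grad_sub {f g : S2 → ℝ} (hf : SmoothFn f) (hg : SmoothFn g) (x : S2) (i : Fin 3) :
    grad (fun y => f y - g y) x i = grad f x i - grad g x i := by
  have := grad_add hf hg.neg x i
  rw [grad_neg hg] at this
  simpa [sub_eq_add_neg] using this

lemma grad_sum {ι : Type} {s : Finset ι} {f : ι → S2 → ℝ} (hf : ∀ i, SmoothFn (f i)) (x : S2)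
    (k : Fin 3) : grad (fun y => ∑ i ∈ s, f i y) x k = ∑ i ∈ s, grad (f i) x k := by
  classical
  induction s using Finset.induction_on with
  | empty => simpa using grad_const 0 x k
  | insert a s ha ih =>
    simp only [Finset.sum_insert ha]
    rw [grad_add (hf a) (SmoothFn.sum hf), ih]

lemma SmoothFn.comp {f : S2 → ℝ} (hf : SmoothFn f) {g : ℝ → ℝ}
    (hg : ∀ x, ContDiffAt ℝ ∞ g (f x)) : SmoothFn (fun x => g (f x)) := fun x =>
  ContMDiffAt.comp (I' := 𝓘(ℝ, ℝ)) x (hg x).contMDiffAt (hf x)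

lemma grad_comp {f : S2 → ℝ} (hf : SmoothFn f) {g : ℝ → ℝ} {x : S2} {g' : ℝ}
    (hg : HasDerivAt g g' (f x)) (i : Fin 3) :
    grad (fun y => g (f y)) x i = g' * grad f x i := by
  have h : radialExt (fun y => g (f y)) =ᶠ[𝓝 (x : E3)] fun y => g (radialExt f y) := by
    filter_upwards [isOpen_ne.mem_nhds x.ne_zero] with y hy
    simp [radialExt_of_ne _ hy]
  rw [grad_congr_ext h]
  rw [← radialExt_coe f x] at hg
  have h1 : HasFDerivAt (fun y => g (radialExt f y)) _ (x : E3) :=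
    hg.comp_hasFDerivAt (x : E3) (hf.diff x.ne_zero).hasFDerivAt
  rw [h1.fderiv]
  simp [grad]

/-- The radial derivative of an extension that is constant along rays vanishes. -/
lemma grad_tangential {f : S2 → ℝ} (hf : SmoothFn f) (x : S2) :
    ∑ i, grad f x i * (x : E3) i = 0 := by
  have h1 : fderiv ℝ (radialExt f) x (x : E3) = 0 := by
    have h2 : HasDerivAt (fun r : ℝ => radialExt f (r • (x : E3)))
        (fderiv ℝ (radialExt f) x (x : E3)) 1 := by
      have h3 : HasFDerivAt (radialExt f) (fderiv ℝ (radialExt f) x) ((1 : ℝ) • (x : E3)) := by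
        simpa using (hf.diff x.ne_zero).hasFDerivAt
      have h4 : HasDerivAt (fun r : ℝ => r • (x : E3)) (x : E3) 1 := by
        simpa using (hasDerivAt_id (1 : ℝ)).smul_const (x : E3)
      exact h3.comp_hasDerivAt 1 h4
    have h5 : HasDerivAt (fun r : ℝ => radialExt f (r • (x : E3))) 0 1 := by
      refine (hasDerivAt_const (1 : ℝ) (radialExt f x)).congr_of_eventuallyEq ?_
      filter_upwards [lt_mem_nhds (zero_lt_one (α := ℝ))] with r hr
      exact radialExt_smul f hr _
    exact h2.unique h5
  have h6 : (x : E3) = ∑ i, (x : E3) i • e i := by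
    ext j
    simp [e, Fin.sum_univ_three]
    fin_cases j <;> simp
  conv at h1 => rw [h6]; lhs; arg 1; rw [← h6]
  rw [map_sum] at h1
  rw [← h1]
  refine Finset.sum_congr rfl fun i _ => ?_
  simp [grad, mul_comm]

lemma grad_coord (j : Fin 3) (x : S2) (i : Fin 3) :
    grad (fun y => (y : E3) j) x i = q x i j := by
  have h : radialExt (fun y => (y : E3) j) =ᶠ[𝓝 (x : E3)] fun y => (‖y‖ ^ 2) ^ (-(1:ℝ)/2) * y j := by
    filter_upwards [isOpen_ne.mem_nhds x.ne_zero] with y hy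
    have hn : 0 < ‖y‖ := norm_pos_iff.mpr hy
    rw [radialExt_of_ne _ hy, proj_of_ne hy, ← Real.rpow_natCast, ← Real.rpow_mul hn.le]
    norm_num [Real.rpow_neg_one]
  rw [grad_congr_ext h]
  have h1 : HasFDerivAt (fun y : E3 => ‖y‖ ^ 2) (2 • innerSL ℝ (x : E3)) (x : E3) :=
    (hasStrictFDerivAt_norm_sq (x : E3)).hasFDerivAt
  have h2 := h1.rpow_const (p := -(1:ℝ)/2) (Or.inl (by rw [x.norm_eq]; norm_num))
  have h3 : HasFDerivAt (fun y : E3 => y j) (EuclideanSpace.proj j : E3 →L[ℝ] ℝ) (x : E3) :=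
    (EuclideanSpace.proj j : E3 →L[ℝ] ℝ).hasFDerivAt
  rw [(h2.fun_mul h3).fderiv]
  simp only [x.norm_eq, q, add_apply, smul_apply, e,
    smul_eq_mul, innerSL_apply_apply, EuclideanSpace.inner_single_right]
  rcases eq_or_ne i j with rfl | hij
  · simp; ring
  · simp [hij, hij.symm]; ring

/-! #### Derivatives in time and on the sphere -/

lemma grad_eq_fderiv_extT {F : ℝ → S2 → ℝ} (hF : SmoothInTime F) (u : ℝ) (x : S2) (i : Fin 3) :
    grad (F u) x i = fderiv ℝ (extT F) (u, (x : E3)) (0, e i) := by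
  have h1 : HasFDerivAt (extT F) (fderiv ℝ (extT F) (u, (x : E3))) (u, (x : E3)) :=
    ((hF.ext (p := (u, (x : E3))) x.ne_zero).differentiableAt (by simp)).hasFDerivAt
  have h2 : HasFDerivAt (fun y : E3 => (u, y)) (ContinuousLinearMap.inr ℝ ℝ E3) (x : E3) :=
    hasFDerivAt_prodMk_right u (x : E3)
  have h3 : HasFDerivAt (radialExt (F u)) _ (x : E3) := h1.comp (x : E3) h2
  rw [grad, h3.fderiv]
  rfl

lemma deriv_eq_fderiv_extT {F : ℝ → S2 → ℝ} (hF : SmoothInTime F) (u : ℝ) {y : E3} (hy : y ≠ 0) :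
    HasDerivAt (fun t => F t (proj y)) (fderiv ℝ (extT F) (u, y) (1, 0)) u := by
  have h1 : HasFDerivAt (extT F) (fderiv ℝ (extT F) (u, y)) (u, y) :=
    ((hF.ext (p := (u, y)) hy).differentiableAt (by simp)).hasFDerivAt
  have h2 : HasFDerivAt (fun t : ℝ => (t, y)) (ContinuousLinearMap.inl ℝ ℝ E3) u :=
    hasFDerivAt_prodMk_left u y
  have h3 : HasFDerivAt (fun t => extT F (t, y)) _ u :=
    HasFDerivAt.comp (g := extT F) (f := fun t : ℝ => (t, y)) u h1 h2
  have h4 := h3.hasDerivAt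
  simp only [extT, radialExt_of_ne _ hy] at h4
  simpa using h4

lemma SmoothInTime.hasDerivAt {F : ℝ → S2 → ℝ} (hF : SmoothInTime F) (u : ℝ) (x : S2) :
    HasDerivAt (fun t => F t x) (deriv (fun t => F t x) u) u := by
  have := deriv_eq_fderiv_extT hF u x.ne_zero
  rw [proj_coe] at this
  exact this.differentiableAt.hasDerivAt

lemma contDiffAt_fderiv_extT {F : ℝ → S2 → ℝ} (hF : SmoothInTime F) {p : ℝ × E3} (hp : p.2 ≠ 0)
    (v : ℝ × E3) : ContDiffAt ℝ ∞ (fun p => fderiv ℝ (extT F) p v) p :=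
  ((hF.ext hp).fderiv_right (m := ∞) (by simp)).clm_apply contDiffAt_const

lemma SmoothInTime.grad {F : ℝ → S2 → ℝ} (hF : SmoothInTime F) (i : Fin 3) :
    SmoothInTime (fun u x => grad (F u) x i) := by
  have h := smoothInTime_of_ext (fun p hp => contDiffAt_fderiv_extT hF (p := p) hp (0, e i))
  have h2 : (fun u x => NullInfinity.grad (F u) x i) = fun (u : ℝ) (x : S2) =>
      fderiv ℝ (extT F) (u, (x : E3)) (0, e i) := by
    funext u x
    exact grad_eq_fderiv_extT hF u x i
  rw [h2]
  exact h

@[fun_prop]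
lemma SmoothFn.grad {f : S2 → ℝ} (hf : SmoothFn f) (i : Fin 3) : SmoothFn (fun x => grad f x i) :=
  (hf.time.grad i).at 0

lemma SmoothInTime.deriv {F : ℝ → S2 → ℝ} (hF : SmoothInTime F) :
    SmoothInTime (fun u x => deriv (fun t => F t x) u) := by
  have h := smoothInTime_of_ext (fun p hp => contDiffAt_fderiv_extT hF (p := p) hp (1, 0))
  have h2 : (fun u x => _root_.deriv (fun t => F t x) u) = fun (u : ℝ) (x : S2) =>
      fderiv ℝ (extT F) (u, (x : E3)) (1, 0) := by
    funext u x
    have := deriv_eq_fderiv_extT hF u x.ne_zero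
    rw [proj_coe] at this
    exact this.deriv
  rw [h2]
  exact h

/-- The chain rule for the restriction of time-dependent data to a cross-section `u = f`. -/
lemma grad_onSection {F : ℝ → S2 → ℝ} (hF : SmoothInTime F) {f : S2 → ℝ} (hf : SmoothFn f)
    (x : S2) (i : Fin 3) : grad (fun y => F (f y) y) x i =
      grad (F (f x)) x i + deriv (fun t => F t x) (f x) * grad f x i := by
  have h : radialExt (fun y => F (f y) y) =ᶠ[𝓝 (x : E3)] fun y => extT F (radialExt f y, y) := by
    filter_upwards [isOpen_ne.mem_nhds x.ne_zero] with y hy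
    simp [radialExt_of_ne _ hy, extT]
  rw [grad_congr_ext h, grad_eq_fderiv_extT hF]
  have h1 : HasFDerivAt (extT F) (fderiv ℝ (extT F) (f x, (x : E3))) (radialExt f x, (x : E3)) := by
    rw [radialExt_coe]
    exact ((hF.ext (p := (f x, (x : E3))) x.ne_zero).differentiableAt (by simp)).hasFDerivAt
  have h2 := (hf.diff x.ne_zero).hasFDerivAt.prodMk (hasFDerivAt_id (x : E3))
  have h3 : HasFDerivAt (fun y : E3 => extT F (radialExt f y, y)) _ (x : E3) :=
    HasFDerivAt.comp (g := extT F) (f := fun y : E3 => (radialExt f y, y)) (x : E3) h1 h2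
  rw [h3.fderiv]
  have h4 := deriv_eq_fderiv_extT hF (f x) x.ne_zero
  rw [proj_coe] at h4
  rw [h4.deriv]
  have h5 : fderiv ℝ (radialExt f) x (e i) = grad f x i := rfl
  simp only [ContinuousLinearMap.comp_apply, ContinuousLinearMap.prod_apply, h5,
    ContinuousLinearMap.id_apply]
  have h6 : ((grad f x i, e i) : ℝ × E3) = (0, e i) + grad f x i • ((1, 0) : ℝ × E3) := by
    simp
  rw [h6, map_add, map_smul]
  simp [mul_comm]

/-- Differentiation in time commutes with the gradient. -/
lemma hasDerivAt_grad {F : ℝ → S2 → ℝ} (hF : SmoothInTime F) (u : ℝ) (x : S2) (i : Fin 3) :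
    HasDerivAt (fun t => grad (F t) x i) (grad (fun y => deriv (fun t => F t y) u) x i) u := by
  have hx : ((u, (x : E3)) : ℝ × E3).2 ≠ 0 := x.ne_zero
  have hd : HasFDerivAt (fderiv ℝ (extT F)) (fderiv ℝ (fderiv ℝ (extT F)) (u, (x : E3)))
      (u, (x : E3)) :=
    (((hF.ext hx).fderiv_right (m := ∞) (by simp)).differentiableAt (by simp)).hasFDerivAt
  have hsymm := (hF.ext hx).isSymmSndFDerivAt
    (by simp only [minSmoothness_of_isRCLikeNormedField]; exact ENat.LEInfty.out)
  have h1 : HasDerivAt (fun t : ℝ => fderiv ℝ (extT F) (t, (x : E3)) (0, e i))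
      (fderiv ℝ (fderiv ℝ (extT F)) (u, (x : E3)) (1, 0) (0, e i)) u := by
    have h2 : HasFDerivAt (fun t : ℝ => (t, (x : E3))) (ContinuousLinearMap.inl ℝ ℝ E3) u :=
      hasFDerivAt_prodMk_left u _
    have h3 : HasFDerivAt (fun t : ℝ => fderiv ℝ (extT F) (t, (x : E3))) _ u := hd.comp u h2
    have h4 := h3.hasDerivAt
    have h5 := h4.clm_apply (hasDerivAt_const u ((0, e i) : ℝ × E3))
    simpa using h5
  have h7 : grad (fun y => deriv (fun t => F t y) u) x i =
      fderiv ℝ (fderiv ℝ (extT F)) (u, (x : E3)) (0, e i) (1, 0) := by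
    have h : radialExt (fun y => deriv (fun t => F t y) u) =ᶠ[𝓝 (x : E3)]
        fun y => fderiv ℝ (extT F) (u, y) (1, 0) := by
      filter_upwards [isOpen_ne.mem_nhds x.ne_zero] with y hy
      rw [radialExt_of_ne _ hy]
      exact (deriv_eq_fderiv_extT hF u hy).deriv
    rw [grad_congr_ext h]
    have h2 : HasFDerivAt (fun y : E3 => (u, y)) (ContinuousLinearMap.inr ℝ ℝ E3) (x : E3) :=
      hasFDerivAt_prodMk_right u (x : E3)
    have h3 : HasFDerivAt (fun y : E3 => fderiv ℝ (extT F) (u, y)) _ (x : E3) := hd.comp (x : E3) h2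
    have h5 := h3.clm_apply (hasFDerivAt_const ((1, 0) : ℝ × E3) (x : E3))
    rw [h5.fderiv]
    simp
  rw [h7, hsymm.eq]
  simpa only [grad_eq_fderiv_extT hF] using h1

/-- The commutator of the Cartesian components of the tangential gradient. -/
lemma grad_grad_comm {f : S2 → ℝ} (hf : SmoothFn f) (x : S2) (i j : Fin 3) :
    grad (fun y => grad f y j) x i - grad (fun y => grad f y i) x j =
      (x : E3) i * grad f x j - (x : E3) j * grad f x i := by
  have key : ∀ i j : Fin 3, grad (fun y => grad f y j) x i = (x : E3) i * grad f x j +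
      fderiv ℝ (fderiv ℝ (radialExt f)) x (e i) (e j) := by
    intro i j
    have h : radialExt (fun y => grad f y j) =ᶠ[𝓝 (x : E3)]
        fun y => ‖y‖ * fderiv ℝ (radialExt f) y (e j) := by
      filter_upwards [isOpen_ne.mem_nhds x.ne_zero] with y hy
      have hn : 0 < ‖y‖⁻¹ := inv_pos.mpr (norm_pos_iff.mpr hy)
      rw [radialExt_of_ne _ hy, grad, proj_of_ne hy]
      have h1 : (fun z => radialExt f (‖y‖⁻¹ • z)) = radialExt f := by
        funext z; exact radialExt_smul f hn z
      have h2 := fderiv_comp_smul (𝕜 := ℝ) (f := radialExt f) (x := y) (‖y‖⁻¹)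
      rw [h1] at h2
      rw [h2]
      have : ‖y‖ ≠ 0 := norm_ne_zero_iff.mpr hy
      simp only [smul_apply, smul_eq_mul]
      field_simp
    rw [grad_congr_ext h]
    have hn : HasFDerivAt (fun y : E3 => ‖y‖) (innerSL ℝ (x : E3)) (x : E3) := by
      have h1 : HasFDerivAt (fun y : E3 => ‖y‖ ^ 2) (2 • innerSL ℝ (x : E3)) (x : E3) :=
        (hasStrictFDerivAt_norm_sq (x : E3)).hasFDerivAt
      have h2 := h1.sqrt (by rw [x.norm_eq]; norm_num)
      simp only [norm_nonneg, Real.sqrt_sq, x.norm_eq] at h2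
      have h3 : (1 / (2 * √((1 : ℝ) ^ 2))) • 2 • innerSL ℝ (x : E3) = innerSL ℝ (x : E3) := by
        rw [two_smul, ← two_smul ℝ, smul_smul]
        norm_num
      rwa [h3] at h2
    have hd : HasFDerivAt (fderiv ℝ (radialExt f)) (fderiv ℝ (fderiv ℝ (radialExt f)) x) (x : E3) :=
      (((hf.ext x.ne_zero).fderiv_right (m := ∞) (by simp)).differentiableAt
        (by simp)).hasFDerivAt
    have h5 := hn.fun_mul (hd.clm_apply (hasFDerivAt_const (e j) (x : E3)))
    rw [h5.fderiv]
    simp [x.norm_eq, grad, e, EuclideanSpace.inner_single_right]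
    ring
  have hsymm := (hf.ext x.ne_zero).isSymmSndFDerivAt
    (by simp only [minSmoothness_of_isRCLikeNormedField]; exact ENat.LEInfty.out)
  rw [key i j, key j i, hsymm.eq (e i) (e j)]
  ring

/-! ### Integration on the sphere -/

/-- The area measure of the sphere. -/
abbrev area : Measure S2 := (volume : Measure E3).toSphere

lemma integrable_area {f : S2 → ℝ} (hf : Continuous f) : Integrable f area :=
  hf.integrable_of_hasCompactSupport (HasCompactSupport.of_compactSpace f)

lemma sphereIntegral_add {f g : S2 → ℝ} (hf : Continuous f) (hg : Continuous g) :
    sphereIntegral (fun x => f x + g x) = sphereIntegral f + sphereIntegral g :=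
  integral_add (integrable_area hf) (integrable_area hg)

lemma sphereIntegral_sub {f g : S2 → ℝ} (hf : Continuous f) (hg : Continuous g) :
    sphereIntegral (fun x => f x - g x) = sphereIntegral f - sphereIntegral g :=
  integral_sub (integrable_area hf) (integrable_area hg)

lemma sphereIntegral_const_mul (c : ℝ) (f : S2 → ℝ) :
    sphereIntegral (fun x => c * f x) = c * sphereIntegral f := integral_const_mul c f

lemma sphereIntegral_neg (f : S2 → ℝ) :
    sphereIntegral (fun x => - f x) = - sphereIntegral f := integral_neg f

lemma sphereIntegral_sum {ι : Type} {s : Finset ι} {f : ι → S2 → ℝ} (hf : ∀ i, Continuous (f i)) :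
    sphereIntegral (fun x => ∑ i ∈ s, f i x) = ∑ i ∈ s, sphereIntegral (f i) :=
  integral_finsetSum s fun i _ => integrable_area (hf i)

lemma sphereIntegral_mono {f g : S2 → ℝ} (hf : Continuous f) (hg : Continuous g)
    (h : ∀ x, f x ≤ g x) : sphereIntegral f ≤ sphereIntegral g :=
  integral_mono (integrable_area hf) (integrable_area hg) h

lemma sphereIntegral_nonneg {f : S2 → ℝ} (h : ∀ x, 0 ≤ f x) : 0 ≤ sphereIntegral f :=
  integral_nonneg h

/-- The total area of the sphere. -/
def totalArea : ℝ := sphereIntegral (fun _ => 1)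

lemma sphereIntegral_const (c : ℝ) : sphereIntegral (fun _ => c) = c * totalArea := by
  rw [totalArea, ← sphereIntegral_const_mul]
  simp

lemma totalArea_pos : 0 < totalArea := by
  have : (area : Measure S2) ≠ 0 := Measure.toSphere_ne_zero _
  unfold totalArea sphereIntegral
  simp only [integral_const, smul_eq_mul, mul_one]
  rw [measureReal_def, ENNReal.toReal_pos_iff]
  exact ⟨by rwa [pos_iff_ne_zero, ne_eq, Measure.measure_univ_eq_zero], measure_lt_top _ _⟩

lemma abs_sphereIntegral_le {f g : S2 → ℝ} (hg : Continuous g)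
    (h : ∀ x, |f x| ≤ g x) : |sphereIntegral f| ≤ sphereIntegral g := by
  have := norm_integral_le_of_norm_le (μ := area) (f := f) (integrable_area hg)
    (Eventually.of_forall h)
  exact this

lemma eq_zero_of_sphereIntegral_sq {f : S2 → ℝ} (hf : Continuous f)
    (h : sphereIntegral (fun x => f x ^ 2) = 0) (x : S2) : f x = 0 := by
  have h1 := (integral_eq_zero_iff_of_nonneg (μ := area) (f := fun x => f x ^ 2)
    (fun x => sq_nonneg _) (integrable_area (hf.pow 2))).mp h
  have h2 : (fun x => f x ^ 2) = fun _ => (0 : ℝ) :=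
    Continuous.ae_eq_iff_eq area (hf.pow 2) continuous_const |>.mp h1
  have := congrFun h2 x
  simpa using this

/-! #### Rotation invariance -/

/-- The action of a linear isometry on the sphere. -/
def isoS (A : E3 ≃ₗᵢ[ℝ] E3) (x : S2) : S2 := ⟨A x, by simp⟩

lemma continuous_isoS (A : E3 ≃ₗᵢ[ℝ] E3) : Continuous (isoS A) :=
  (A.continuous.comp continuous_subtype_val).subtype_mk _

open scoped Pointwise in
lemma measurePreserving_isoS (A : E3 ≃ₗᵢ[ℝ] E3) : MeasurePreserving (isoS A) area area := by
  refine ⟨(continuous_isoS A).measurable, ?_⟩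
  ext s hs
  rw [Measure.map_apply (continuous_isoS A).measurable hs, Measure.toSphere_apply' _ hs,
    Measure.toSphere_apply' _ ((continuous_isoS A).measurable hs)]
  congr 1
  have h : A ⁻¹' (Ioo (0 : ℝ) 1 • ((fun x : S2 => (x : E3)) '' s)) =
      Ioo (0 : ℝ) 1 • ((fun x : S2 => (x : E3)) '' (isoS A ⁻¹' s)) := by
    ext y
    simp only [mem_preimage, Set.mem_smul, mem_image]
    constructor
    · rintro ⟨r, hr, _, ⟨z, hz, rfl⟩, hy⟩
      refine ⟨r, hr, A.symm z, ⟨isoS A.symm z, ?_, rfl⟩, ?_⟩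
      · have : isoS A (isoS A.symm z) = z := by
          apply Subtype.ext; simp [isoS]
        rwa [this]
      · rw [← map_smul, hy]; simp
    · rintro ⟨r, hr, _, ⟨z, hz, rfl⟩, rfl⟩
      exact ⟨r, hr, _, ⟨isoS A z, hz, rfl⟩, by simp [isoS]⟩
  refine (congrArg volume h.symm).trans ?_
  exact ((A.measurePreserving).measure_preimage_equiv (f := A.toMeasurableEquiv) _)

lemma sphereIntegral_isoS (A : E3 ≃ₗᵢ[ℝ] E3) {f : S2 → ℝ} (hf : Continuous f) :
    sphereIntegral (fun x => f (isoS A x)) = sphereIntegral f := by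
  have h := integral_map (μ := area) (φ := isoS A) (continuous_isoS A).aemeasurable (f := f)
    (by rw [(measurePreserving_isoS A).map_eq]; exact (integrable_area hf).aestronglyMeasurable)
  rw [(measurePreserving_isoS A).map_eq] at h
  exact h.symm

/-- The reflection of the sphere that fixes the axis spanned by `v`. -/
def refl (v : E3) : E3 ≃ₗᵢ[ℝ] E3 := Submodule.reflection (ℝ ∙ v)

lemma refl_apply (v z : E3) : refl v z = (2 * (inner ℝ v z / ‖v‖ ^ 2)) • v - z := by
  rw [refl, Submodule.reflection_singleton_apply, two_smul, ← two_smul ℝ, smul_smul]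
  rfl

/-! #### Differentiation under the integral -/

lemma exists_bound {F : ℝ → S2 → ℝ} (hF : SmoothInTime F) (a b : ℝ) :
    ∃ K, 0 ≤ K ∧ ∀ u ∈ Icc a b, ∀ x, |F u x| ≤ K := by
  obtain ⟨K, hK⟩ := (isCompact_Icc (a := a) (b := b)).prod (isCompact_univ (X := S2))
    |>.exists_bound_of_continuousOn hF.continuous.continuousOn
  refine ⟨|K|, abs_nonneg K, fun u hu x => ?_⟩
  exact (hK (u, x) ⟨hu, mem_univ _⟩).trans (le_abs_self K)

lemma hasDerivAt_sphereIntegral {F : ℝ → S2 → ℝ} (hF : SmoothInTime F) (u : ℝ) :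
    HasDerivAt (fun t => sphereIntegral (F t))
      (sphereIntegral (fun x => deriv (fun t => F t x) u)) u := by
  obtain ⟨K, _, hK⟩ := exists_bound hF.deriv (u - 1) (u + 1)
  refine (hasDerivAt_integral_of_dominated_loc_of_deriv_le (μ := area) (F := F)
    (F' := fun t x => deriv (fun t => F t x) t) (bound := fun _ => K) (x₀ := u)
    (Icc_mem_nhds (a := u - 1) (b := u + 1) (by linarith) (by linarith))
    (Eventually.of_forall fun t => ?_) (integrable_area (hF.at u).continuous) ?_
    (Eventually.of_forall fun x t ht => hK t ht x) (integrable_const K)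
    (Eventually.of_forall fun x t _ => hF.hasDerivAt t x)).2
  · exact (integrable_area (hF.at t).continuous).aestronglyMeasurable
  · exact (integrable_area (hF.deriv.at u).continuous).aestronglyMeasurable

/-! #### Integration by parts -/

/-- Rotation fields have divergence zero: the rotations about an axis preserve the area measure. -/
lemma sphereIntegral_rotation {f : S2 → ℝ} (hf : SmoothFn f) (i j : Fin 3) :
    sphereIntegral (fun x => (x : E3) i * grad f x j - (x : E3) j * grad f x i) = 0 := by
  rcases eq_or_ne i j with rfl | hij
  · simp [sphereIntegral]
  set v : ℝ → E3 := fun t => e i + t • e j with hv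
  have hnorm : ∀ t, ‖v t‖ ^ 2 = 1 + t ^ 2 := by
    intro t
    rw [hv, EuclideanSpace.real_norm_sq_eq]
    fin_cases i <;> fin_cases j <;> simp_all [Fin.sum_univ_three, e] <;> ring
  have hpos : ∀ t, (‖v t‖ ^ 2) ≠ 0 := fun t => by rw [hnorm]; positivity
  have hvd : ContDiff ℝ ∞ v := by
    exact contDiff_const.add (contDiff_id.smul contDiff_const)
  -- The reflections fixing the axes spanned by `v t = e i + t e j` preserve the area measure. At
  -- `t = 0` their velocity is twice the rotation field composed with the reflection.
  have hsm : SmoothInTime (fun t x => f (isoS (refl (v t)) x)) := by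
    have h := smoothInTime_of_ext
      (G := fun p => radialExt f ((2 * (inner ℝ (v p.1) p.2 / ‖v p.1‖ ^ 2)) • v p.1 - p.2)) (by
      intro p hp
      have h0 : (2 * (inner ℝ (v p.1) p.2 / ‖v p.1‖ ^ 2)) • v p.1 - p.2 ≠ 0 := by
        rw [← refl_apply]
        simpa using hp
      have h1 : ContDiffAt ℝ ∞
          (fun p : ℝ × E3 => (2 * (inner ℝ (v p.1) p.2 / ‖v p.1‖ ^ 2)) • v p.1 - p.2) p := by
        have hv1 : ContDiffAt ℝ ∞ (fun p : ℝ × E3 => v p.1) p :=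
          (hvd.comp contDiff_fst).contDiffAt
        exact ((contDiffAt_const.mul ((hv1.inner ℝ contDiffAt_snd).div (hv1.norm_sq ℝ)
          (hpos _))).smul hv1).sub contDiffAt_snd
      exact ContDiffAt.comp (g := radialExt f) p (hf.ext h0) h1)
    convert h using 3 with t x
    rw [← refl_apply, ← radialExt_coe f]
    rfl
  have hc : ∀ t, sphereIntegral (fun x => f (isoS (refl (v t)) x)) = sphereIntegral f :=
    fun t => sphereIntegral_isoS _ hf.continuous
  have h1 := hasDerivAt_sphereIntegral hsm 0
  simp only [hc] at h1
  have h2 := h1.unique (hasDerivAt_const 0 (sphereIntegral f))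
  have h3 : ∀ x : S2, deriv (fun t => f (isoS (refl (v t)) x)) 0 =
      2 * (fun w : S2 => (w : E3) i * grad f w j - (w : E3) j * grad f w i)
        (isoS (refl (v 0)) x) := by
    intro x
    have hvi : ∀ (t : ℝ) (z : E3), inner ℝ (v t) z = z i + t * z j := by
      intro t z
      simp [hv, inner_add_left, inner_smul_left, EuclideanSpace.inner_single_left]
    set w : S2 := isoS (refl (v 0)) x with hw
    have hwc : (w : E3) = (2 * (x : E3) i) • e i - (x : E3) := by
      have : (w : E3) = refl (v 0) x := rfl
      rw [this, refl_apply, hvi, hnorm]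
      simp [hv]
    have hwi : (w : E3) i = (x : E3) i := by rw [hwc]; simp [e]; ring
    have hwj : (w : E3) j = - (x : E3) j := by rw [hwc]; simp [e, hij.symm]
    have hd : HasDerivAt (fun t => (2 * ((x : E3) i + t * (x : E3) j)) • v t -
        (1 + t ^ 2) • (x : E3)) ((2 * (x : E3) j) • e i + (2 * (x : E3) i) • e j) 0 := by
      have a : HasDerivAt (fun t : ℝ => 2 * ((x : E3) i + t * (x : E3) j)) (2 * (x : E3) j) 0 := by
        have := (((hasDerivAt_id (0 : ℝ)).mul_const ((x : E3) j)).const_add ((x : E3) i)).const_mul 2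
        simpa using this
      have b : HasDerivAt v (e j) 0 := by
        have := ((hasDerivAt_id (0 : ℝ)).smul_const (e j)).const_add (e i)
        simp only [one_smul] at this
        exact this
      have c : HasDerivAt (fun t : ℝ => 1 + t ^ 2) 0 0 := by
        have := (hasDerivAt_pow 2 (0 : ℝ)).const_add 1
        simpa using this
      have d := (a.fun_smul b).fun_sub (c.smul_const (x : E3))
      have h5 : (2 * ((x : E3) i + 0 * (x : E3) j)) • e j + (2 * (x : E3) j) • v 0 -
          (0 : ℝ) • (x : E3) = (2 * (x : E3) j) • e i + (2 * (x : E3) i) • e j := by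
        simp [hv, add_comm]
      rwa [h5] at d
    -- the factor `1 + t²` clears the denominator of the reflection, `radialExt f` being homogeneous
    have heq : (fun t => f (isoS (refl (v t)) x)) = fun t => radialExt f
        ((2 * ((x : E3) i + t * (x : E3) j)) • v t - (1 + t ^ 2) • (x : E3)) := by
      funext t
      have hp : (0 : ℝ) < 1 + t ^ 2 := by positivity
      rw [← radialExt_coe f, ← radialExt_smul f hp]
      congr 1
      have : ((isoS (refl (v t)) x : S2) : E3) = refl (v t) x := rfl
      rw [this, refl_apply, hvi, hnorm, smul_sub, smul_smul]
      congr 2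
      field_simp
    rw [heq]
    have hw0 : (2 * ((x : E3) i + 0 * (x : E3) j)) • v 0 - (1 + (0 : ℝ) ^ 2) • (x : E3) = w := by
      rw [hwc]; simp [hv]
    have hg : HasFDerivAt (radialExt f) (fderiv ℝ (radialExt f) w)
        ((2 * ((x : E3) i + 0 * (x : E3) j)) • v 0 - (1 + (0 : ℝ) ^ 2) • (x : E3)) := by
      rw [hw0]; exact (hf.diff w.ne_zero).hasFDerivAt
    have h4 : HasDerivAt (fun t => radialExt f
        ((2 * ((x : E3) i + t * (x : E3) j)) • v t - (1 + t ^ 2) • (x : E3))) _ 0 :=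
      HasFDerivAt.comp_hasDerivAt (l := radialExt f) (f := fun t =>
        (2 * ((x : E3) i + t * (x : E3) j)) • v t - (1 + t ^ 2) • (x : E3)) 0 hg hd
    rw [h4.deriv, map_add, map_smul, map_smul]
    simp only [hwi, hwj, grad, smul_eq_mul]
    ring
  simp only [h3] at h2
  rw [sphereIntegral_const_mul] at h2
  have hcont : Continuous
      (fun w : S2 => (w : E3) i * grad f w j - (w : E3) j * grad f w i) :=
    (((smoothFn_coord i).mul (hf.grad j)).sub ((smoothFn_coord j).mul (hf.grad i))).continuous
  rw [sphereIntegral_isoS (refl (v 0)) hcont] at h2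
  linarith

lemma q_contract (x : S2) (j : Fin 3) : ∑ i, (x : E3) i * q x j i = 0 := by
  have h := x.sum_sq
  simp only [q, Fin.sum_univ_three]
  fin_cases j <;> simp
  · linear_combination (-(x : E3) 0) * h
  · linear_combination (-(x : E3) 1) * h
  · linear_combination (-(x : E3) 2) * h

lemma q_trace (x : S2) : ∑ i, q x i i = 2 := by
  have h := x.sum_sq
  simp only [q, Fin.sum_univ_three]
  simp
  linarith

/-- The divergence theorem for `f e_i`; the right-hand side comes from the mean curvature of the
sphere. -/
lemma sphereIntegral_grad {f : S2 → ℝ} (hf : SmoothFn f) (j : Fin 3) :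
    sphereIntegral (fun x => grad f x j) = 2 * sphereIntegral (fun x => f x * (x : E3) j) := by
  -- sum over `i` of the vanishing integrals of the rotation fields applied to `f x_i`
  have h : ∀ i, sphereIntegral (fun x =>
      (x : E3) i * grad (fun y => f y * (y : E3) i) x j -
      (x : E3) j * grad (fun y => f y * (y : E3) i) x i) = 0 :=
    fun i => sphereIntegral_rotation (hf.mul (smoothFn_coord i)) i j
  have hs : ∀ i, SmoothFn (fun x => (x : E3) i * grad (fun y => f y * (y : E3) i) x j -
      (x : E3) j * grad (fun y => f y * (y : E3) i) x i) := fun i =>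
    ((smoothFn_coord i).mul ((hf.mul (smoothFn_coord i)).grad j)).sub
      ((smoothFn_coord j).mul ((hf.mul (smoothFn_coord i)).grad i))
  have h2 := sphereIntegral_sum (s := Finset.univ) (fun i => (hs i).continuous)
  simp only [h, Finset.sum_const_zero] at h2
  have h3 : ∀ x : S2, (∑ i, ((x : E3) i * grad (fun y => f y * (y : E3) i) x j -
      (x : E3) j * grad (fun y => f y * (y : E3) i) x i)) =
      grad f x j - 2 * (f x * (x : E3) j) := by
    intro x
    simp only [grad_mul hf (smoothFn_coord _), grad_coord]
    have a := x.sum_sq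
    have b := grad_tangential hf x
    have c := q_contract x j
    have d := q_trace x
    simp only [Fin.sum_univ_three] at b c d ⊢
    linear_combination grad f x j * a - (x : E3) j * b + f x * c - (x : E3) j * f x * d
  simp only [h3] at h2
  rw [sphereIntegral_sub (hf.grad j).continuous
    ((hf.mul (smoothFn_coord j)).const_mul 2).continuous, sphereIntegral_const_mul] at h2
  linarith

/-- The divergence theorem for tangential fields. -/
lemma sphereIntegral_div {V : Field1} (hV : ∀ i, SmoothFn (fun x => V x i))
    (ht : ∀ x, ∑ i, V x i * (x : E3) i = 0) :
    sphereIntegral (fun x => ∑ i, grad (fun y => V y i) x i) = 0 := by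
  rw [sphereIntegral_sum fun i => ((hV i).grad i).continuous]
  simp only [sphereIntegral_grad (hV _)]
  rw [← Finset.mul_sum, ← sphereIntegral_sum fun i => ((hV i).mul (smoothFn_coord i)).continuous]
  simp only [ht]
  simp [sphereIntegral]

/-! ### Smooth dependence of integrals on parameters -/

/-- An integral over a compact set depends smoothly on the parameters of its integrand. -/
lemma contDiffOn_integral_param {G P : Type} [NormedAddCommGroup G] [NormedSpace ℝ G]
    [FiniteDimensional ℝ G] [MeasurableSpace G] [BorelSpace G] [NormedAddCommGroup P]
    [NormedSpace ℝ P] {μ : Measure G} {k : G → ℝ} (hk : LocallyIntegrable k μ)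
    {Φ : P × G → ℝ} {s : Set P} (hs : IsOpen s) {c W : Set G} (hc : IsCompact c)
    (hW : IsOpen W) (hcW : c ⊆ W) (hμ : ∀ᵐ z ∂μ, z ∈ c)
    (hΦ : ∀ p ∈ s, ∀ z ∈ W, ContDiffAt ℝ ∞ Φ (p, z)) :
    ContDiffOn ℝ ∞ (fun p => ∫ z, k z * Φ (p, z) ∂μ) s := by
  -- With a cutoff `χ` the integral becomes a convolution, evaluated at `0`, of `k` with the reflection
  -- of a smooth compactly supported function.
  obtain ⟨t, ht, hct, htW⟩ := exists_compact_between hc hW hcW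
  obtain ⟨χ, h1, h0, -⟩ := exists_contMDiffMap_one_nhds_of_subset_interior (n := ⊤) 𝓘(ℝ, G)
    hc.isClosed hct
  have hχ : ContDiff ℝ ∞ χ := χ.contMDiff.contDiff
  have hχ1 : ∀ z ∈ c, χ z = 1 := fun z hz => (h1.self_of_nhdsSet) z hz
  have hg : ContDiffOn ℝ ∞ (fun r : P × G => χ (-r.2) * Φ (r.1, -r.2)) (s ×ˢ univ) := by
    rintro ⟨p, z⟩ ⟨hp, -⟩
    apply ContDiffAt.contDiffWithinAt
    by_cases hz : -z ∈ W
    · have a : ContDiffAt ℝ ∞ (fun r : P × G => (r.1, -r.2)) (p, z) := by fun_prop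
      have b : ContDiffAt ℝ ∞ (fun r : P × G => χ (-r.2)) (p, z) :=
        (hχ.comp (by fun_prop : ContDiff ℝ ∞ fun r : P × G => -r.2)).contDiffAt
      exact b.mul (ContDiffAt.comp (g := Φ) (f := fun r : P × G => (r.1, -r.2)) (p, z)
        (hΦ p hp (-z) hz) a)
    · have hz' : -z ∈ tᶜ := fun h => hz (htW h)
      have hn : {r : P × G | -r.2 ∈ tᶜ} ∈ 𝓝 (p, z) :=
        (ht.isClosed.isOpen_compl.preimage (continuous_snd.neg)).mem_nhds hz'
      refine (contDiffAt_const (c := (0 : ℝ))).congr_of_eventuallyEq ?_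
      filter_upwards [hn] with r hr
      rw [h0 _ hr, zero_mul]
  have key := contDiffOn_convolution_right_with_param_comp (μ := μ) (n := ⊤) (𝕜 := ℝ)
    (ContinuousLinearMap.mul ℝ ℝ) (v := fun _ : P => (0 : G)) contDiffOn_const hs
    (f := k) (g := fun p z => χ (-z) * Φ (p, -z)) (k := -t) ht.neg ?_ hk hg
  · refine key.congr fun p hp => ?_
    rw [convolution_def]
    refine integral_congr_ae ?_
    filter_upwards [hμ] with z hz
    simp [hχ1 z hz]
  · intro p z _ hz
    have : -z ∉ t := by simpa using hz
    rw [h0 _ this, zero_mul]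

/-- The primitive in time of a time-dependent function, vanishing at `u = 0`. -/
def prim (F : ℝ → S2 → ℝ) (u : ℝ) (x : S2) : ℝ := ∫ s in (0 : ℝ)..u, F s x

lemma continuous_time {F : ℝ → S2 → ℝ} (hF : SmoothInTime F) (x : S2) :
    Continuous (fun s => F s x) := hF.continuous.comp (continuous_id.prodMk continuous_const)

lemma prim_hasDerivAt {F : ℝ → S2 → ℝ} (hF : SmoothInTime F) (u : ℝ) (x : S2) :
    HasDerivAt (fun t => prim F t x) (F u x) u :=
  intervalIntegral.integral_hasDerivAt_right ((continuous_time hF x).intervalIntegrable _ _)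
    ((continuous_time hF x).stronglyMeasurableAtFilter _ _) (continuous_time hF x).continuousAt

lemma SmoothInTime.prim {F : ℝ → S2 → ℝ} (hF : SmoothInTime F) : SmoothInTime (prim F) := by
  have h := contDiffOn_integral_param (G := ℝ) (P := ℝ × E3)
    (μ := volume.restrict (Icc 0 1)) (k := fun _ => 1)
    (Φ := fun r => extT F (r.2 * r.1.1, r.1.2)) (s := {p | p.2 ≠ 0}) (c := Icc 0 1) (W := univ)
    (integrable_const _).locallyIntegrable (isOpen_ne.preimage continuous_snd)
    isCompact_Icc isOpen_univ (subset_univ _) (ae_restrict_mem measurableSet_Icc) (by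
      intro p hp z _
      have a : ContDiffAt ℝ ∞ (fun r : (ℝ × E3) × ℝ => (r.2 * r.1.1, r.1.2)) (p, z) := by
        fun_prop
      exact ContDiffAt.comp (g := extT F) (p, z) (hF.ext (p := (z * p.1, p.2)) hp) a)
  have h2 := smoothInTime_of_ext
    (G := fun p : ℝ × E3 => p.1 * ∫ z in Icc (0 : ℝ) 1, 1 * extT F (z * p.1, p.2)) (by
      intro p hp
      exact contDiffAt_fst.mul
        (h.contDiffAt ((isOpen_ne.preimage continuous_snd).mem_nhds hp)))
  convert h2 using 3 with u x
  simp only [NullInfinity.prim, one_mul, extT, radialExt_coe]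
  rw [integral_Icc_eq_integral_Ioc, ← intervalIntegral.integral_of_le zero_le_one]
  have := intervalIntegral.mul_integral_comp_mul_right (f := fun s => F s x) (a := 0) (b := 1) u
  simpa using this.symm

/-! ### The Green operator of `D² (D² + 2)` -/

/-- The kernel `(1 - t) log (1 - t)`, which is continuous up to `t = 1`. -/
def green (t : ℝ) : ℝ := (1 - t) * Real.log (1 - t)

lemma continuous_green : Continuous green :=
  Real.continuous_mul_log.comp (continuous_const.sub continuous_id)

/-- The Green operator `h ↦ ∫ (1 - x·y) log (1 - x·y) h(y)`. -/
def greenOp (h : S2 → ℝ) (x : S2) : ℝ :=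
  sphereIntegral (fun y => green (inner ℝ (x : E3) (y : E3)) * h y)

/-- The Green operator preserves smoothness: its kernel is rotation invariant, and a point `p`
near `x₀` is moved to `x₀` by the reflection along the bisector of `p` and `x₀`. -/
lemma SmoothFn.greenOp {h : S2 → ℝ} (hh : SmoothFn h) : SmoothFn (greenOp h) := by
  have hcoe : Continuous (fun y : S2 => (y : E3)) := continuous_subtype_val
  have hemb : MeasurableEmbedding (fun y : S2 => (y : E3)) :=
    MeasurableEmbedding.subtype_coe Metric.isClosed_sphere.measurableSet
  have key : ∀ y₀ : E3, y₀ ≠ 0 → ContDiffAt ℝ ∞ (fun p => NullInfinity.greenOp h (proj p)) y₀ := by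
    intro y₀ hy₀
    set x₀ : S2 := proj y₀ with hx₀
    -- `refl (v p)` exchanges `x₀` and `proj p`; it depends smoothly on `p` where `v p ≠ 0`
    set v : E3 → E3 := fun p => ‖p‖⁻¹ • p + x₀ with hv
    set s : Set E3 := {p | p ≠ 0 ∧ v p ≠ 0} with hs
    have hvc : ∀ p : E3, p ≠ 0 → ContDiffAt ℝ ∞ v p := fun p hp =>
      (((contDiffAt_norm ℝ hp).inv (norm_ne_zero_iff.mpr hp)).smul contDiffAt_id).add
        contDiffAt_const
    have hso : IsOpen s := by
      rw [isOpen_iff_mem_nhds]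
      rintro p ⟨hp, hvp⟩
      filter_upwards [isOpen_ne.mem_nhds hp,
        (hvc p hp).continuousAt.eventually_ne hvp] with r h1 h2 using ⟨h1, h2⟩
    have hy₀s : y₀ ∈ s := by
      refine ⟨hy₀, ?_⟩
      have h1 : v y₀ = (2 : ℝ) • (x₀ : E3) := by
        simp only [hv]
        rw [← proj_of_ne hy₀, two_smul]
      rw [h1]
      exact smul_ne_zero two_ne_zero x₀.ne_zero
    have hcd := contDiffOn_integral_param (G := E3) (P := E3)
      (μ := area.map (fun y : S2 => (y : E3)))
      (k := fun z => green (inner ℝ (x₀ : E3) z))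
      (Φ := fun r => radialExt h ((2 * (inner ℝ (v r.1) r.2 / ‖v r.1‖ ^ 2)) • v r.1 - r.2))
      (s := s) (c := Metric.sphere 0 1) (W := {0}ᶜ)
      ((continuous_green.comp (continuous_const.inner continuous_id)).locallyIntegrable) hso
      (isCompact_sphere 0 1) isOpen_compl_singleton
      (fun z hz h0 => by simp only [mem_singleton_iff] at h0; simp [h0] at hz)
      (by
        rw [hemb.ae_map_iff]
        exact Eventually.of_forall fun y => y.2)
      (by
        rintro p ⟨hp, hvp⟩ z hz
        have h0 : (2 * (inner ℝ (v p) z / ‖v p‖ ^ 2)) • v p - z ≠ 0 := by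
          rw [← refl_apply]
          simpa using hz
        have hv1 : ContDiffAt ℝ ∞ (fun r : E3 × E3 => v r.1) (p, z) :=
          ContDiffAt.comp (g := v) (p, z) (hvc p hp) contDiffAt_fst
        have hn : ‖v p‖ ^ 2 ≠ 0 := pow_ne_zero 2 (norm_ne_zero_iff.mpr hvp)
        have h1 : ContDiffAt ℝ ∞ (fun r : E3 × E3 =>
            (2 * (inner ℝ (v r.1) r.2 / ‖v r.1‖ ^ 2)) • v r.1 - r.2) (p, z) :=
          ((contDiffAt_const.mul ((hv1.inner ℝ contDiffAt_snd).div (hv1.norm_sq ℝ)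
            hn)).smul hv1).sub contDiffAt_snd
        exact ContDiffAt.comp (g := radialExt h) (p, z) (hh.ext h0) h1)
    refine (hcd.contDiffAt (hso.mem_nhds hy₀s)).congr_of_eventuallyEq ?_
    filter_upwards [hso.mem_nhds hy₀s] with p hp
    rw [hemb.integral_map]
    have hpx : (refl (v p)) x₀ = proj p := by
      have hpp : ‖p‖⁻¹ • p = (proj p : E3) := (proj_of_ne hp.1).symm
      have hvp : v p = (proj p : E3) + x₀ := by simp only [hv, hpp]
      have h1 : ‖v p‖ ^ 2 = 2 * inner ℝ (v p) (x₀ : E3) := by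
        rw [hvp, norm_add_sq_real, inner_add_left, (proj p).norm_eq, x₀.norm_eq,
          real_inner_self_eq_norm_sq, x₀.norm_eq]
        ring
      have h2 : ‖v p‖ ^ 2 ≠ 0 := pow_ne_zero 2 (norm_ne_zero_iff.mpr hp.2)
      have h3 : 2 * (inner ℝ (v p) (x₀ : E3) / ‖v p‖ ^ 2) = 1 := by
        rw [← mul_div_assoc, ← h1, div_self h2]
      rw [refl_apply, h3, one_smul, hvp, add_sub_cancel_right]
    have hf : Continuous (fun y : S2 => green (inner ℝ (proj p : E3) (y : E3)) * h y) :=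
      (continuous_green.comp (continuous_const.inner hcoe)).mul hh.continuous
    rw [NullInfinity.greenOp, ← sphereIntegral_isoS (refl (v p)) hf, sphereIntegral]
    refine integral_congr_ae (Eventually.of_forall fun y => ?_)
    have hy : ((isoS (refl (v p)) y : S2) : E3) = refl (v p) y := rfl
    simp only [hy]
    rw [← hpx, LinearIsometryEquiv.inner_map_map, ← refl_apply, ← hy, radialExt_coe]
  have h2 := smoothFn_of_ext key
  simpa only [proj_coe] using h2

/-! ### Tangential fields in Cartesian components -/

/-- Smooth tangential covector fields. -/
structure IsTan (V : Field1) : Prop where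
  smooth : ∀ i, SmoothFn (fun x => V x i)
  tan : ∀ x, ∑ i, V x i * (x : E3) i = 0

/-- Smooth symmetric traceless tangential two-tensor fields. -/
structure IsSTF (T : Field2) : Prop where
  smooth : ∀ i j, SmoothFn (fun x => T x i j)
  symm : ∀ x i j, T x i j = T x j i
  tan : ∀ x i, ∑ j, T x i j * (x : E3) j = 0
  trace : ∀ x, ∑ i, T x i i = 0

lemma isTan_grad {f : S2 → ℝ} (hf : SmoothFn f) : IsTan (grad f) :=
  ⟨fun i => hf.grad i, fun x => grad_tangential hf x⟩

lemma IsTan.deriv {V : Field1} (hV : IsTan V) (x : S2) (k : Fin 3) :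
    ∑ a, grad (fun y => V y a) x k * (x : E3) a = - V x k := by
  have h : (fun y : S2 => ∑ a, V y a * (y : E3) a) = fun _ => 0 := funext hV.tan
  have h1 := grad_sum (s := Finset.univ) (fun a => (hV.smooth a).mul (smoothFn_coord a)) x k
  rw [h, grad_const] at h1
  simp only [grad_mul (hV.smooth _) (smoothFn_coord _), grad_coord] at h1
  have h2 := hV.tan x
  simp only [q, Fin.sum_univ_three] at h1 h2 ⊢
  fin_cases k <;> simp at h1 ⊢
  · linear_combination -h1 + (x : E3) 0 * h2
  · linear_combination -h1 + (x : E3) 1 * h2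
  · linear_combination -h1 + (x : E3) 2 * h2

/-- The covariant derivative of a tangential covector field in Cartesian components. -/
lemma IsTan.covD1_eq {V : Field1} (hV : IsTan V) (x : S2) (k i : Fin 3) :
    covD1 V x k i = grad (fun y => V y i) x k + (x : E3) i * V x k := by
  have h := hV.deriv x k
  have h2 : ∑ a, (if i = a then (1 : ℝ) else 0) * grad (fun y => V y a) x k =
      grad (fun y => V y i) x k := by simp
  simp only [covD1, q, Fin.sum_univ_three] at h h2 ⊢
  linear_combination h2 - (x : E3) i * h

lemma IsTan.div1_eq {V : Field1} (hV : IsTan V) (x : S2) :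
    div1 V x = ∑ i, grad (fun y => V y i) x i := by
  have h := hV.tan x
  simp only [div1, hV.covD1_eq, Fin.sum_univ_three] at h ⊢
  linear_combination h

lemma hess_eq {f : S2 → ℝ} (hf : SmoothFn f) (x : S2) (k i : Fin 3) :
    hess f x k i = grad (fun y => grad f y i) x k + (x : E3) i * grad f x k :=
  (isTan_grad hf).covD1_eq x k i

lemma lap_eq {f : S2 → ℝ} (hf : SmoothFn f) (x : S2) :
    lap f x = ∑ i, grad (fun y => grad f y i) x i := (isTan_grad hf).div1_eq x

@[fun_prop]
lemma SmoothFn.lap {f : S2 → ℝ} (hf : SmoothFn f) : SmoothFn (lap f) := by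
  have h : NullInfinity.lap f = fun x => ∑ i, NullInfinity.grad (fun y => NullInfinity.grad f y i) x i :=
    funext (lap_eq hf)
  rw [h]
  exact SmoothFn.sum fun i => (hf.grad i).grad i

lemma lap_add {f g : S2 → ℝ} (hf : SmoothFn f) (hg : SmoothFn g) (x : S2) :
    lap (fun y => f y + g y) x = lap f x + lap g x := by
  rw [lap_eq (hf.add hg), lap_eq hf, lap_eq hg, ← Finset.sum_add_distrib]
  refine Finset.sum_congr rfl fun i _ => ?_
  rw [← grad_add (hf.grad i) (hg.grad i)]
  simp only [grad_add hf hg]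

lemma lap_const_mul {f : S2 → ℝ} (hf : SmoothFn f) (c : ℝ) (x : S2) :
    lap (fun y => c * f y) x = c * lap f x := by
  rw [lap_eq (hf.const_mul c), lap_eq hf, Finset.mul_sum]
  refine Finset.sum_congr rfl fun i _ => ?_
  rw [← grad_const_mul (hf.grad i)]
  simp only [grad_const_mul hf]

lemma lap_const (c : ℝ) (x : S2) : lap (fun _ => c) x = 0 := by
  rw [lap_eq (smoothFn_const c)]
  simp only [grad_const]
  simp

lemma lap_coord (j : Fin 3) (x : S2) : lap (fun y => (y : E3) j) x = -2 * (x : E3) j := by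
  rw [lap_eq (smoothFn_coord j)]
  simp only [grad_coord]
  have h : ∀ i, grad (fun y => q y i j) x i = - (q x i i * (x : E3) j + (x : E3) i * q x i j) := by
    intro i
    have h1 := grad_sub (smoothFn_const (if i = j then (1 : ℝ) else 0))
      ((smoothFn_coord i).mul (smoothFn_coord j)) x i
    rw [grad_const, grad_mul (smoothFn_coord i) (smoothFn_coord j), grad_coord, grad_coord] at h1
    simp only [q] at h1 ⊢
    linarith
  simp only [h]
  have hs : ∀ i, q x i j = q x j i := by
    intro i
    simp only [q, eq_comm (a := i), mul_comm]
  have a := q_trace x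
  have b := q_contract x j
  simp only [hs, Fin.sum_univ_three] at a b ⊢
  linear_combination (-(x : E3) j) * a - b

/-- The operator `D² (D² + 2)`. -/
def lap2 (f : S2 → ℝ) : S2 → ℝ := lap (fun y => lap f y + 2 * f y)

lemma SmoothFn.lap_add_two {f : S2 → ℝ} (hf : SmoothFn f) :
    SmoothFn (fun y => NullInfinity.lap f y + 2 * f y) := hf.lap.add (hf.const_mul 2)

@[fun_prop]
lemma SmoothFn.lap2 {f : S2 → ℝ} (hf : SmoothFn f) : SmoothFn (lap2 f) := hf.lap_add_two.lap

lemma lap2_add {f g : S2 → ℝ} (hf : SmoothFn f) (hg : SmoothFn g) (x : S2) :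
    lap2 (fun y => f y + g y) x = lap2 f x + lap2 g x := by
  rw [lap2, lap2, lap2, ← lap_add hf.lap_add_two hg.lap_add_two]
  congr 1
  funext y
  rw [lap_add hf hg]
  ring

lemma lap2_const_mul {f : S2 → ℝ} (hf : SmoothFn f) (c : ℝ) (x : S2) :
    lap2 (fun y => c * f y) x = c * lap2 f x := by
  rw [lap2, lap2, ← lap_const_mul hf.lap_add_two]
  congr 1
  funext y
  rw [lap_const_mul hf]
  ring

lemma lap2_const (c : ℝ) (x : S2) : lap2 (fun _ => c) x = 0 := by
  simp only [lap2, lap_const]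

lemma lap2_coord (j : Fin 3) (x : S2) : lap2 (fun y => (y : E3) j) x = 0 := by
  simp only [lap2, lap_coord]
  have : (fun y : S2 => -2 * (y : E3) j + 2 * (y : E3) j) = fun _ => 0 := by funext y; ring
  rw [this, lap_const]

/-! #### Green's identities -/

lemma sphereIntegral_mul_lap {f g : S2 → ℝ} (hf : SmoothFn f) (hg : SmoothFn g) :
    sphereIntegral (fun x => f x * lap g x) =
      - sphereIntegral (fun x => ∑ i, grad f x i * grad g x i) := by
  have h := sphereIntegral_div (V := fun x i => f x * grad g x i)
    (fun i => hf.mul (hg.grad i)) (fun x => by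
      have := grad_tangential hg x
      simp only [mul_assoc, ← Finset.mul_sum, this, mul_zero])
  have h1 : ∀ x, ∑ i, grad (fun y => f y * grad g y i) x i =
      (∑ i, grad f x i * grad g x i) + f x * lap g x := by
    intro x
    rw [lap_eq hg, Finset.mul_sum, ← Finset.sum_add_distrib]
    exact Finset.sum_congr rfl fun i _ => grad_mul hf (hg.grad i) x i
  simp only [h1] at h
  rw [sphereIntegral_add (SmoothFn.sum fun i => (hf.grad i).mul (hg.grad i)).continuous
    (hf.mul hg.lap).continuous] at h
  linarith

lemma sphereIntegral_lap_symm {f g : S2 → ℝ} (hf : SmoothFn f) (hg : SmoothFn g) :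
    sphereIntegral (fun x => f x * lap g x) = sphereIntegral (fun x => lap f x * g x) := by
  rw [sphereIntegral_mul_lap hf hg]
  have := sphereIntegral_mul_lap hg hf
  simp only [mul_comm (g _), mul_comm (grad g _ _)] at this
  exact this.symm

lemma sphereIntegral_lap2_symm {f g : S2 → ℝ} (hf : SmoothFn f) (hg : SmoothFn g) :
    sphereIntegral (fun x => f x * lap2 g x) = sphereIntegral (fun x => lap2 f x * g x) := by
  have e1 : sphereIntegral (fun x => f x * lap2 g x) =
      sphereIntegral (fun x => lap f x * lap g x) + 2 * sphereIntegral (fun x => lap f x * g x) := by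
    simp only [lap2]
    rw [sphereIntegral_lap_symm hf hg.lap_add_two, ← sphereIntegral_const_mul,
      ← sphereIntegral_add (hf.lap.mul hg.lap).continuous
        ((hf.lap.mul hg).const_mul 2).continuous]
    congr 1; funext x; ring
  have e2 : sphereIntegral (fun x => g x * lap2 f x) =
      sphereIntegral (fun x => lap f x * lap g x) + 2 * sphereIntegral (fun x => f x * lap g x) := by
    simp only [lap2]
    rw [sphereIntegral_lap_symm hg hf.lap_add_two, ← sphereIntegral_const_mul,
      ← sphereIntegral_add (hf.lap.mul hg.lap).continuous
        ((hf.mul hg.lap).const_mul 2).continuous]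
    congr 1; funext x; ring
  rw [e1, ← sphereIntegral_lap_symm hf hg, ← e2]
  simp only [mul_comm]

/-! ### The Green operator inverts `D² (D² + 2)` -/

/-- The Euclidean inner product of two points of the sphere. -/
def dot (x y : S2) : ℝ := inner ℝ (x : E3) (y : E3)

lemma dot_eq (x y : S2) : dot x y = ∑ i, (x : E3) i * (y : E3) i := by
  simp [dot, PiLp.inner_apply, mul_comm]

lemma dot_comm (x y : S2) : dot x y = dot y x := real_inner_comm _ _

@[fun_prop]
lemma smoothFn_dot (x : S2) : SmoothFn (dot x) := by
  have : dot x = fun y : S2 => ∑ i, (x : E3) i * (y : E3) i := funext (dot_eq x)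
  rw [this]
  exact SmoothFn.sum fun i => (smoothFn_coord i).const_mul _

lemma dot_le_one (x y : S2) : dot x y ≤ 1 := by
  have := real_inner_le_norm (x : E3) (y : E3)
  rwa [x.norm_eq, y.norm_eq, one_mul] at this

lemma neg_one_le_dot (x y : S2) : -1 ≤ dot x y := by
  have := neg_le_of_abs_le (abs_real_inner_le_norm (x : E3) (y : E3))
  rwa [x.norm_eq, y.norm_eq, one_mul] at this

lemma dot_eq_dist (x y : S2) : 1 - dot x y = dist x y ^ 2 / 2 := by
  have h : dist x y = ‖(x : E3) - y‖ := by rw [Subtype.dist_eq, dist_eq_norm]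
  rw [h, norm_sub_sq_real, x.norm_eq, y.norm_eq, dot]
  ring

lemma grad_dot (x y : S2) (i : Fin 3) : grad (dot x) y i = (x : E3) i - dot x y * (y : E3) i := by
  have : dot x = fun y : S2 => ∑ i, (x : E3) i * (y : E3) i := funext (dot_eq x)
  rw [this, grad_sum fun i => (smoothFn_coord i).const_mul _]
  simp only [grad_const_mul (smoothFn_coord _), grad_coord, q, Fin.sum_univ_three]
  fin_cases i <;> simp <;> ring

lemma continuous_dot (x : S2) : Continuous (dot x) := (smoothFn_dot x).continuous

/-- The Laplacian of a zonal function is Legendre's operator. -/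
lemma lap_zonal (x : S2) {g g1 g2 : ℝ → ℝ} (hg : ∀ t, t ≤ 1 → HasDerivAt g (g1 t) t)
    (hg1 : ∀ t, t ≤ 1 → HasDerivAt g1 (g2 t) t) (hs : ∀ t, t ≤ 1 → ContDiffAt ℝ ∞ g t)
    (hs1 : ∀ t, t ≤ 1 → ContDiffAt ℝ ∞ g1 t) (y : S2) :
    lap (fun y => g (dot x y)) y =
      (1 - dot x y ^ 2) * g2 (dot x y) - 2 * dot x y * g1 (dot x y) := by
  have hd := smoothFn_dot x
  have hsg : SmoothFn (fun y => g (dot x y)) := hd.comp fun y => hs _ (dot_le_one x y)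
  have hsg1 : SmoothFn (fun y => g1 (dot x y)) := hd.comp fun y => hs1 _ (dot_le_one x y)
  rw [lap_eq hsg]
  have h1 : ∀ i, (fun y => grad (fun y => g (dot x y)) y i) =
      fun y => g1 (dot x y) * grad (dot x) y i := fun i => by
    funext y
    exact grad_comp hd (hg _ (dot_le_one x y)) i
  have h2 := lap_eq hd y
  have h3 : lap (dot x) y = -2 * dot x y := by
    have : dot x = fun y : S2 => ∑ i, (x : E3) i * (y : E3) i := funext (dot_eq x)
    rw [this]
    simp only [Fin.sum_univ_three]
    rw [lap_add (((smoothFn_coord 0).const_mul _).add ((smoothFn_coord 1).const_mul _))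
      ((smoothFn_coord 2).const_mul _),
      lap_add ((smoothFn_coord 0).const_mul _) ((smoothFn_coord 1).const_mul _)]
    simp only [lap_const_mul (smoothFn_coord _), lap_coord]
    ring
  simp only [h1, grad_mul hsg1 (hd.grad _), grad_comp hd (hg1 _ (dot_le_one x y))]
  rw [Finset.sum_add_distrib, ← Finset.mul_sum, ← h2, h3]
  have h4 : ∑ i, g2 (dot x y) * grad (dot x) y i * grad (dot x) y i =
      g2 (dot x y) * (1 - dot x y ^ 2) := by
    simp only [grad_dot]
    have a := x.sum_sq
    have b := y.sum_sq
    have c := dot_eq x y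
    simp only [Fin.sum_univ_three] at c ⊢
    linear_combination g2 (dot x y) * (a + dot x y ^ 2 * b + 2 * dot x y * c)
  rw [h4]
  ring

/-- The regularized kernel `(a - t) log (a - t)`, smooth on the sphere for `a > 1`. -/
def greenReg (a t : ℝ) : ℝ := (a - t) * Real.log (a - t)

lemma lap2_greenReg (x : S2) {a : ℝ} (ha : 1 < a) (y : S2) :
    lap2 (fun y => greenReg a (dot x y)) y =
      2 * (a ^ 2 - 1) ^ 2 / (a - dot x y) ^ 3 - 2 * a - 6 * dot x y := by
  have hpos : ∀ t, t ≤ 1 → 0 < a - t := fun t ht => by linarith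
  have hsub : ∀ t : ℝ, HasDerivAt (fun t => a - t) (-1) t := fun t => by
    simpa using (hasDerivAt_id t).const_sub a
  have hlog : ∀ t, t ≤ 1 → HasDerivAt (fun t => Real.log (a - t)) (-1 / (a - t)) t :=
    fun t ht => (hsub t).log (hpos t ht).ne'
  have csub : ∀ t : ℝ, ContDiffAt ℝ ∞ (fun t => a - t) t := fun t => by fun_prop
  have clog : ∀ t, t ≤ 1 → ContDiffAt ℝ ∞ (fun t => Real.log (a - t)) t :=
    fun t ht => (csub t).log (hpos t ht).ne'
  have s1 : ∀ y, lap (fun y => greenReg a (dot x y)) y + 2 * greenReg a (dot x y) =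
      (1 - dot x y ^ 2) / (a - dot x y) + 2 * a * Real.log (a - dot x y) + 2 * dot x y := by
    intro y
    rw [lap_zonal x (g := greenReg a) (g1 := fun t => -(Real.log (a - t)) - 1)
      (g2 := fun t => 1 / (a - t))]
    · have := (hpos _ (dot_le_one x y)).ne'
      simp only [greenReg]
      field_simp
      ring
    · intro t ht
      have h := (hsub t).fun_mul (hlog t ht)
      have := (hpos t ht).ne'
      refine h.congr_deriv ?_
      field_simp
      ring
    · intro t ht
      have h := (hlog t ht).fun_neg.sub_const 1
      refine h.congr_deriv ?_
      ring
    · exact fun t ht => (csub t).mul (clog t ht)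
    · exact fun t ht => (clog t ht).neg.sub contDiffAt_const
  simp only [lap2, s1]
  rw [lap_zonal x (g := fun t => (1 - t ^ 2) / (a - t) + 2 * a * Real.log (a - t) + 2 * t)
      (g1 := fun t => (-2 * t * (a - t) + (1 - t ^ 2)) / (a - t) ^ 2 - 2 * a / (a - t) + 2)
      (g2 := fun t => -2 / (a - t) - 4 * t / (a - t) ^ 2 + 2 * (1 - t ^ 2) / (a - t) ^ 3
        - 2 * a / (a - t) ^ 2)]
  · have := (hpos _ (dot_le_one x y)).ne'
    field_simp
    ring
  · intro t ht
    have hne := (hpos t ht).ne'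
    have h1 : HasDerivAt (fun t : ℝ => 1 - t ^ 2) (-(2 * t)) t := by
      simpa using (hasDerivAt_pow 2 t).const_sub 1
    have h := ((h1.fun_div (hsub t) hne).fun_add ((hlog t ht).const_mul (2 * a))).fun_add
      ((hasDerivAt_id t).const_mul 2)
    refine h.congr_deriv ?_
    field_simp
    ring
  · intro t ht
    have hne := (hpos t ht).ne'
    have h1 : HasDerivAt (fun t : ℝ => -2 * t * (a - t) + (1 - t ^ 2))
        (-2 * (a - t) + -2 * t * (-1) + -(2 * t)) t := by
      have e1 : HasDerivAt (fun t : ℝ => 1 - t ^ 2) (-(2 * t)) t := by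
        simpa using (hasDerivAt_pow 2 t).const_sub 1
      have e2 : HasDerivAt (fun t : ℝ => -2 * t) (-2) t := by
        simpa using (hasDerivAt_id t).const_mul (-2)
      exact (e2.fun_mul (hsub t)).fun_add e1
    have h2 : HasDerivAt (fun t : ℝ => (a - t) ^ 2) (2 * (a - t) * (-1)) t := by
      have := (hsub t).fun_pow 2
      simpa using this
    have h := (((h1.fun_div h2 (pow_ne_zero 2 hne)).fun_sub
      ((hasDerivAt_const t (2 * a)).fun_div (hsub t) hne))).add_const 2
    refine h.congr_deriv ?_
    field_simp
    ring
  · intro t ht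
    have hne := (hpos t ht).ne'
    exact ((((by fun_prop : ContDiffAt ℝ ∞ (fun t : ℝ => 1 - t ^ 2) t).div (csub t) hne).add
      (contDiffAt_const.mul (clog t ht)))).add (by fun_prop)
  · intro t ht
    have hne := (hpos t ht).ne'
    exact (((by fun_prop : ContDiffAt ℝ ∞ (fun t : ℝ => -2 * t * (a - t) + (1 - t ^ 2)) t).div
      ((csub t).pow 2) (pow_ne_zero 2 hne)).sub (contDiffAt_const.div (csub t) hne)).add
      contDiffAt_const

lemma sphereIntegral_coord (i : Fin 3) : sphereIntegral (fun x => (x : E3) i) = 0 := by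
  have := sphereIntegral_grad (smoothFn_const 1) i
  simp only [grad_const, one_mul] at this
  simp only [sphereIntegral, integral_zero] at this ⊢
  linarith

lemma sphereIntegral_dot (x : S2) : sphereIntegral (dot x) = 0 := by
  have : dot x = fun y : S2 => ∑ i, (x : E3) i * (y : E3) i := funext (dot_eq x)
  rw [this, sphereIntegral_sum fun i => ((smoothFn_coord i).const_mul _).continuous]
  simp [sphereIntegral_const_mul, sphereIntegral_coord]

lemma smoothFn_greenReg (x : S2) {a : ℝ} (ha : 1 < a) :
    SmoothFn (fun y => greenReg a (dot x y)) := by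
  refine (smoothFn_dot x).comp (g := greenReg a) fun y => ?_
  have h : a - dot x y ≠ 0 := by have := dot_le_one x y; linarith
  have h1 : ContDiffAt ℝ ∞ (fun t => a - t) (dot x y) := by fun_prop
  exact h1.mul (h1.log h)

/-- The Green operator applied to `D² (D² + 2) φ` returns a multiple of `φ` without its `ℓ = 0, 1`
parts. The regularized kernels satisfy this with `φ` averaged against a positive kernel
`2 (a² - 1)² / (a - x·y)³`, which concentrates at `y = x` as `a → 1`. -/
lemma greenOp_lap2 {φ : S2 → ℝ} (hφ : SmoothFn φ) (x : S2) :
    greenOp (lap2 φ) x = 2 * totalArea * φ x - 2 * sphereIntegral φ -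
      6 * sphereIntegral (fun y => dot x y * φ y) := by
  set A := totalArea with hA
  have hApos : 0 < A := totalArea_pos
  set P : ℝ → S2 → ℝ := fun a y => 2 * (a ^ 2 - 1) ^ 2 / (a - dot x y) ^ 3 with hP
  have hs : ∀ a, 1 < a → ∀ y, 0 < a - dot x y := fun a ha y => by
    have := dot_le_one x y; linarith
  have hPc : ∀ a, 1 < a → Continuous (P a) := fun a ha =>
    continuous_const.div ((continuous_const.sub (continuous_dot x)).pow 3)
      fun y => pow_ne_zero 3 (hs a ha y).ne'
  have hPn : ∀ a, 1 < a → ∀ y, 0 ≤ P a y := fun a ha y =>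
    div_nonneg (by positivity) (pow_nonneg (hs a ha y).le 3)
  -- `lap2_greenReg` tested against a smooth function
  have hreg : ∀ (ψ : S2 → ℝ), SmoothFn ψ → ∀ a, 1 < a →
      sphereIntegral (fun y => greenReg a (dot x y) * lap2 ψ y) =
        sphereIntegral (fun y => P a y * ψ y) - 2 * a * sphereIntegral ψ -
          6 * sphereIntegral (fun y => dot x y * ψ y) := by
    intro ψ hψ a ha
    rw [sphereIntegral_lap2_symm (smoothFn_greenReg x ha) hψ]
    simp only [lap2_greenReg x ha]
    have c1 : Continuous (fun y => P a y * ψ y) := (hPc a ha).mul hψ.continuous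
    have c2 : Continuous (fun y => P a y * ψ y - 2 * a * ψ y) :=
      c1.sub (hψ.const_mul _).continuous
    rw [← sphereIntegral_const_mul, ← sphereIntegral_const_mul,
      ← sphereIntegral_sub c1 (hψ.const_mul _).continuous,
      ← sphereIntegral_sub c2 (((smoothFn_dot x).mul hψ).const_mul _).continuous]
    congr 1
    funext y
    ring
  -- the total mass of the averaging kernel, from the previous identity for constants
  have hmass : ∀ a, 1 < a → sphereIntegral (P a) = 2 * a * A := by
    intro a ha
    have := hreg (fun _ => 1) (smoothFn_const 1) a ha
    simp only [lap2_const, mul_zero, mul_one, sphereIntegral_const, zero_mul, one_mul] at this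
    have h3 := sphereIntegral_dot x
    have h4 : sphereIntegral (fun y => dot x y) = 0 := h3
    have h5 : sphereIntegral (fun y => P a y) = sphereIntegral (P a) := rfl
    rw [h4, h5] at this
    linarith
  -- The defect of the identity for the kernel with parameter `a`. It is continuous in `a`, since
  -- `t log t` is continuous at `0`, and the claim is that it vanishes at `a = 1`.
  set D : ℝ → ℝ := fun a => sphereIntegral (fun y => greenReg a (dot x y) * lap2 φ y) -
    2 * a * A * φ x + 2 * a * sphereIntegral φ + 6 * sphereIntegral (fun y => dot x y * φ y)
    with hD
  have hDc : Continuous D := by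
    have h1 : Continuous fun a => sphereIntegral (fun y => greenReg a (dot x y) * lap2 φ y) := by
      have h2 := continuous_parametric_integral_of_continuous (μ := area) (s := univ)
        (f := fun a y => greenReg a (dot x y) * lap2 φ y) (by
          have e1 : Continuous (fun p : ℝ × S2 => p.1 - dot x p.2) :=
            continuous_fst.sub ((continuous_dot x).comp continuous_snd)
          exact (Real.continuous_mul_log.comp e1).mul
            (hφ.lap2.continuous.comp continuous_snd)) isCompact_univ
      rw [Measure.restrict_univ] at h2
      exact h2
    fun_prop
  have hbound : ∀ ε, 0 < ε → |D 1| ≤ 2 * A * ε := by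
    intro ε hε
    obtain ⟨δ, hδ, hδε⟩ := Metric.continuous_iff.mp hφ.continuous x ε hε
    obtain ⟨M, hM⟩ := isCompact_univ.exists_bound_of_continuousOn hφ.continuous.continuousOn
    have hM' : ∀ y, |φ y| ≤ M := fun y => hM y (mem_univ y)
    have hM0 : 0 ≤ M := (abs_nonneg _).trans (hM' x)
    set M' := 2 * M * (2 / δ ^ 2) ^ 3 with hM'd
    have hM'0 : 0 ≤ M' := by positivity
    -- Near `x` the function `φ` is nearly constant; away from `x` the cube dominates, and its integral
    -- against `P a` tends to zero.
    have hpt : ∀ a, 1 < a → ∀ y, |φ y - φ x| ≤ ε + M' * (a - dot x y) ^ 3 := by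
      intro a ha y
      by_cases hy : dist y x < δ
      · have h1 := hδε y hy
        rw [Real.dist_eq] at h1
        have : 0 ≤ M' * (a - dot x y) ^ 3 := mul_nonneg hM'0 (pow_nonneg (hs a ha y).le 3)
        linarith
      · have h1 : δ ^ 2 / 2 ≤ a - dot x y := by
          have h2 := dot_eq_dist x y
          have h3 : δ ^ 2 ≤ dist x y ^ 2 := by
            rw [dist_comm x y]
            exact pow_le_pow_left₀ hδ.le (not_lt.mp hy) 2
          linarith
        have h2 : 1 ≤ (2 / δ ^ 2) ^ 3 * (a - dot x y) ^ 3 := by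
          rw [← mul_pow]
          apply one_le_pow₀
          have : (2 / δ ^ 2) * (δ ^ 2 / 2) = 1 := by field_simp
          rw [← this]
          exact mul_le_mul_of_nonneg_left h1 (by positivity)
        have h3 : |φ y - φ x| ≤ 2 * M := by
          have := abs_sub (φ y) (φ x)
          linarith [hM' y, hM' x]
        have h4 : 2 * M * 1 ≤ 2 * M * ((2 / δ ^ 2) ^ 3 * (a - dot x y) ^ 3) :=
          mul_le_mul_of_nonneg_left h2 (by positivity)
        have h5 : M' * (a - dot x y) ^ 3 = 2 * M * ((2 / δ ^ 2) ^ 3 * (a - dot x y) ^ 3) := by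
          rw [hM'd]; ring
        linarith
    have hDa : ∀ a, 1 < a → |D a| ≤ 2 * a * A * ε + 2 * (a ^ 2 - 1) ^ 2 * M' * A := by
      intro a ha
      have h1 : D a = sphereIntegral (fun y => P a y * (φ y - φ x)) := by
        have h2 : (fun y => P a y * (φ y - φ x)) = fun y => P a y * φ y - φ x * P a y := by
          funext y; ring
        have c1 : Continuous (fun y => P a y * φ y) := (hPc a ha).mul hφ.continuous
        have c2 : Continuous (fun y => φ x * P a y) := continuous_const.mul (hPc a ha)
        rw [h2, sphereIntegral_sub c1 c2, sphereIntegral_const_mul, hmass a ha, hD]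
        simp only
        rw [hreg φ hφ a ha]
        ring
      rw [h1]
      have h3 := abs_sphereIntegral_le (f := fun y => P a y * (φ y - φ x))
        (g := fun y => ε * P a y + 2 * (a ^ 2 - 1) ^ 2 * M')
        ((continuous_const.mul (hPc a ha)).fun_add continuous_const) (by
          intro y
          rw [abs_mul, abs_of_nonneg (hPn a ha y)]
          have h4 := mul_le_mul_of_nonneg_left (hpt a ha y) (hPn a ha y)
          have h5 : P a y * (a - dot x y) ^ 3 = 2 * (a ^ 2 - 1) ^ 2 := by
            rw [hP]
            exact div_mul_cancel₀ _ (pow_ne_zero 3 (hs a ha y).ne')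
          calc _ ≤ _ := h4
            _ = ε * P a y + (P a y * (a - dot x y) ^ 3) * M' := by ring
            _ = _ := by rw [h5])
      have c1 : Continuous (fun y => ε * P a y) := continuous_const.mul (hPc a ha)
      rw [sphereIntegral_add c1 continuous_const,
        sphereIntegral_const_mul, sphereIntegral_const, hmass a ha] at h3
      calc _ ≤ _ := h3
        _ = _ := by ring
    have h1 : Tendsto (fun a => |D a|) (𝓝[>] 1) (𝓝 |D 1|) :=
      (hDc.abs.tendsto 1).mono_left nhdsWithin_le_nhds
    have h2 : Tendsto (fun a : ℝ => 2 * a * A * ε + 2 * (a ^ 2 - 1) ^ 2 * M' * A) (𝓝[>] 1)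
        (𝓝 (2 * A * ε)) := by
      have hc : Continuous (fun a : ℝ => 2 * a * A * ε + 2 * (a ^ 2 - 1) ^ 2 * M' * A) := by
        fun_prop
      have := (hc.tendsto 1).mono_left (nhdsWithin_le_nhds (s := Ioi 1))
      simpa using this
    exact le_of_tendsto_of_tendsto h1 h2 (by
      filter_upwards [self_mem_nhdsWithin] with a ha using hDa a ha)
  have hD1 : D 1 = 0 := by
    by_contra hne
    have hpos : 0 < |D 1| := abs_pos.mpr hne
    have := hbound (|D 1| / (4 * A)) (by positivity)
    have h2 : 2 * A * (|D 1| / (4 * A)) = |D 1| / 2 := by field_simp; ring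
    linarith
  have hg : sphereIntegral (fun y => greenReg 1 (dot x y) * lap2 φ y) = greenOp (lap2 φ) x := rfl
  rw [hD] at hD1
  simp only [hg] at hD1
  linarith

/-! ### Divergences of symmetric traceless tensors -/

lemma IsSTF.deriv {T : Field2} (hT : IsSTF T) (x : S2) (k i : Fin 3) :
    ∑ b, grad (fun y => T y i b) x k * (x : E3) b = - T x k i := by
  have h := IsTan.deriv (V := fun x b => T x i b) ⟨hT.smooth i, fun x => hT.tan x i⟩ x k
  rw [h, hT.symm]

/-- The covariant derivative of a tangential two-tensor field in Cartesian components. -/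
lemma IsSTF.covD2_eq {T : Field2} (hT : IsSTF T) (x : S2) (k i j : Fin 3) :
    covD2 T x k i j = grad (fun y => T y i j) x k + (x : E3) i * T x k j
      + (x : E3) j * T x k i := by
  have h1 : ∀ a, ∑ b, q x j b * grad (fun y => T y a b) x k =
      grad (fun y => T y a j) x k + (x : E3) j * T x k a := by
    intro a
    have h := hT.deriv x k a
    have h2 : ∑ b, (if j = b then (1 : ℝ) else 0) * grad (fun y => T y a b) x k =
        grad (fun y => T y a j) x k := by simp
    simp only [q, Fin.sum_univ_three] at h h2 ⊢
    linear_combination h2 - (x : E3) j * h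
  have h3 : ∑ a, q x i a * grad (fun y => T y a j) x k =
      grad (fun y => T y i j) x k + (x : E3) i * T x k j := by
    have h := hT.deriv x k j
    have h2 : ∑ b, (if i = b then (1 : ℝ) else 0) * grad (fun y => T y b j) x k =
        grad (fun y => T y i j) x k := by simp
    have h4 : ∀ b, (fun y => T y j b) = fun y => T y b j := fun b => funext fun y => hT.symm y j b
    simp only [h4] at h
    simp only [q, Fin.sum_univ_three] at h h2 ⊢
    linear_combination h2 - (x : E3) i * h
  have h5 : ∑ a, q x i a * T x k a = T x k i := by
    have h := hT.tan x k
    have h2 : ∑ b, (if i = b then (1 : ℝ) else 0) * T x k b = T x k i := by simp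
    simp only [q, Fin.sum_univ_three] at h h2 ⊢
    linear_combination h2 - (x : E3) i * h
  calc covD2 T x k i j = ∑ a, q x i a * ∑ b, q x j b * grad (fun y => T y a b) x k := by
        simp only [covD2, Finset.mul_sum, mul_assoc]
    _ = (∑ a, q x i a * grad (fun y => T y a j) x k) + (x : E3) j * ∑ a, q x i a * T x k a := by
        simp only [h1, mul_add, Finset.sum_add_distrib, Finset.mul_sum]
        congr 1
        exact Finset.sum_congr rfl fun a _ => by ring
    _ = _ := by rw [h3, h5]

lemma IsSTF.div2_eq {T : Field2} (hT : IsSTF T) (x : S2) (j : Fin 3) :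
    div2 T x j = ∑ i, grad (fun y => T y i j) x i := by
  have h := hT.tan x j
  have h2 := hT.trace x
  have h3 : ∀ i, T x j i = T x i j := fun i => hT.symm x j i
  simp only [div2, hT.covD2_eq, h3, Fin.sum_univ_three] at h h2 ⊢
  linear_combination h + (x : E3) j * h2

lemma IsSTF.isTan_div2 {T : Field2} (hT : IsSTF T) : IsTan (div2 T) := by
  refine ⟨fun j => ?_, fun x => ?_⟩
  · have h : (fun x => div2 T x j) = fun x => ∑ i, grad (fun y => T y i j) x i :=
      funext fun x => hT.div2_eq x j
    rw [h]
    have := hT.smooth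
    fun_prop
  · simp only [hT.div2_eq, Finset.sum_mul]
    rw [Finset.sum_comm]
    have h : ∀ i, ∑ j, grad (fun y => T y i j) x i * (x : E3) j = - T x i i :=
      fun i => hT.deriv x i i
    simp only [h, Finset.sum_neg_distrib, hT.trace x, neg_zero]

/-- The double divergence `D^A D^B T_AB`. -/
abbrev ddiv (T : Field2) : S2 → ℝ := div1 (div2 T)

@[fun_prop]
lemma IsTan.smooth_div1 {V : Field1} (hV : IsTan V) : SmoothFn (div1 V) := by
  have h : div1 V = fun x => ∑ i, grad (fun y => V y i) x i := funext hV.div1_eq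
  rw [h]
  have := hV.smooth
  fun_prop

lemma IsSTF.smooth_ddiv {T : Field2} (hT : IsSTF T) : SmoothFn (ddiv T) := hT.isTan_div2.smooth_div1

lemma hess_symm {f : S2 → ℝ} (hf : SmoothFn f) (x : S2) (i j : Fin 3) :
    hess f x i j = hess f x j i := by
  rw [hess_eq hf, hess_eq hf]
  have := grad_grad_comm hf x i j
  linarith

lemma hess_tan {f : S2 → ℝ} (hf : SmoothFn f) (x : S2) (i : Fin 3) :
    ∑ j, hess f x i j * (x : E3) j = 0 := by
  have h1 := (isTan_grad hf).deriv x i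
  have h2 := x.sum_sq
  simp only [hess_eq hf, Fin.sum_univ_three] at h1 ⊢
  linear_combination h1 + grad f x i * h2

lemma hess_trace {f : S2 → ℝ} (x : S2) : ∑ i, hess f x i i = lap f x := rfl

@[fun_prop]
lemma SmoothFn.hess {f : S2 → ℝ} (hf : SmoothFn f) (i j : Fin 3) :
    SmoothFn (fun x => hess f x i j) := by
  simp only [hess_eq hf]
  fun_prop

@[fun_prop]
lemma smoothFn_q (i j : Fin 3) : SmoothFn (fun x => q x i j) := by
  unfold q
  fun_prop

/-- The tensor `-2 D_A D_B u + q_AB D² u`, which is the change of the shear under `u`. -/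
def stf (u : S2 → ℝ) : Field2 := fun x i j => -2 * hess u x i j + q x i j * lap u x

lemma isSTF_stf {u : S2 → ℝ} (hu : SmoothFn u) : IsSTF (stf u) := by
  refine ⟨fun i j => ?_, fun x i j => ?_, fun x i => ?_, fun x => ?_⟩
  · unfold stf
    fun_prop
  · simp only [stf, hess_symm hu x i j, q, eq_comm (a := i), mul_comm]
  · have h1 := hess_tan hu x i
    have h2 := q_contract x i
    simp only [stf, Fin.sum_univ_three] at h1 h2 ⊢
    linear_combination -2 * h1 + lap u x * h2
  · have h1 := hess_trace (f := u) x
    have h2 := q_trace x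
    simp only [stf, Fin.sum_univ_three] at h1 h2 ⊢
    linear_combination -2 * h1 + lap u x * h2

lemma grad_q (x : S2) (k i j : Fin 3) :
    grad (fun y => q y i j) x k = - (q x k i * (x : E3) j + (x : E3) i * q x k j) := by
  have h1 := grad_sub (smoothFn_const (if i = j then (1 : ℝ) else 0))
    ((smoothFn_coord i).mul (smoothFn_coord j)) x k
  rw [grad_const, grad_mul (smoothFn_coord i) (smoothFn_coord j), grad_coord, grad_coord] at h1
  have h2 : (fun y : S2 => q y i j) = fun y : S2 => (if i = j then (1 : ℝ) else 0) -
      (y : E3) i * (y : E3) j := rfl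
  rw [h2, h1]
  ring

lemma q_mul_grad {f : S2 → ℝ} (hf : SmoothFn f) (x : S2) (j : Fin 3) :
    ∑ i, q x i j * grad f x i = grad f x j := by
  have h := grad_tangential hf x
  have h2 : ∑ i, (if i = j then (1 : ℝ) else 0) * grad f x i = grad f x j := by simp
  simp only [q, Fin.sum_univ_three] at h h2 ⊢
  linear_combination h2 - (x : E3) j * h

/-- The divergence of the change of the shear is the gradient of `-(D² + 2) u`. -/
lemma div2_stf {u : S2 → ℝ} (hu : SmoothFn u) (x : S2) (j : Fin 3) :
    div2 (stf u) x j = - grad (fun y => lap u y + 2 * u y) x j := by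
  rw [(isSTF_stf hu).div2_eq]
  have h1 : ∀ i, (fun y => stf u y i j) = fun y =>
      -2 * (grad (fun z => grad u z i) y j + (y : E3) i * grad u y j) + q y i j * lap u y := by
    intro i
    funext y
    rw [stf, hess_symm hu, hess_eq hu]
  have h2 : ∀ i, grad (fun y => stf u y i j) x i =
      -2 * (grad (fun y => grad (fun z => grad u z i) y j) x i + (q x i i * grad u x j +
        (x : E3) i * grad (fun y => grad u y j) x i)) +
      (-(q x i i * (x : E3) j + (x : E3) i * q x i j) * lap u x + q x i j * grad (lap u) x i) := by
    intro i
    rw [h1, grad_add (by fun_prop) (by fun_prop), grad_const_mul (by fun_prop),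
      grad_add (by fun_prop) (by fun_prop), grad_mul (by fun_prop) (by fun_prop),
      grad_mul (by fun_prop) (by fun_prop), grad_coord, grad_q]
  have h3 : ∀ i, grad (fun y => grad (fun z => grad u z i) y j) x i =
      grad (fun y => grad (fun z => grad u z i) y i) x j +
      (x : E3) i * grad (fun z => grad u z i) x j - (x : E3) j * grad (fun z => grad u z i) x i := by
    intro i
    have := grad_grad_comm (hu.grad i) x i j
    linarith
  have h4 : grad (lap u) x j = ∑ i, grad (fun y => grad (fun z => grad u z i) y i) x j := by
    have : lap u = fun y => ∑ i, grad (fun z => grad u z i) y i := funext (lap_eq hu)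
    rw [this, grad_sum (by fun_prop)]
  have h5 := lap_eq hu x
  have h6 := (isTan_grad hu).deriv x j
  have h7 := q_trace x
  have h8 := q_mul_grad hu.lap x j
  have h9 : ∑ i, (x : E3) i * grad (fun y => grad u y j) x i = 0 := by
    have := grad_tangential (hu.grad j) x
    simpa only [mul_comm] using this
  have h10 : ∑ i, (x : E3) i * q x i j = 0 := by
    have := q_contract x j
    have hs : ∀ i, q x i j = q x j i := by
      intro i
      simp only [q, eq_comm (a := i), mul_comm]
    simpa only [hs] using this
  rw [grad_add (by fun_prop) (by fun_prop), grad_const_mul hu]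
  simp only [h2, h3]
  simp only [Fin.sum_univ_three] at h4 h5 h6 h7 h8 h9 h10 ⊢
  linear_combination 2 * h4 - 2 * (x : E3) j * h5 - 2 * h6 - (2 * grad u x j +
    (x : E3) j * lap u x) * h7 + h8 - 2 * h9 - lap u x * h10

lemma ddiv_stf {u : S2 → ℝ} (hu : SmoothFn u) (x : S2) : ddiv (stf u) x = - lap2 u x := by
  have h : div2 (stf u) = grad (fun y => (-1) * (lap u y + 2 * u y)) := by
    funext y j
    rw [div2_stf hu, grad_const_mul (by fun_prop)]
    ring
  rw [ddiv, h]
  have := lap_const_mul (f := fun y => lap u y + 2 * u y) (by fun_prop) (-1) x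
  simp only [lap2]
  rw [show div1 (grad fun y => -1 * (lap u y + 2 * u y)) x =
    lap (fun y => -1 * (lap u y + 2 * u y)) x from rfl, this]
  ring

lemma IsSTF.add {S T : Field2} (hS : IsSTF S) (hT : IsSTF T) :
    IsSTF (fun x i j => S x i j + T x i j) := by
  refine ⟨fun i j => (hS.smooth i j).add (hT.smooth i j), fun x i j => ?_, fun x i => ?_,
    fun x => ?_⟩
  · rw [hS.symm, hT.symm]
  · simp only [add_mul, Finset.sum_add_distrib, hS.tan, hT.tan, add_zero]
  · simp only [Finset.sum_add_distrib, hS.trace, hT.trace, add_zero]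

lemma div2_add {S T : Field2} (hS : IsSTF S) (hT : IsSTF T) (x : S2) (j : Fin 3) :
    div2 (fun x i j => S x i j + T x i j) x j = div2 S x j + div2 T x j := by
  rw [(hS.add hT).div2_eq, hS.div2_eq, hT.div2_eq, ← Finset.sum_add_distrib]
  exact Finset.sum_congr rfl fun i _ => grad_add (hS.smooth i j) (hT.smooth i j) x i

lemma ddiv_add {S T : Field2} (hS : IsSTF S) (hT : IsSTF T) (x : S2) :
    ddiv (fun x i j => S x i j + T x i j) x = ddiv S x + ddiv T x := by
  rw [ddiv, (hS.add hT).isTan_div2.div1_eq, ddiv, hS.isTan_div2.div1_eq, ddiv,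
    hT.isTan_div2.div1_eq, ← Finset.sum_add_distrib]
  refine Finset.sum_congr rfl fun i _ => ?_
  rw [← grad_add (hS.isTan_div2.smooth i) (hT.isTan_div2.smooth i)]
  simp only [div2_add hS hT]

/-- Integration by parts against a double divergence. -/
lemma sphereIntegral_mul_ddiv {T : Field2} (hT : IsSTF T) {u : S2 → ℝ} (hu : SmoothFn u) :
    sphereIntegral (fun x => u x * ddiv T x) =
      sphereIntegral (fun x => ∑ i, ∑ j, T x i j * hess u x i j) := by
  have hd := hT.isTan_div2
  have s1 := hT.smooth
  have s2 := hd.smooth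
  have h1 := sphereIntegral_div (V := fun x j => u x * div2 T x j) (by fun_prop) (fun x => by
    have := hd.tan x
    simp only [mul_assoc, ← Finset.mul_sum, this, mul_zero])
  have h2 := sphereIntegral_div (V := fun x i => ∑ j, T x i j * grad u x j) (by fun_prop)
    (fun x => by
      simp only [Finset.sum_mul]
      rw [Finset.sum_comm]
      refine Finset.sum_eq_zero fun j _ => ?_
      have h := hT.tan x j
      have h3 : ∀ i, T x i j * grad u x j * (x : E3) i =
          grad u x j * (T x j i * (x : E3) i) := fun i => by rw [hT.symm x i j]; ring
      simp only [h3, ← Finset.mul_sum, h, mul_zero])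
  have e1 : ∀ x, ∑ j, grad (fun y => u y * div2 T y j) x j =
      (∑ j, grad u x j * div2 T x j) + u x * ddiv T x := by
    intro x
    rw [ddiv, hd.div1_eq, Finset.mul_sum, ← Finset.sum_add_distrib]
    exact Finset.sum_congr rfl fun j _ => grad_mul hu (s2 j) x j
  have e2 : ∀ x, ∑ i, grad (fun y => ∑ j, T y i j * grad u y j) x i =
      (∑ j, grad u x j * div2 T x j) + ∑ i, ∑ j, T x i j * hess u x i j := by
    intro x
    have a1 := hT.tan x 0
    have a2 := hT.tan x 1
    have a3 := hT.tan x 2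
    simp only [hT.div2_eq, hess_eq hu, Fin.sum_univ_three] at a1 a2 a3 ⊢
    have b : ∀ i, grad (fun y => T y i 0 * grad u y 0 + T y i 1 * grad u y 1 +
        T y i 2 * grad u y 2) x i = (grad (fun y => T y i 0) x i * grad u x 0 +
        T x i 0 * grad (fun y => grad u y 0) x i) + (grad (fun y => T y i 1) x i * grad u x 1 +
        T x i 1 * grad (fun y => grad u y 1) x i) + (grad (fun y => T y i 2) x i * grad u x 2 +
        T x i 2 * grad (fun y => grad u y 2) x i) := by
      intro i
      rw [grad_add (by fun_prop) (by fun_prop), grad_add (by fun_prop) (by fun_prop),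
        grad_mul (by fun_prop) (by fun_prop), grad_mul (by fun_prop) (by fun_prop),
        grad_mul (by fun_prop) (by fun_prop)]
    simp only [b]
    linear_combination - grad u x 0 * a1 - grad u x 1 * a2 - grad u x 2 * a3
  have c1 : SmoothFn (ddiv T) := hT.smooth_ddiv
  simp only [e1] at h1
  simp only [e2] at h2
  rw [sphereIntegral_add (by fun_prop) (by fun_prop)] at h1 h2
  linarith

lemma contract_hess {T : Field2} (hT : IsSTF T) (u : S2 → ℝ) (x : S2) :
    ∑ i, ∑ j, T x i j * hess u x i j = -(1 / 2) * ∑ i, ∑ j, T x i j * stf u x i j := by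
  have h0 := hT.tan x 0
  have h1 := hT.tan x 1
  have h2 := hT.tan x 2
  have h3 := hT.trace x
  simp only [stf, q, Fin.sum_univ_three] at h0 h1 h2 h3 ⊢
  simp
  linear_combination (lap u x / 2) * (h3 - (x : E3) 0 * h0 - (x : E3) 1 * h1 - (x : E3) 2 * h2)

lemma sphereIntegral_mul_ddiv' {T : Field2} (hT : IsSTF T) {u : S2 → ℝ} (hu : SmoothFn u) :
    sphereIntegral (fun x => u x * ddiv T x) =
      -(1 / 2) * sphereIntegral (fun x => ∑ i, ∑ j, T x i j * stf u x i j) := by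
  rw [sphereIntegral_mul_ddiv hT hu, ← sphereIntegral_const_mul]
  simp only [contract_hess hT]

lemma sphereIntegral_normSq_stf {u : S2 → ℝ} (hu : SmoothFn u) :
    sphereIntegral (fun x => ∑ i, ∑ j, stf u x i j ^ 2) =
      2 * sphereIntegral (fun x => u x * lap2 u x) := by
  have h := sphereIntegral_mul_ddiv' (isSTF_stf hu) hu
  simp only [ddiv_stf hu, mul_neg, sphereIntegral_neg] at h
  simp only [pow_two]
  linarith

/-- Double divergences are orthogonal to the spherical harmonics with `ℓ = 0, 1`. -/
lemma sphereIntegral_ddiv {T : Field2} (hT : IsSTF T) : sphereIntegral (ddiv T) = 0 := by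
  have h := sphereIntegral_mul_ddiv hT (smoothFn_const 1)
  have h2 : ∀ x i j, hess (fun _ : S2 => (1 : ℝ)) x i j = 0 := fun x i j => by
    rw [hess_eq (smoothFn_const 1)]
    simp [grad_const]
  simp only [h2, one_mul] at h
  simpa [sphereIntegral] using h

lemma sphereIntegral_ddiv_coord {T : Field2} (hT : IsSTF T) (k : Fin 3) :
    sphereIntegral (fun x => ddiv T x * (x : E3) k) = 0 := by
  have h := sphereIntegral_mul_ddiv' hT (smoothFn_coord k)
  have h2 : ∀ x i j, stf (fun y : S2 => (y : E3) k) x i j = 0 := fun x i j => by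
    rw [stf, hess_eq (smoothFn_coord k), lap_coord]
    simp only [grad_coord]
    rw [grad_q]
    have : q x i j = q x j i := by simp only [q, eq_comm (a := i), mul_comm]
    ring
  simp only [h2] at h
  simp only [mul_comm (ddiv T _)]
  simpa [sphereIntegral] using h

/-! ### Existence and uniqueness of the potential -/

attribute [fun_prop] SmoothFn.greenOp SmoothFn.lap_add_two

lemma sphereIntegral_greenOp_symm {f g : S2 → ℝ} (hf : SmoothFn f) (hg : SmoothFn g) :
    sphereIntegral (fun x => greenOp f x * g x) = sphereIntegral (fun x => f x * greenOp g x) := by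
  have hc : Continuous (fun p : S2 × S2 => green (dot p.1 p.2) * f p.2 * g p.1) := by
    have h1 : Continuous (fun p : S2 × S2 => dot p.1 p.2) :=
      (continuous_subtype_val.comp continuous_fst).inner
        (continuous_subtype_val.comp continuous_snd)
    exact ((continuous_green.comp h1).mul (hf.continuous.comp continuous_snd)).mul
      (hg.continuous.comp continuous_fst)
  have hi : Integrable (fun p : S2 × S2 => green (dot p.1 p.2) * f p.2 * g p.1)
      (area.prod area) :=
    hc.integrable_of_hasCompactSupport (HasCompactSupport.of_compactSpace _)
  have h := integral_integral_swap (f := fun x y => green (dot x y) * f y * g x) hi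
  have e1 : sphereIntegral (fun x => greenOp f x * g x) =
      ∫ x, ∫ y, green (dot x y) * f y * g x ∂area ∂area := by
    refine integral_congr_ae (Eventually.of_forall fun x => ?_)
    simp only [integral_mul_const]
    rfl
  have e2 : sphereIntegral (fun y => f y * greenOp g y) =
      ∫ y, ∫ x, green (dot x y) * f y * g x ∂area ∂area := by
    refine integral_congr_ae (Eventually.of_forall fun y => ?_)
    have : ∀ x, green (dot x y) * f y * g x = f y * (green (dot y x) * g x) := fun x => by
      rw [dot_comm]; ring
    simp only [this, integral_const_mul]
    rfl
  rw [e1, e2, h]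

lemma sphereIntegral_dot_mul {h : S2 → ℝ} (hh : SmoothFn h) (x : S2) :
    sphereIntegral (fun y => dot x y * h y) =
      ∑ i, (x : E3) i * sphereIntegral (fun y => h y * (y : E3) i) := by
  have h1 : (fun y => dot x y * h y) = fun y => ∑ i, (x : E3) i * (h y * (y : E3) i) := by
    funext y
    rw [dot_eq, Finset.sum_mul]
    exact Finset.sum_congr rfl fun i _ => by ring
  rw [h1, sphereIntegral_sum (fun i => by fun_prop)]
  simp only [sphereIntegral_const_mul]

@[fun_prop]
lemma smoothFn_dot_mul {h : S2 → ℝ} (hh : SmoothFn h) :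
    SmoothFn (fun x => sphereIntegral (fun y => dot x y * h y)) := by
  simp only [sphereIntegral_dot_mul hh]
  fun_prop

/-- The Green operator is also a right inverse of `D² (D² + 2)`. It follows from the
corresponding fact for left inverses since both operators are symmetric. -/
lemma lap2_greenOp {h : S2 → ℝ} (hh : SmoothFn h) (x : S2) :
    lap2 (greenOp h) x = 2 * totalArea * h x - 2 * sphereIntegral h -
      6 * sphereIntegral (fun y => dot x y * h y) := by
  set w : S2 → ℝ := fun x => 2 * totalArea * h x - 2 * sphereIntegral h -
      6 * sphereIntegral (fun y => dot x y * h y) with hw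
  have hws : SmoothFn w := by fun_prop
  -- `w` is the right-hand side and `u` the difference of the two sides; both have the same pairing
  -- with `u`, so that `∫ u² = 0`
  set u : S2 → ℝ := fun x => lap2 (greenOp h) x - w x with hu
  have hus : SmoothFn u := by fun_prop
  have h1 : sphereIntegral (fun x => u x * lap2 (greenOp h) x) =
      sphereIntegral (fun x => u x * w x) := by
    rw [sphereIntegral_lap2_symm hus hh.greenOp, ← sphereIntegral_greenOp_symm hus.lap2 hh]
    have e1 : sphereIntegral (fun x => greenOp (lap2 u) x * h x) =
        2 * totalArea * sphereIntegral (fun x => u x * h x) -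
        2 * (sphereIntegral u * sphereIntegral h) -
        6 * sphereIntegral (fun x => sphereIntegral (fun y => dot x y * u y) * h x) := by
      rw [← sphereIntegral_const_mul, ← sphereIntegral_const_mul, ← sphereIntegral_const_mul,
        ← sphereIntegral_const_mul,
        ← sphereIntegral_sub (by fun_prop) (by fun_prop),
        ← sphereIntegral_sub (by fun_prop) (SmoothFn.continuous (by fun_prop))]
      congr 1
      funext x
      rw [greenOp_lap2 hus]
      ring
    have e2 : sphereIntegral (fun x => u x * w x) =
        2 * totalArea * sphereIntegral (fun x => u x * h x) -
        2 * (sphereIntegral h * sphereIntegral u) -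
        6 * sphereIntegral (fun x => sphereIntegral (fun y => dot x y * h y) * u x) := by
      rw [← sphereIntegral_const_mul, ← sphereIntegral_const_mul, ← sphereIntegral_const_mul,
        ← sphereIntegral_const_mul,
        ← sphereIntegral_sub (by fun_prop) (by fun_prop),
        ← sphereIntegral_sub (by fun_prop) (SmoothFn.continuous (by fun_prop))]
      congr 1
      funext x
      rw [hw]
      ring
    have e3 : ∀ {f g : S2 → ℝ}, SmoothFn f → SmoothFn g →
        sphereIntegral (fun x => sphereIntegral (fun y => dot x y * f y) * g x) =
        ∑ i, sphereIntegral (fun y => f y * (y : E3) i) *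
          sphereIntegral (fun y => g y * (y : E3) i) := by
      intro f g hf hg
      simp only [sphereIntegral_dot_mul hf, ← sphereIntegral_const_mul]
      rw [← sphereIntegral_sum (fun i => by fun_prop)]
      congr 1
      funext x
      rw [Finset.sum_mul]
      refine Finset.sum_congr rfl fun i _ => ?_
      simp only [sphereIntegral_const_mul]
      ring
    rw [e1, e2, e3 hus hh, e3 hh hus, mul_comm (sphereIntegral u)]
    simp only [mul_comm (sphereIntegral fun y => u y * _)]
  have h2 : sphereIntegral (fun x => u x ^ 2) = 0 := by
    have : (fun x => u x ^ 2) = fun x => u x * lap2 (greenOp h) x - u x * w x := by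
      funext x; simp only [hu]; ring
    rw [this, sphereIntegral_sub (by fun_prop) (by fun_prop), h1, sub_self]
  have h3 := eq_zero_of_sphereIntegral_sq hus.continuous h2 x
  simp only [hu] at h3
  linarith

lemma sphereIntegral_coord_mul (i j : Fin 3) :
    sphereIntegral (fun x => (x : E3) i * (x : E3) j) =
      if i = j then totalArea / 3 else 0 := by
  have h := sphereIntegral_grad (smoothFn_coord i) j
  simp only [grad_coord, q] at h
  rw [sphereIntegral_sub (by fun_prop) (by fun_prop), sphereIntegral_const] at h
  simp only [mul_comm (_ : ℝ) ((_ : E3) i)] at h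
  rcases eq_or_ne i j with rfl | hij
  · simp only [if_true] at h ⊢
    linarith
  · simp only [hij, hij.symm, if_false] at h ⊢
    linarith

/-- The part of a function that is orthogonal to the spherical harmonics with `ℓ = 0, 1`. -/
def projHigh (k : S2 → ℝ) (x : S2) : ℝ :=
  k x - sphereIntegral k / totalArea -
    3 / totalArea * ∑ i, sphereIntegral (fun y => k y * (y : E3) i) * (x : E3) i

@[fun_prop]
lemma SmoothFn.projHigh {k : S2 → ℝ} (hk : SmoothFn k) : SmoothFn (projHigh k) := by
  unfold NullInfinity.projHigh
  fun_prop

lemma sphereIntegral_projHigh {k : S2 → ℝ} (hk : SmoothFn k) :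
    sphereIntegral (projHigh k) = 0 := by
  have hA := totalArea_pos.ne'
  unfold projHigh
  rw [sphereIntegral_sub (by fun_prop) (by fun_prop), sphereIntegral_sub (by fun_prop)
    (by fun_prop), sphereIntegral_const, sphereIntegral_const_mul,
    sphereIntegral_sum (fun i => by fun_prop)]
  simp only [sphereIntegral_const_mul, sphereIntegral_coord]
  simp
  field_simp
  ring

lemma sphereIntegral_projHigh_coord {k : S2 → ℝ} (hk : SmoothFn k) (j : Fin 3) :
    sphereIntegral (fun x => projHigh k x * (x : E3) j) = 0 := by
  have hA := totalArea_pos.ne'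
  have h1 : (fun x : S2 => projHigh k x * (x : E3) j) = fun x : S2 => k x * (x : E3) j -
      sphereIntegral k / totalArea * (x : E3) j - 3 / totalArea *
      ∑ i, sphereIntegral (fun y => k y * (y : E3) i) * ((x : E3) i * (x : E3) j) := by
    funext x
    simp only [projHigh, Fin.sum_univ_three]
    ring
  rw [h1, sphereIntegral_sub (by fun_prop) (by fun_prop), sphereIntegral_sub (by fun_prop)
    (by fun_prop), sphereIntegral_const_mul, sphereIntegral_const_mul,
    sphereIntegral_sum (fun i => by fun_prop)]
  simp only [sphereIntegral_const_mul, sphereIntegral_coord, sphereIntegral_coord_mul]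
  simp
  field_simp
  ring

lemma lap2_projHigh {k : S2 → ℝ} (hk : SmoothFn k) (x : S2) : lap2 (projHigh k) x = lap2 k x := by
  have h1 : projHigh k = fun x => k x + ((-(sphereIntegral k / totalArea)) +
      (((-(3 / totalArea) * sphereIntegral (fun y => k y * (y : E3) 0)) * (x : E3) 0 +
      (-(3 / totalArea) * sphereIntegral (fun y => k y * (y : E3) 1)) * (x : E3) 1) +
      (-(3 / totalArea) * sphereIntegral (fun y => k y * (y : E3) 2)) * (x : E3) 2)) := by
    funext x
    simp only [projHigh, Fin.sum_univ_three]
    ring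
  rw [h1, lap2_add (by fun_prop) (by fun_prop), lap2_add (by fun_prop) (by fun_prop),
    lap2_add (by fun_prop) (by fun_prop), lap2_add (by fun_prop) (by fun_prop), lap2_const]
  simp only [lap2_const_mul (smoothFn_coord _), lap2_coord]
  ring

lemma greenOp_lap2_eq_projHigh {k : S2 → ℝ} (hk : SmoothFn k) (x : S2) :
    greenOp (lap2 k) x = 2 * totalArea * projHigh k x := by
  have hA := totalArea_pos.ne'
  rw [greenOp_lap2 hk, sphereIntegral_dot_mul hk, projHigh]
  simp only [Fin.sum_univ_three]
  field_simp
  ring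

lemma projHigh_eq_self {k : S2 → ℝ} (h0 : sphereIntegral k = 0)
    (h1 : ∀ i, sphereIntegral (fun x => k x * (x : E3) i) = 0) : projHigh k = k := by
  funext x
  simp [projHigh, h0, h1]

lemma IsPotential.lap2_eq {T : Field2} {c : S2 → ℝ} (hc : IsPotential T c) (x : S2) :
    lap2 c x = 2 * ddiv T x := by
  have := hc.eqn x
  rw [lap2, ddiv, ← this]
  ring

lemma IsPotential.eq {T : Field2} {c d : S2 → ℝ} (hc : IsPotential T c) (hd : IsPotential T d) :
    c = d := by
  funext x
  have h1 := greenOp_lap2_eq_projHigh hc.smooth x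
  have h2 := greenOp_lap2_eq_projHigh hd.smooth x
  have h3 : lap2 c = lap2 d := by
    funext y
    rw [hc.lap2_eq, hd.lap2_eq]
  rw [projHigh_eq_self hc.no_l0 hc.no_l1] at h1
  rw [projHigh_eq_self hd.no_l0 hd.no_l1] at h2
  rw [h3] at h1
  exact mul_left_cancel₀ (mul_ne_zero two_ne_zero totalArea_pos.ne') (h1.symm.trans h2)

lemma IsSTF.exists_isPotential {T : Field2} (hT : IsSTF T) : ∃ c, IsPotential T c := by
  have hA := totalArea_pos.ne'
  have hs : SmoothFn (ddiv T) := hT.smooth_ddiv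
  have hg : SmoothFn (fun x => 1 / totalArea * greenOp (ddiv T) x) := by fun_prop
  refine ⟨projHigh (fun x => 1 / totalArea * greenOp (ddiv T) x), hg.projHigh, fun x => ?_,
    sphereIntegral_projHigh hg, sphereIntegral_projHigh_coord hg⟩
  have h := lap2_projHigh hg x
  rw [lap2_const_mul hs.greenOp, lap2_greenOp hs, sphereIntegral_dot_mul hs,
    sphereIntegral_ddiv hT] at h
  simp only [sphereIntegral_ddiv_coord hT] at h
  rw [lap2] at h
  rw [h]
  simp
  field_simp

lemma IsSTF.isPotential_potential {T : Field2} (hT : IsSTF T) : IsPotential T (potential T) :=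
  Classical.epsilon_spec hT.exists_isPotential

/-! ### The energy estimate for the potential -/

lemma sq_sphereIntegral_abs_le {c : S2 → ℝ} (hc : Continuous c) :
    sphereIntegral (fun x => |c x|) ^ 2 ≤ totalArea * sphereIntegral (fun x => c x ^ 2) := by
  have hA := totalArea_pos
  set m := sphereIntegral (fun x => |c x|) with hm
  have h := sphereIntegral_nonneg (f := fun x => (totalArea * |c x| - m) ^ 2)
    (fun x => sq_nonneg _)
  have h1 : (fun x => (totalArea * |c x| - m) ^ 2) = fun x => (totalArea ^ 2 * c x ^ 2 -
      2 * totalArea * m * |c x|) + m ^ 2 := by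
    funext x
    rw [← sq_abs (c x)]
    ring
  rw [h1, sphereIntegral_add (by fun_prop) (by fun_prop), sphereIntegral_sub (by fun_prop)
    (by fun_prop), sphereIntegral_const_mul, sphereIntegral_const_mul, sphereIntegral_const,
    ← hm] at h
  have h2 : 0 ≤ totalArea * (totalArea * sphereIntegral (fun x => c x ^ 2) - m ^ 2) := by
    linarith
  have := nonneg_of_mul_nonneg_right h2 hA
  linarith

lemma exists_green_bound : ∃ κ : ℝ, 0 < κ ∧ ∀ x y : S2, |green (dot x y)| ≤ κ := by
  obtain ⟨K, hK⟩ := (isCompact_Icc (a := (-1 : ℝ)) (b := 1)).exists_bound_of_continuousOn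
    continuous_green.continuousOn
  refine ⟨|K| + 1, by positivity, fun x y => ?_⟩
  have := hK (dot x y) ⟨neg_one_le_dot x y, dot_le_one x y⟩
  rw [Real.norm_eq_abs] at this
  linarith [le_abs_self K]

/-- The quadratic form of the Green operator is bounded on `L²`. -/
lemma exists_greenOp_bound : ∃ κ : ℝ, 0 < κ ∧ ∀ c : S2 → ℝ, SmoothFn c →
    |sphereIntegral (fun x => greenOp c x * c x)| ≤
      κ * totalArea * sphereIntegral (fun x => c x ^ 2) := by
  obtain ⟨κ, hκ, hb⟩ := exists_green_bound
  refine ⟨κ, hκ, fun c hc => ?_⟩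
  have hcc := hc.continuous
  have h1 : ∀ x, |greenOp c x| ≤ κ * sphereIntegral (fun y => |c y|) := by
    intro x
    rw [← sphereIntegral_const_mul]
    refine abs_sphereIntegral_le (by fun_prop) fun y => ?_
    rw [abs_mul]
    exact mul_le_mul_of_nonneg_right (hb x y) (abs_nonneg _)
  have h2 := abs_sphereIntegral_le (f := fun x => greenOp c x * c x)
    (g := fun x => κ * sphereIntegral (fun y => |c y|) * |c x|) (by fun_prop) (fun x => by
      rw [abs_mul]
      exact mul_le_mul_of_nonneg_right (h1 x) (abs_nonneg _))
  rw [sphereIntegral_const_mul] at h2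
  calc _ ≤ _ := h2
    _ = κ * sphereIntegral (fun y => |c y|) ^ 2 := by ring
    _ ≤ κ * (totalArea * sphereIntegral (fun x => c x ^ 2)) :=
      mul_le_mul_of_nonneg_left (sq_sphereIntegral_abs_le hcc) hκ.le
    _ = _ := by ring

/-- Young's inequality for the pairing of two tensors. -/
lemma abs_sphereIntegral_contract_le {S T : Field2} (hS : ∀ i j, SmoothFn (fun x => S x i j))
    (hT : ∀ i j, SmoothFn (fun x => T x i j)) {l : ℝ} (hl : 0 < l) :
    |sphereIntegral (fun x => ∑ i, ∑ j, S x i j * T x i j)| ≤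
      l / 2 * sphereIntegral (fun x => ∑ i, ∑ j, S x i j ^ 2) +
      1 / (2 * l) * sphereIntegral (fun x => ∑ i, ∑ j, T x i j ^ 2) := by
  rw [← sphereIntegral_const_mul, ← sphereIntegral_const_mul,
    ← sphereIntegral_add (by fun_prop) (by fun_prop)]
  refine abs_sphereIntegral_le (by fun_prop) fun x => ?_
  rw [Finset.mul_sum, Finset.mul_sum, ← Finset.sum_add_distrib]
  refine (Finset.abs_sum_le_sum_abs _ _).trans (Finset.sum_le_sum fun i _ => ?_)
  rw [Finset.mul_sum, Finset.mul_sum, ← Finset.sum_add_distrib]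
  refine (Finset.abs_sum_le_sum_abs _ _).trans (Finset.sum_le_sum fun j _ => ?_)
  rw [abs_mul, ← sq_abs (S x i j), ← sq_abs (T x i j)]
  have h := sq_nonneg (l * |S x i j| - |T x i j|)
  have h2 : l / 2 * |S x i j| ^ 2 + 1 / (2 * l) * |T x i j| ^ 2 - |S x i j| * |T x i j| =
      1 / (2 * l) * (l * |S x i j| - |T x i j|) ^ 2 := by
    field_simp
    ring
  have h3 : 0 ≤ 1 / (2 * l) * (l * |S x i j| - |T x i j|) ^ 2 := by positivity
  linarith

/-- The `L²` norm of the gradient of a solution of `D² (D² + 2) k = 2 D^A D^B T_AB`, apart from its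
`ℓ = 0, 1` parts, is bounded by the `L²` norm of `T`. -/
lemma exists_energy_bound : ∃ K : ℝ, 0 ≤ K ∧ ∀ (T : Field2) (k : S2 → ℝ), IsSTF T → SmoothFn k →
    (∀ x, lap2 k x = 2 * ddiv T x) →
    sphereIntegral (fun x => ∑ i, grad (projHigh k) x i ^ 2) ≤
      K * sphereIntegral (fun x => ∑ i, ∑ j, T x i j ^ 2) := by
  obtain ⟨κ, hκ, hb⟩ := exists_greenOp_bound
  refine ⟨2 * κ + 1, by positivity, fun T k hT hk hTk => ?_⟩
  have hA := totalArea_pos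
  set A := totalArea
  set c := projHigh k with hc
  have hcs : SmoothFn c := hk.projHigh
  have hTs := hT.smooth
  have hcT : ∀ x, lap2 c x = 2 * ddiv T x := fun x => by rw [hc, lap2_projHigh hk, hTk]
  have hgc : ∀ x, greenOp (lap2 c) x = 2 * A * c x := fun x => by
    have h : lap2 c = lap2 k := funext (lap2_projHigh hk)
    rw [h, greenOp_lap2_eq_projHigh hk]
  -- `w` is a multiple of the solution of `D² (D² + 2) w = c`
  set w := greenOp c with hw
  have hws : SmoothFn w := hcs.greenOp
  have hwl : ∀ x, lap2 w x = 2 * A * c x := fun x => by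
    rw [hw, lap2_greenOp hcs, sphereIntegral_dot_mul hcs, hc, sphereIntegral_projHigh hk]
    simp only [sphereIntegral_projHigh_coord hk]
    simp [A]
  set N := sphereIntegral (fun x => ∑ i, ∑ j, T x i j ^ 2) with hN
  set Q := sphereIntegral (fun x => c x ^ 2) with hQ
  have hQ0 : 0 ≤ Q := sphereIntegral_nonneg fun x => sq_nonneg _
  have pair : ∀ u, SmoothFn u → sphereIntegral (fun x => u x * lap2 c x) =
      - sphereIntegral (fun x => ∑ i, ∑ j, T x i j * stf u x i j) := by
    intro u hu
    have h1 : (fun x => u x * lap2 c x) = fun x => 2 * (u x * ddiv T x) := by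
      funext x; rw [hcT]; ring
    rw [h1, sphereIntegral_const_mul, sphereIntegral_mul_ddiv' hT hu]
    ring
  -- `∫ c²` is the pairing of `T` with the second derivatives of `w`, whose norm is bounded by `∫ c²`;
  -- the parameter of Young's inequality is chosen so that half of it is absorbed
  have hQN : Q ≤ κ * N := by
    have h1 : 2 * A * Q = sphereIntegral (fun x => w x * lap2 c x) := by
      rw [hw, sphereIntegral_greenOp_symm hcs hcs.lap2, hQ, ← sphereIntegral_const_mul]
      congr 1
      funext x
      rw [hgc]
      ring
    have h2 := abs_sphereIntegral_contract_le hTs (isSTF_stf hws).smooth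
      (l := 2 * κ * A) (by positivity)
    rw [pair w hws] at h1
    have h3 : sphereIntegral (fun x => ∑ i, ∑ j, stf w x i j ^ 2) ≤ 4 * A * (κ * A * Q) := by
      rw [sphereIntegral_normSq_stf hws]
      have h4 : (fun x => w x * lap2 w x) = fun x => 2 * A * (greenOp c x * c x) := by
        funext x; rw [hwl]; ring
      rw [h4, sphereIntegral_const_mul]
      have h5 := (le_abs_self _).trans (hb c hcs)
      have h6 := mul_le_mul_of_nonneg_left h5 (by positivity : 0 ≤ 4 * A)
      linarith
    have h4 : 2 * A * Q ≤ 2 * κ * A / 2 * N + 1 / (2 * (2 * κ * A)) * (4 * A * (κ * A * Q)) := by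
      have h5 := neg_abs_le (sphereIntegral (fun x => ∑ i, ∑ j, T x i j * stf w x i j))
      have h6 := mul_le_mul_of_nonneg_left h3 (by positivity : 0 ≤ 1 / (2 * (2 * κ * A)))
      linarith
    have h5 : 1 / (2 * (2 * κ * A)) * (4 * A * (κ * A * Q)) = A * Q := by
      field_simp
      ring
    rw [h5] at h4
    have h6 : A * Q ≤ A * (κ * N) := by linarith
    exact le_of_mul_le_mul_left h6 hA
  -- the energy `∫ c D² (D² + 2) c` controls `∫ |D c|²` with the help of the bound on `∫ c²`
  set E := sphereIntegral (fun x => c x * lap2 c x) with hE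
  have hEN : E ≤ 2 * N := by
    have h1 := pair c hcs
    have h2 := abs_sphereIntegral_contract_le hTs (isSTF_stf hcs).smooth (l := 2) (by norm_num)
    rw [sphereIntegral_normSq_stf hcs] at h2
    have h5 := neg_abs_le (sphereIntegral (fun x => ∑ i, ∑ j, T x i j * stf c x i j))
    linarith
  set G := sphereIntegral (fun x => ∑ i, grad c x i ^ 2) with hG
  have hGl : sphereIntegral (fun x => c x * lap c x) = - G := by
    rw [sphereIntegral_mul_lap hcs hcs, hG]
    simp only [pow_two]
  have hEl : E = sphereIntegral (fun x => lap c x ^ 2) - 2 * G := by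
    have h1 : sphereIntegral (fun x => c x * lap2 c x) =
        sphereIntegral (fun x => lap c x * (lap c x + 2 * c x)) :=
      sphereIntegral_lap_symm hcs hcs.lap_add_two
    have h2 : (fun x => lap c x * (lap c x + 2 * c x)) =
        fun x => lap c x ^ 2 + 2 * (c x * lap c x) := by funext x; ring
    rw [hE, h1, h2, sphereIntegral_add (by fun_prop) (by fun_prop), sphereIntegral_const_mul, hGl]
    ring
  have h1 : G ≤ Q + 1 / 4 * sphereIntegral (fun x => lap c x ^ 2) := by
    have h2 : sphereIntegral (fun x => - (c x * lap c x)) ≤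
        sphereIntegral (fun x => c x ^ 2 + 1 / 4 * lap c x ^ 2) :=
      sphereIntegral_mono (by fun_prop) (by fun_prop) fun x => by
        have := sq_nonneg (c x + 1 / 2 * lap c x)
        linarith
    rw [sphereIntegral_neg, hGl, sphereIntegral_add (by fun_prop) (by fun_prop),
      sphereIntegral_const_mul] at h2
    linarith
  linarith

/-! ### Killing fields -/

/-- A smooth function on the sphere with vanishing gradient is constant. -/
lemma eq_of_grad_eq_zero {f : S2 → ℝ} (hf : SmoothFn f) (h : ∀ x i, grad f x i = 0)
    (x y : S2) : f x = f y := by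
  have hc : IsConnected ({0}ᶜ : Set E3) := isConnected_compl_singleton_of_one_lt_rank (by
    rw [← Module.finrank_eq_rank, finrank_euclideanSpace_fin]; norm_num) 0
  have hz : ∀ x : S2, fderiv ℝ (radialExt f) x = 0 := by
    intro x
    ext v
    have h6 : v = ∑ i, v i • e i := by
      ext j
      simp [e, Fin.sum_univ_three]
      fin_cases j <;> simp
    rw [h6, map_sum]
    simp only [map_smul]
    have h7 : ∀ i, fderiv ℝ (radialExt f) x (e i) = 0 := fun i => h x i
    simp [h7]
  have hd : ∀ y ∈ ({0}ᶜ : Set E3), fderiv ℝ (radialExt f) y = 0 := by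
    intro y hy
    have hn : 0 < ‖y‖⁻¹ := inv_pos.mpr (norm_pos_iff.mpr hy)
    have h1 : (fun z => radialExt f (‖y‖⁻¹ • z)) = radialExt f := by
      funext z; exact radialExt_smul f hn z
    have h2 := fderiv_comp_smul (𝕜 := ℝ) (f := radialExt f) (x := y) (‖y‖⁻¹)
    rw [h1, ← proj_of_ne hy, hz, smul_zero] at h2
    exact h2
  have := isOpen_compl_singleton.is_const_of_fderiv_eq_zero (𝕜 := ℝ) (f := radialExt f)
    hc.isPreconnected (fun y hy => (hf.diff hy).differentiableWithinAt) hd x.ne_zero y.ne_zero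
  rwa [radialExt_coe, radialExt_coe] at this

/-- The infinitesimal rotation of the sphere with (constant, antisymmetric) matrix `B`,
characterized by its derivative; equivalently `Y_i = ∑ k, x_k B_ki`. -/
structure IsRot (Y : Field1) (B : Fin 3 → Fin 3 → ℝ) : Prop where
  isTan : IsTan Y
  anti : ∀ i j, B i j = - B j i
  deriv : ∀ x k i, grad (fun y => Y y i) x k = B k i - (x : E3) k * Y x i

/-- Killing fields on the sphere are infinitesimal rotations: the homogeneous extension of degree
one of a Killing field is a Killing field of Euclidean space, so that its second derivatives,
symmetric in one pair of indices and antisymmetric in another, vanish. -/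
lemma IsKilling.exists_isRot {Y : Field1} (hY : IsKilling Y) : ∃ B, IsRot Y B := by
  have ht : IsTan Y := ⟨hY.smooth, hY.tangential⟩
  have hs := ht.smooth
  -- the Euclidean derivative of the homogeneous extension
  set b : S2 → Fin 3 → Fin 3 → ℝ := fun x k i =>
    grad (fun y => Y y i) x k + (x : E3) k * Y x i with hb
  have hbs : ∀ k i, SmoothFn (fun x => b x k i) := fun k i => by
    simp only [hb]; fun_prop
  have hanti : ∀ x k i, b x k i = - b x i k := by
    intro x k i
    have := hY.killing x k i
    rw [ht.covD1_eq, ht.covD1_eq] at this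
    simp only [hb]
    linarith
  have hsymm : ∀ x l k i, grad (fun y => b y k i) x l = grad (fun y => b y l i) x k := by
    intro x l k i
    have h1 : ∀ l k, grad (fun y => b y k i) x l =
        grad (fun y => grad (fun y => Y y i) y k) x l + (q x l k * Y x i +
          (x : E3) k * grad (fun y => Y y i) x l) := by
      intro l k
      simp only [hb]
      rw [grad_add (by fun_prop) (by fun_prop), grad_mul (by fun_prop) (by fun_prop), grad_coord]
    have h2 := grad_grad_comm (hs i) x l k
    have h3 : q x l k = q x k l := by simp only [q, eq_comm (a := l), mul_comm]
    rw [h1, h1, h3]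
    linarith
  have hanti' : ∀ x l k i, grad (fun y => b y k i) x l = - grad (fun y => b y i k) x l := by
    intro x l k i
    rw [← grad_neg (hbs i k)]
    congr 1
    funext y
    exact hanti y k i
  have hzero : ∀ k i x l, grad (fun y => b y k i) x l = 0 := by
    intro k i x l
    have h1 := hsymm x l k i
    have h2 := hanti' x k l i
    have h3 := hsymm x k i l
    have h4 := hanti' x i k l
    have h5 := hsymm x i l k
    have h6 := hanti' x l i k
    linarith
  -- any point will do
  let x₀ : S2 := proj 0
  refine ⟨b x₀, ht, hanti x₀, fun x k i => ?_⟩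
  rw [eq_of_grad_eq_zero (hbs k i) (hzero k i) x₀ x]
  simp only [hb]
  ring

namespace IsRot

variable {Y : Field1} {B : Fin 3 → Fin 3 → ℝ}

lemma smooth (hY : IsRot Y B) : ∀ i, SmoothFn (fun x => Y x i) := hY.isTan.smooth

lemma eq (hY : IsRot Y B) (x : S2) (i : Fin 3) : ∑ k, (x : E3) k * B k i = Y x i := by
  have h := grad_tangential (hY.smooth i) x
  have h2 := x.sum_sq
  simp only [hY.deriv, Fin.sum_univ_three] at h ⊢
  linear_combination h + Y x i * h2

lemma diag (hY : IsRot Y B) (i : Fin 3) : B i i = 0 := by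
  have := hY.anti i i
  linarith

lemma div_eq_zero (hY : IsRot Y B) (x : S2) : ∑ i, grad (fun y => Y y i) x i = 0 := by
  have h := hY.isTan.tan x
  simp only [hY.deriv, hY.diag, Fin.sum_univ_three] at h ⊢
  linarith

end IsRot

lemma smoothFn_alongD {Y : Field1} (hY : ∀ i, SmoothFn (fun x => Y x i)) {f : S2 → ℝ}
    (hf : SmoothFn f) : SmoothFn (alongD Y f) := by
  unfold alongD
  fun_prop

namespace IsRot

variable {Y : Field1} {B : Fin 3 → Fin 3 → ℝ}

lemma smooth_alongD (hY : IsRot Y B) {f : S2 → ℝ} (hf : SmoothFn f) : SmoothFn (alongD Y f) :=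
  smoothFn_alongD hY.smooth hf

/-- Rotation fields are antisymmetric operators. -/
lemma sphereIntegral_alongD (hY : IsRot Y B) {f g : S2 → ℝ} (hf : SmoothFn f) (hg : SmoothFn g) :
    sphereIntegral (fun x => alongD Y f x * g x) = - sphereIntegral (fun x => f x * alongD Y g x) := by
  have hs := hY.smooth
  have h := sphereIntegral_div (V := fun x i => (f x * g x) * Y x i) (by fun_prop) (fun x => by
    have := hY.isTan.tan x
    simp only [mul_assoc, ← Finset.mul_sum, this, mul_zero])
  have h1 : ∀ x, ∑ i, grad (fun y => (f y * g y) * Y y i) x i =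
      alongD Y f x * g x + f x * alongD Y g x := by
    intro x
    have h2 := hY.div_eq_zero x
    simp only [grad_mul (hf.mul hg) (hs _), grad_mul hf hg, alongD, Fin.sum_univ_three] at h2 ⊢
    linear_combination f x * g x * h2
  have c1 := hY.smooth_alongD hf
  have c2 := hY.smooth_alongD hg
  simp only [h1] at h
  rw [sphereIntegral_add (by fun_prop) (by fun_prop)] at h
  linarith

lemma sphereIntegral_alongD_self (hY : IsRot Y B) {f : S2 → ℝ} (hf : SmoothFn f) :
    sphereIntegral (fun x => alongD Y f x * f x) = 0 := by
  have h := hY.sphereIntegral_alongD hf hf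
  simp only [mul_comm (f _)] at h
  linarith

/-- The commutator of a rotation field with the components of the gradient. -/
lemma grad_alongD (hY : IsRot Y B) {f : S2 → ℝ} (hf : SmoothFn f) (x : S2) (l : Fin 3) :
    grad (alongD Y f) x l = alongD Y (fun y => grad f y l) x + ∑ i, B l i * grad f x i := by
  have hs := hY.smooth
  have h1 : alongD Y f = fun y => ∑ i, Y y i * grad f y i := rfl
  have h2 : ∀ i, grad (fun y => grad f y i) x l = grad (fun y => grad f y l) x i +
      (x : E3) l * grad f x i - (x : E3) i * grad f x l := fun i => by
    have := grad_grad_comm hf x l i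
    linarith
  have h3 := hY.isTan.tan x
  rw [h1, grad_sum (by fun_prop)]
  simp only [grad_mul (hs _) (hf.grad _), h2, hY.deriv, alongD, Fin.sum_univ_three] at h3 ⊢
  linear_combination - grad f x l * h3

/-- Rotation fields commute with the Laplacian. -/
lemma lap_alongD (hY : IsRot Y B) {f : S2 → ℝ} (hf : SmoothFn f) (x : S2) :
    lap (alongD Y f) x = alongD Y (lap f) x := by
  have hs := hY.smooth
  have hg : ∀ i, SmoothFn (alongD Y (fun y => grad f y i)) := fun i =>
    hY.smooth_alongD (hf.grad i)
  rw [lap_eq (hY.smooth_alongD hf)]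
  have h1 : ∀ l, (fun y => grad (alongD Y f) y l) =
      fun y => alongD Y (fun y => grad f y l) y + ∑ i, B l i * grad f y i :=
    fun l => funext fun y => hY.grad_alongD hf y l
  have h2 : ∀ l, grad (fun y => grad (alongD Y f) y l) x l =
      (alongD Y (fun y => grad (fun y => grad f y l) y l) x +
        ∑ i, B l i * grad (fun y => grad f y l) x i) +
      ∑ i, B l i * grad (fun y => grad f y i) x l := by
    intro l
    rw [h1, grad_add (hg l) (by fun_prop), grad_sum (by fun_prop),
      hY.grad_alongD (hf.grad l)]
    simp only [grad_const_mul (hf.grad _)]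
  have h3 : alongD Y (lap f) x = ∑ l, alongD Y (fun y => grad (fun y => grad f y l) y l) x := by
    have h4 : lap f = fun y => ∑ l, grad (fun y => grad f y l) y l := funext (lap_eq hf)
    simp only [alongD]
    rw [Finset.sum_comm]
    refine Finset.sum_congr rfl fun i _ => ?_
    rw [h4, grad_sum (by fun_prop), Finset.mul_sum]
  rw [h3]
  simp only [h2, Fin.sum_univ_three, hY.diag, hY.anti 1 0, hY.anti 2 0, hY.anti 2 1]
  ring

lemma alongD_add {f g : S2 → ℝ} (hf : SmoothFn f) (hg : SmoothFn g) (x : S2) :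
    alongD Y (fun y => f y + g y) x = alongD Y f x + alongD Y g x := by
  simp only [alongD, grad_add hf hg, mul_add, Finset.sum_add_distrib]

lemma alongD_const_mul {f : S2 → ℝ} (hf : SmoothFn f) (c : ℝ) (x : S2) :
    alongD Y (fun y => c * f y) x = c * alongD Y f x := by
  simp only [alongD, grad_const_mul hf, Finset.mul_sum]
  exact Finset.sum_congr rfl fun i _ => by ring

lemma lap_add_two_alongD (hY : IsRot Y B) {f : S2 → ℝ} (hf : SmoothFn f) (x : S2) :
    lap (alongD Y f) x + 2 * alongD Y f x = alongD Y (fun y => lap f y + 2 * f y) x := by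
  rw [hY.lap_alongD hf, alongD_add hf.lap (hf.const_mul 2), alongD_const_mul hf]

lemma lap2_alongD (hY : IsRot Y B) {f : S2 → ℝ} (hf : SmoothFn f) (x : S2) :
    lap2 (alongD Y f) x = alongD Y (lap2 f) x := by
  rw [lap2]
  simp only [hY.lap_add_two_alongD hf]
  rw [hY.lap_alongD hf.lap_add_two]
  rfl

lemma sphereIntegral_lap2_alongD (hY : IsRot Y B) {f : S2 → ℝ} (hf : SmoothFn f) :
    sphereIntegral (fun x => lap2 f x * alongD Y f x) = 0 := by
  have h1 := sphereIntegral_lap2_symm hf (hY.smooth_alongD hf)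
  simp only [hY.lap2_alongD hf] at h1
  have h2 := hY.sphereIntegral_alongD hf hf.lap2
  simp only [mul_comm (alongD Y f _)] at h2
  linarith

/-- The part of the Dray-Streubel angular momentum that is quadratic in the supertranslation
vanishes: this is the vanishing of the angular momentum of Minkowski space. -/
lemma sphereIntegral_stf_stf (hY : IsRot Y B) {f : S2 → ℝ} (hf : SmoothFn f) :
    sphereIntegral (fun x => ∑ i, Y x i * ∑ j, stf f x i j * div2 (stf f) x j) = 0 := by
  have hs := hY.smooth
  set h : S2 → ℝ := fun y => lap f y + 2 * f y with hh
  have hhs : SmoothFn h := by fun_prop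
  have ha : SmoothFn (alongD Y f) := hY.smooth_alongD hf
  have hah : SmoothFn (alongD Y h) := hY.smooth_alongD hhs
  -- pointwise form of the integrand
  have h1 : ∀ x, ∑ i, Y x i * ∑ j, stf f x i j * div2 (stf f) x j =
      2 * (∑ j, grad (alongD Y f) x j * grad h x j) -
      2 * (∑ j, (∑ i, B j i * grad f x i) * grad h x j) - lap f x * alongD Y h x := by
    intro x
    have a1 : ∀ j, ∑ i, Y x i * hess f x i j = grad (alongD Y f) x j -
        ∑ i, B j i * grad f x i + (x : E3) j * alongD Y f x := by
      intro j
      rw [hY.grad_alongD hf]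
      simp only [alongD, hess_eq hf, Fin.sum_univ_three]
      ring
    have a2 : ∀ j, ∑ i, Y x i * q x i j = Y x j := by
      intro j
      have h3 := hY.isTan.tan x
      have h2 : ∑ i, (if i = j then (1 : ℝ) else 0) * Y x i = Y x j := by simp
      simp only [q, Fin.sum_univ_three] at h3 h2 ⊢
      linear_combination h2 - (x : E3) j * h3
    have a3 : ∑ i, Y x i * ∑ j, stf f x i j * div2 (stf f) x j =
        2 * (∑ j, (∑ i, Y x i * hess f x i j) * grad h x j) -
        lap f x * ∑ j, (∑ i, Y x i * q x i j) * grad h x j := by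
      simp only [div2_stf hf, stf, Fin.sum_univ_three]
      ring
    have a4 := grad_tangential hhs x
    rw [a3]
    simp only [a1, a2, alongD, Fin.sum_univ_three] at a4 ⊢
    linear_combination 2 * (Y x 0 * grad f x 0 + Y x 1 * grad f x 1 + Y x 2 * grad f x 2) * a4
  -- the term with the constant matrix
  have h2 : sphereIntegral (fun x => ∑ j, (∑ i, B j i * grad f x i) * grad h x j) =
      sphereIntegral (fun x => alongD Y f x * h x) := by
    have b1 : ∀ j, sphereIntegral (fun x => grad (fun y => (∑ i, B j i * grad f y i) * h y) x j) =
        2 * sphereIntegral (fun x => (∑ i, B j i * grad f x i) * h x * (x : E3) j) :=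
      fun j => sphereIntegral_grad (by fun_prop) j
    have b2 : sphereIntegral
        (fun x => ∑ j, grad (fun y => (∑ i, B j i * grad f y i) * h y) x j) =
        2 * sphereIntegral (fun x => ∑ j, (∑ i, B j i * grad f x i) * h x * (x : E3) j) := by
      rw [sphereIntegral_sum (fun j => by fun_prop), sphereIntegral_sum (fun j => by fun_prop),
        Finset.mul_sum]
      exact Finset.sum_congr rfl fun j _ => b1 j
    have b3 : ∀ x, ∑ j, (∑ i, B j i * grad f x i) * h x * (x : E3) j = alongD Y f x * h x := by
      intro x
      simp only [alongD, ← hY.eq, Fin.sum_univ_three]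
      ring
    have b4 : ∀ x, ∑ j, grad (fun y => (∑ i, B j i * grad f y i) * h y) x j =
        alongD Y f x * h x + ∑ j, (∑ i, B j i * grad f x i) * grad h x j := by
      intro x
      have b5 : ∀ j, grad (fun y => (∑ i, B j i * grad f y i) * h y) x j =
          (∑ i, B j i * grad (fun y => grad f y i) x j) * h x +
            (∑ i, B j i * grad f x i) * grad h x j := by
        intro j
        rw [grad_mul (by fun_prop) hhs, grad_sum (by fun_prop)]
        simp only [grad_const_mul (hf.grad _)]
      have c1 := grad_grad_comm hf x 0 1
      have c2 := grad_grad_comm hf x 0 2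
      have c3 := grad_grad_comm hf x 1 2
      simp only [b5]
      simp only [alongD, ← hY.eq, Fin.sum_univ_three, hY.diag, hY.anti 1 0, hY.anti 2 0,
        hY.anti 2 1]
      linear_combination h x * (B 0 1 * c1 + B 0 2 * c2 + B 1 2 * c3)
    simp only [b3, b4] at b2
    rw [sphereIntegral_add (by fun_prop) (by fun_prop)] at b2
    linarith
  have h3 : sphereIntegral (fun x => ∑ j, grad (alongD Y f) x j * grad h x j) =
      - sphereIntegral (fun x => alongD Y f x * lap h x) := by
    rw [sphereIntegral_mul_lap ha hhs, neg_neg]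
  have h4 : sphereIntegral (fun x => lap f x * alongD Y h x) =
      - sphereIntegral (fun x => alongD Y f x * lap h x) := by
    rw [sphereIntegral_lap_symm ha hhs]
    simp only [hY.lap_alongD hf]
    rw [hY.sphereIntegral_alongD hf.lap hhs, neg_neg]
  have h5 : sphereIntegral (fun x => alongD Y f x * lap h x) +
      2 * sphereIntegral (fun x => alongD Y f x * h x) = 0 := by
    have d1 := hY.sphereIntegral_alongD_self hhs
    simp only [hh, ← hY.lap_add_two_alongD hf] at d1
    rw [sphereIntegral_lap_symm ha hhs, ← sphereIntegral_const_mul,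
      ← sphereIntegral_add (by fun_prop) (by fun_prop), ← d1]
    congr 1
    funext x
    ring
  simp only [h1]
  rw [sphereIntegral_sub (by fun_prop) (by fun_prop), sphereIntegral_sub (by fun_prop)
    (by fun_prop), sphereIntegral_const_mul, sphereIntegral_const_mul, h2, h3, h4]
  linarith

end IsRot

/-! ### Time-dependent tensors and their restriction to cross-sections -/

/-- Smooth time-dependent symmetric traceless tangential two-tensor fields. -/
structure IsSTFTime (T : ℝ → Field2) : Prop where
  smooth : ∀ i j, SmoothInTime (fun u x => T u x i j)
  symm : ∀ u x i j, T u x i j = T u x j i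
  tan : ∀ u x i, ∑ j, T u x i j * (x : E3) j = 0
  trace : ∀ u x, ∑ i, T u x i i = 0

namespace IsSTFTime

variable {T : ℝ → Field2}

lemma slice (hT : IsSTFTime T) (u : ℝ) : IsSTF (T u) :=
  ⟨fun i j => (hT.smooth i j).at u, hT.symm u, hT.tan u, hT.trace u⟩

lemma onSection (hT : IsSTFTime T) {f : S2 → ℝ} (hf : SmoothFn f) :
    IsSTF (fun x i j => T (f x) x i j) :=
  ⟨fun i j => (hT.smooth i j).onSection hf, fun x => hT.symm (f x) x,
    fun x => hT.tan (f x) x, fun x => hT.trace (f x) x⟩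

lemma hasDerivAt (hT : IsSTFTime T) (u : ℝ) (x : S2) (i j : Fin 3) :
    HasDerivAt (fun t => T t x i j) (dot2 T u x i j) u := (hT.smooth i j).hasDerivAt u x

lemma timeDeriv (hT : IsSTFTime T) : IsSTFTime (dot2 T) := by
  refine ⟨fun i j => (hT.smooth i j).deriv, fun u x i j => ?_, fun u x i => ?_, fun u x => ?_⟩
  · have : (fun t => T t x i j) = fun t => T t x j i := funext fun t => hT.symm t x i j
    simp only [dot2, this]
  · have h1 : HasDerivAt (fun t => ∑ j, T t x i j * (x : E3) j)
        (∑ j, dot2 T u x i j * (x : E3) j) u :=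
      HasDerivAt.fun_sum fun j _ => (hT.hasDerivAt u x i j).mul_const _
    simp only [hT.tan] at h1
    exact h1.unique (hasDerivAt_const u 0)
  · have h1 : HasDerivAt (fun t => ∑ i, T t x i i) (∑ i, dot2 T u x i i) u :=
      HasDerivAt.fun_sum fun i _ => hT.hasDerivAt u x i i
    simp only [hT.trace] at h1
    exact h1.unique (hasDerivAt_const u 0)

lemma smooth_div2 (hT : IsSTFTime T) (j : Fin 3) : SmoothInTime (fun u x => div2 (T u) x j) := by
  have h : (fun u x => div2 (T u) x j) = fun u x => ∑ i, grad (fun y => T u y i j) x i := by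
    funext u x
    exact (hT.slice u).div2_eq x j
  rw [h]
  exact SmoothInTime.sum fun i => (hT.smooth i j).grad i

lemma smooth_ddiv (hT : IsSTFTime T) : SmoothInTime (fun u => ddiv (T u)) := by
  have h : (fun u => ddiv (T u)) = fun u x => ∑ i, grad (fun y => div2 (T u) y i) x i := by
    funext u x
    exact (hT.slice u).isTan_div2.div1_eq x
  rw [h]
  exact SmoothInTime.sum fun i => (hT.smooth_div2 i).grad i

/-- The divergence commutes with differentiation in time. -/
lemma deriv_div2 (hT : IsSTFTime T) (u : ℝ) (x : S2) (j : Fin 3) :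
    deriv (fun t => div2 (T t) x j) u = div2 (dot2 T u) x j := by
  have h : (fun t => div2 (T t) x j) = fun t => ∑ i, grad (fun y => T t y i j) x i :=
    funext fun t => (hT.slice t).div2_eq x j
  rw [h, (hT.timeDeriv.slice u).div2_eq]
  exact (HasDerivAt.fun_sum fun i _ => hasDerivAt_grad (hT.smooth i j) u x i).deriv

lemma grad_onSection (hT : IsSTFTime T) {f : S2 → ℝ} (hf : SmoothFn f) (x : S2) (k i j : Fin 3) :
    grad (fun y => T (f y) y i j) x k =
      grad (fun y => T (f x) y i j) x k + dot2 T (f x) x i j * grad f x k :=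
  NullInfinity.grad_onSection (hT.smooth i j) hf x k

lemma grad_div2_section (hT : IsSTFTime T) {f : S2 → ℝ} (hf : SmoothFn f) (x : S2) (k j : Fin 3) :
    grad (fun y => div2 (T (f y)) y j) x k =
      grad (fun y => div2 (T (f x)) y j) x k +
        div2 (dot2 T (f x)) x j * grad f x k := by
  rw [← hT.deriv_div2]
  exact NullInfinity.grad_onSection (hT.smooth_div2 j) hf x k

lemma div2_onSection (hT : IsSTFTime T) {f : S2 → ℝ} (hf : SmoothFn f) (x : S2) (j : Fin 3) :
    div2 (fun x i j => T (f x) x i j) x j =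
      div2 (T (f x)) x j + ∑ k, dot2 T (f x) x j k * grad f x k := by
  rw [(hT.onSection hf).div2_eq, (hT.slice (f x)).div2_eq, ← Finset.sum_add_distrib]
  refine Finset.sum_congr rfl fun i _ => ?_
  rw [hT.grad_onSection hf, hT.timeDeriv.symm (f x) x i j]

lemma isTan_div2_section (hT : IsSTFTime T) {f : S2 → ℝ} (hf : SmoothFn f) :
    IsTan (fun x j => div2 (T (f x)) x j) :=
  ⟨fun j => (hT.smooth_div2 j).onSection hf, fun x => (hT.slice (f x)).isTan_div2.tan x⟩

/-- The double divergence of the restriction of a tensor to a cross-section. -/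
lemma ddiv_onSection (hT : IsSTFTime T) {f : S2 → ℝ} (hf : SmoothFn f) (x : S2) :
    ddiv (fun x i j => T (f x) x i j) x = ddiv (T (f x)) x +
      2 * ∑ i, div2 (dot2 T (f x)) x i * grad f x i +
      (∑ i, ∑ j, dot2 (dot2 T) (f x) x i j * grad f x i * grad f x j) +
      ∑ i, ∑ j, dot2 T (f x) x i j * hess f x i j := by
  have hN := hT.timeDeriv.onSection hf
  have hNs := hN.smooth
  have hV := (hT.isTan_div2_section hf).smooth
  have h1 : ∀ j, (fun y => div2 (fun x i j => T (f x) x i j) y j) = fun y => div2 (T (f y)) y j +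
      ∑ k, dot2 T (f y) y j k * grad f y k :=
    fun j => funext fun y => hT.div2_onSection hf y j
  rw [ddiv, (hT.onSection hf).isTan_div2.div1_eq, ddiv, (hT.slice (f x)).isTan_div2.div1_eq]
  have h2 : ∀ j, grad (fun y => div2 (fun x i j => T (f x) x i j) y j) x j =
      (grad (fun y => div2 (T (f x)) y j) x j +
        div2 (dot2 T (f x)) x j * grad f x j) +
      ∑ k, ((grad (fun y => dot2 T (f x) y j k) x j +
        dot2 (dot2 T) (f x) x j k * grad f x j) * grad f x k +
        dot2 T (f x) x j k * grad (fun y => grad f y k) x j) := by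
    intro j
    rw [h1, grad_add (hV j) (by fun_prop), hT.grad_div2_section hf, grad_sum (by fun_prop)]
    congr 1
    refine Finset.sum_congr rfl fun k _ => ?_
    rw [grad_mul (hNs j k) (by fun_prop), hT.timeDeriv.grad_onSection hf]
  simp only [h2, (hT.timeDeriv.slice (f x)).div2_eq, hess_eq hf]
  have t0 := hT.timeDeriv.tan (f x) x 0
  have t1 := hT.timeDeriv.tan (f x) x 1
  have t2 := hT.timeDeriv.tan (f x) x 2
  simp only [Fin.sum_univ_three] at t0 t1 t2 ⊢
  linear_combination - grad f x 0 * t0 - grad f x 1 * t1 - grad f x 2 * t2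

end IsSTFTime

/-! ### Algebra of symmetric tensors in the tangent plane -/

/-- The polarized Cayley-Hamilton identity `N H + H N = tr (N H) + (tr H) N` in the plane orthogonal
to `x`, for `N` symmetric and traceless and `H` symmetric. It is obtained from the vanishing of
antisymmetrization over four indices in three dimensions, contracted with `x_i x_j`. -/
lemma cayley_hamilton {x Y f : Fin 3 → ℝ} {N H : Fin 3 → Fin 3 → ℝ} (hx : ∑ i, x i * x i = 1)
    (hN : ∀ i j, N i j = N j i) (hH : ∀ i j, H i j = H j i) (hNx : ∀ i, ∑ j, N i j * x j = 0)
    (hHx : ∀ i, ∑ j, H i j * x j = 0) (htr : ∑ i, N i i = 0) (hY : ∑ i, Y i * x i = 0)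
    (hf : ∑ i, f i * x i = 0) :
    ∑ i, (∑ j, N i j * f j) * (∑ k, H i k * Y k) + ∑ i, (∑ j, N i j * Y j) * (∑ k, H i k * f k) =
      (∑ i, ∑ j, N i j * H i j) * (∑ k, Y k * f k) +
        (∑ i, H i i) * ∑ i, Y i * ∑ j, N i j * f j := by
  have key : (∑ i, x i * x i) * (∑ i, N i i) * (∑ i, H i i) * (∑ k, Y k * f k)
      - ((∑ i, x i * ∑ j, N i j * x j) * (∑ i, H i i) * (∑ k, Y k * f k)
        + (∑ i, x i * ∑ j, H i j * x j) * (∑ i, N i i) * (∑ k, Y k * f k)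
        + (∑ i, f i * x i) * (∑ i, Y i * x i) * (∑ i, N i i) * (∑ i, H i i)
        + (∑ i, ∑ j, N i j * H i j) * (∑ i, x i * x i) * (∑ k, Y k * f k)
        + (∑ i, Y i * ∑ j, N i j * f j) * (∑ i, x i * x i) * (∑ i, H i i)
        + (∑ i, Y i * ∑ j, H i j * f j) * (∑ i, x i * x i) * (∑ i, N i i))
      + ((∑ i, x i * ∑ j, N i j * x j) * (∑ i, Y i * ∑ j, H i j * f j)
        + (∑ i, x i * ∑ j, H i j * x j) * (∑ i, Y i * ∑ j, N i j * f j)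
        + (∑ i, f i * x i) * (∑ i, Y i * x i) * (∑ i, ∑ j, N i j * H i j))
      + (2 * (∑ i, (∑ j, N i j * x j) * (∑ j, H i j * x j)) * (∑ k, Y k * f k)
        + (∑ i, f i * ∑ j, N i j * x j) * (∑ i, Y i * x i) * (∑ i, H i i)
        + (∑ i, Y i * ∑ j, N i j * x j) * (∑ i, f i * x i) * (∑ i, H i i)
        + (∑ i, f i * ∑ j, H i j * x j) * (∑ i, Y i * x i) * (∑ i, N i i)
        + (∑ i, Y i * ∑ j, H i j * x j) * (∑ i, f i * x i) * (∑ i, N i i)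
        + (∑ i, (∑ j, N i j * f j) * (∑ k, H i k * Y k)) * (∑ i, x i * x i)
        + (∑ i, (∑ j, N i j * Y j) * (∑ k, H i k * f k)) * (∑ i, x i * x i))
      - ((∑ i, (∑ j, H i j * f j) * (∑ j, N i j * x j)) * (∑ i, Y i * x i)
        + (∑ i, f i * ∑ j, N i j * x j) * (∑ i, Y i * ∑ j, H i j * x j)
        + (∑ i, (∑ j, N i j * f j) * (∑ j, H i j * x j)) * (∑ i, Y i * x i)
        + (∑ i, f i * ∑ j, H i j * x j) * (∑ i, Y i * ∑ j, N i j * x j)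
        + (∑ i, (∑ j, N i j * Y j) * (∑ j, H i j * x j)) * (∑ i, f i * x i)
        + (∑ i, (∑ j, H i j * Y j) * (∑ j, N i j * x j)) * (∑ i, f i * x i)) = 0 := by
    simp only [Fin.sum_univ_three]
    rw [hN 1 0, hN 2 0, hN 2 1, hH 1 0, hH 2 0, hH 2 1]
    ring
  simp only [hx, hNx, hHx, htr, hY, hf, mul_zero, zero_mul, Finset.sum_const_zero, mul_one,
    add_zero, zero_add, sub_zero] at key
  linarith

/-! ### Divergences of the auxiliary vector fields -/

namespace IsRot

variable {Y : Field1} {B : Fin 3 → Fin 3 → ℝ}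

/-- The gradient of `Y^A D_A f`, up to its radial component. -/
lemma grad_alongD_contract (hY : IsRot Y B) {f : S2 → ℝ} (hf : SmoothFn f) (x : S2)
    {V : Fin 3 → ℝ} (hV : ∑ i, V i * (x : E3) i = 0) :
    ∑ i, V i * grad (alongD Y f) x i =
      ∑ i, V i * ∑ k, B i k * grad f x k + ∑ i, V i * ∑ k, hess f x i k * Y x k := by
  have h : ∀ i, grad (alongD Y f) x i =
      (∑ k, B i k * grad f x k) + (∑ k, hess f x i k * Y x k) - (x : E3) i * alongD Y f x := by
    intro i
    have h1 : ∀ k, hess f x i k = grad (fun y => grad f y i) x k + (x : E3) i * grad f x k :=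
      fun k => by rw [hess_symm hf, hess_eq hf]
    rw [hY.grad_alongD hf]
    simp only [h1, alongD, Fin.sum_univ_three]
    ring
  simp only [h, Fin.sum_univ_three] at hV ⊢
  linear_combination (- alongD Y f x) * hV

/-- The divergence of `V^A Y^B D_B f`. -/
lemma div_mul_alongD (hY : IsRot Y B) {f : S2 → ℝ} (hf : SmoothFn f) {V : Field1} (hV : IsTan V)
    (x : S2) : ∑ i, grad (fun y => V y i * alongD Y f y) x i =
      div1 V x * alongD Y f x + ∑ i, V x i * ∑ k, B i k * grad f x k +
        ∑ i, V x i * ∑ k, hess f x i k * Y x k := by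
  have h := hY.grad_alongD_contract hf x (hV.tan x)
  rw [hV.div1_eq, Finset.sum_mul, add_assoc, ← h, ← Finset.sum_add_distrib]
  exact Finset.sum_congr rfl fun i _ => grad_mul (hV.smooth i) (hY.smooth_alongD hf) x i

/-- The divergence of `D^A f (Y^B V_B)`. -/
lemma div_grad_mul (hY : IsRot Y B) {f : S2 → ℝ} (hf : SmoothFn f) {V : Field1}
    (hV : ∀ i, SmoothFn (fun x => V x i)) (x : S2) :
    ∑ i, grad (fun y => grad f y i * ∑ j, Y y j * V y j) x i =
      lap f x * (∑ j, Y x j * V x j) + ∑ i, grad f x i * ∑ j, B i j * V x j +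
        ∑ i, grad f x i * ∑ j, Y x j * grad (fun y => V y j) x i := by
  have hs := hY.smooth
  have h := grad_tangential hf x
  have h1 : ∀ i, grad (fun y => grad f y i * ∑ j, Y y j * V y j) x i =
      grad (fun y => grad f y i) x i * (∑ j, Y x j * V x j) +
      grad f x i * ∑ j, ((B i j - (x : E3) i * Y x j) * V x j +
        Y x j * grad (fun y => V y j) x i) := by
    intro i
    rw [grad_mul (by fun_prop) (by fun_prop), grad_sum (by fun_prop)]
    simp only [grad_mul (hs _) (hV _), hY.deriv]
  simp only [h1]
  simp only [lap_eq hf, Fin.sum_univ_three] at h ⊢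
  linear_combination (-(Y x 0 * V x 0 + Y x 1 * V x 1 + Y x 2 * V x 2)) * h

/-- The divergence of `φ Y^B T_AB`. -/
lemma div_mul_contract (hY : IsRot Y B) {φ : S2 → ℝ} (hφ : SmoothFn φ) {T : Field2}
    (hT : IsSTF T) (x : S2) :
    ∑ i, grad (fun y => φ y * ∑ j, T y i j * Y y j) x i =
      ∑ i, grad φ x i * ∑ j, T x i j * Y x j + φ x * ∑ j, Y x j * div2 T x j := by
  have hs := hY.smooth
  have hTs := hT.smooth
  have h1 : ∀ i, grad (fun y => φ y * ∑ j, T y i j * Y y j) x i =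
      grad φ x i * (∑ j, T x i j * Y x j) +
      φ x * ∑ j, (grad (fun y => T y i j) x i * Y x j +
        T x i j * (B i j - (x : E3) i * Y x j)) := by
    intro i
    rw [grad_mul (by fun_prop) (by fun_prop), grad_sum (by fun_prop)]
    simp only [grad_mul (hTs _ _) (hs _), hY.deriv]
  have t0 := hT.tan x 0
  have t1 := hT.tan x 1
  have t2 := hT.tan x 2
  simp only [h1]
  simp only [hT.div2_eq, Fin.sum_univ_three] at t0 t1 t2 ⊢
  rw [hT.symm x 1 0, hT.symm x 2 0, hT.symm x 2 1] at *
  rw [hY.diag, hY.diag, hY.diag, hY.anti 1 0, hY.anti 2 0, hY.anti 2 1]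
  linear_combination (- φ x) * (Y x 0 * t0 + Y x 1 * t1 + Y x 2 * t2)

end IsRot

/-- The divergence of `T_AB D^B f`. -/
lemma IsSTF.div_contract_grad {T : Field2} (hT : IsSTF T) {f : S2 → ℝ} (hf : SmoothFn f) :
    IsTan (fun x i => ∑ j, T x i j * grad f x j) ∧ ∀ x,
    div1 (fun x i => ∑ j, T x i j * grad f x j) x =
      ∑ j, div2 T x j * grad f x j + ∑ i, ∑ j, T x i j * hess f x i j := by
  have hTs := hT.smooth
  have ht : IsTan (fun x i => ∑ j, T x i j * grad f x j) := by
    refine ⟨by fun_prop, fun x => ?_⟩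
    have t0 := hT.tan x 0
    have t1 := hT.tan x 1
    have t2 := hT.tan x 2
    simp only [Fin.sum_univ_three] at t0 t1 t2 ⊢
    rw [hT.symm x 1 0, hT.symm x 2 0, hT.symm x 2 1] at *
    linear_combination grad f x 0 * t0 + grad f x 1 * t1 + grad f x 2 * t2
  refine ⟨ht, fun x => ?_⟩
  rw [ht.div1_eq]
  have h1 : ∀ i, grad (fun y => ∑ j, T y i j * grad f y j) x i =
      ∑ j, (grad (fun y => T y i j) x i * grad f x j +
        T x i j * grad (fun y => grad f y j) x i) := by
    intro i
    rw [grad_sum (by fun_prop)]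
    simp only [grad_mul (hTs _ _) (hf.grad _)]
  have t0 := hT.tan x 0
  have t1 := hT.tan x 1
  have t2 := hT.tan x 2
  simp only [h1]
  simp only [hT.div2_eq, hess_eq hf, Fin.sum_univ_three] at t0 t1 t2 ⊢
  linear_combination -(grad f x 0 * t0 + grad f x 1 * t1 + grad f x 2 * t2)

/-- The gradient of `|D f|²`. -/
lemma grad_normSq_grad {f : S2 → ℝ} (hf : SmoothFn f) (x : S2) (i : Fin 3) :
    grad (fun y => ∑ j, grad f y j ^ 2) x i = 2 * ∑ j, hess f x i j * grad f x j := by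
  have h := grad_tangential hf x
  rw [grad_sum (by fun_prop)]
  have h1 : ∀ j, grad (fun y => grad f y j ^ 2) x i =
      2 * grad f x j * grad (fun y => grad f y j) x i := by
    intro j
    have : (fun y => grad f y j ^ 2) = fun y => grad f y j * grad f y j := by
      funext y; ring
    rw [this, grad_mul (by fun_prop) (by fun_prop)]
    ring
  simp only [h1, hess_eq hf, Fin.sum_univ_three] at h ⊢
  linear_combination (-2 * grad f x i) * h

/-! ### The Dray-Streubel angular momentum as the integral of a local density -/

lemma IsTan.mul_left {V : Field1} (hV : IsTan V) {φ : S2 → ℝ} (hφ : SmoothFn φ) :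
    IsTan (fun x i => φ x * V x i) :=
  ⟨fun i => hφ.mul (hV.smooth i), fun x => by
    simp only [mul_assoc, ← Finset.mul_sum, hV.tan, mul_zero]⟩

lemma IsTan.mul_right {V : Field1} (hV : IsTan V) {φ : S2 → ℝ} (hφ : SmoothFn φ) :
    IsTan (fun x i => V x i * φ x) := by
  simpa only [mul_comm] using hV.mul_left hφ

lemma IsTan.sphereIntegral_div {V : Field1} (hV : IsTan V) :
    sphereIntegral (fun x => ∑ i, NullInfinity.grad (fun y => V y i) x i) = 0 :=
  NullInfinity.sphereIntegral_div hV.smooth hV.tan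

lemma IsTan.smooth_sum_grad {V : Field1} (hV : IsTan V) :
    SmoothFn (fun x => ∑ i, NullInfinity.grad (fun y => V y i) x i) :=
  SmoothFn.sum fun i => (hV.smooth i).grad i

lemma IsSTF.isTan_contract {T : Field2} (hT : IsSTF T) {V : Field1}
    (hV : ∀ i, SmoothFn (fun x => V x i)) : IsTan (fun x i => ∑ j, T x i j * V x j) := by
  have hTs := hT.smooth
  refine ⟨by fun_prop, fun x => ?_⟩
  have t0 := hT.tan x 0
  have t1 := hT.tan x 1
  have t2 := hT.tan x 2
  simp only [Fin.sum_univ_three] at t0 t1 t2 ⊢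
  rw [hT.symm x 1 0, hT.symm x 2 0, hT.symm x 2 1] at *
  linear_combination V x 0 * t0 + V x 1 * t1 + V x 2 * t2

namespace BondiData

variable (D : BondiData)

lemma isSTFTime_C : IsSTFTime D.C := ⟨D.C_smooth, D.C_symm, D.C_tangential, D.C_traceless⟩

lemma isSTFTime_news : IsSTFTime D.news := D.isSTFTime_C.timeDeriv

/-- The mass aspect without the double divergence of the shear, `m - (1/4) D^A D^B C_AB`. -/
def redMass (u : ℝ) (x : S2) : ℝ := D.m u x - 1 / 4 * ddiv (D.C u) x

lemma smooth_redMass : SmoothInTime D.redMass :=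
  D.m_smooth.sub (D.isSTFTime_C.smooth_ddiv.const_mul _)

/-- The mass aspect on a cross-section differs from the restriction of `redMass` by a double
divergence. -/
lemma massOn_eq {f : S2 → ℝ} (hf : SmoothFn f) (x : S2) :
    D.massOn f x = D.redMass (f x) x + 1 / 4 * ddiv (fun x i j => D.C (f x) x i j) x := by
  rw [D.isSTFTime_C.ddiv_onSection hf, redMass, massOn]
  simp only [news]
  ring

lemma shearOn_eq (f : S2 → ℝ) :
    D.shearOn f = fun x i j => D.C (f x) x i j + stf f x i j := by
  funext x i j
  simp only [shearOn, stf]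
  ring

lemma isSTF_shearOn {f : S2 → ℝ} (hf : SmoothFn f) : IsSTF (D.shearOn f) := by
  rw [shearOn_eq]
  exact (D.isSTFTime_C.onSection hf).add (isSTF_stf hf)

/-- The part of the density of the Dray-Streubel angular momentum that does not involve the
derivatives of the cross-section. -/
def dsBase (Y : Field1) (u : ℝ) (x : S2) : ℝ :=
  (∑ i, Y x i * D.L u x i) - 1 / 4 * ∑ i, Y x i * ∑ j, D.C u x i j * div2 (D.C u) x j

/-- The coefficients of `D f` in the density of the Dray-Streubel angular momentum, for a rotation
field `Y` with matrix `B`, after the terms of higher order have been written as divergences. -/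
def dsLin (Y : Field1) (B : Fin 3 → Fin 3 → ℝ) (k : Fin 3) (u : ℝ) (x : S2) : ℝ :=
  3 * D.m u x * Y x k
    + 3 / 4 * ∑ i, Y x i * curlD (div2 (D.C u)) x i k
    + 3 / 4 * ∑ i, Y x i * mul2 (D.news u) (D.C u) x k i
    - 1 / 4 * ∑ i, Y x i * ∑ j, D.C u x i j * D.news u x j k
    - 2 * D.redMass u x * Y x k
    - ddiv (D.C u) x * Y x k
    + 1 / 2 * ∑ j, Y x j * grad (fun y => div2 (D.C u) y j) x k
    - ∑ i, div2 (D.C u) x i * B i k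
    + 1 / 2 * ∑ j, D.C u x k j * Y x j

/-- The integrand of the Dray-Streubel angular momentum, modulo divergences. The products of the
news tensor, `D D f` and `D f` combine by the Cayley-Hamilton identity. The last term is the only one
that is present for vanishing data. -/
lemma ds_integrand_eq {Y : Field1} {B : Fin 3 → Fin 3 → ℝ} (hY : IsRot Y B) {f : S2 → ℝ}
    (hf : SmoothFn f) (x : S2) :
    (∑ i, Y x i * (D.angOn f x i - 1 / 4 * ∑ j, D.shearOn f x i j * div2 (D.shearOn f) x j))
        - 2 * (D.massOn f x * alongD Y f x) =
      (D.dsBase Y (f x) x + ∑ k, D.dsLin Y B k (f x) x * grad f x k)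
      + 1 / 2 * ∑ i, grad (fun y => (∑ j, D.news (f y) y i j * grad f y j) * alongD Y f y) x i
      - 1 / 4 * ∑ i, grad (fun y => (∑ j, grad f y j ^ 2) * ∑ j, D.news (f y) y i j * Y y j) x i
      + ∑ i, grad (fun y => div2 (D.C (f y)) y i * alongD Y f y) x i
      - 1 / 2 * ∑ i, grad (fun y => grad f y i * ∑ j, Y y j * div2 (D.C (f y)) y j) x i
      - 1 / 2 * ∑ i, grad (fun y => div2 (fun x i j => D.C (f x) x i j) y i * alongD Y f y) x i
      + 1 / 4 * ∑ i, grad (fun y => lap f y * ∑ j, D.C (f y) y i j * Y y j) x i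
      - 1 / 4 * ∑ i, Y x i * ∑ j, stf f x i j * div2 (stf f) x j := by
  have hC := D.isSTFTime_C
  have hN := D.isSTFTime_news
  have hNs := hN.onSection hf
  have hCs := hC.onSection hf
  have hV := hC.isTan_div2_section hf
  have e1 := hNs.div_contract_grad hf
  have hdN : dot2 D.C = D.news := rfl
  rw [hY.div_mul_alongD hf e1.1, e1.2, hY.div_mul_contract (by fun_prop) hNs,
    hY.div_mul_alongD hf hV, hY.div_grad_mul hf hV.smooth, hY.div_mul_alongD hf hCs.isTan_div2,
    hY.div_mul_contract (by fun_prop) hCs]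
  have e2 : div1 (fun y i => div2 (D.C (f y)) y i) x = ddiv (D.C (f x)) x +
      ∑ i, div2 (D.news (f x)) x i * grad f x i := by
    rw [hV.div1_eq, ddiv, (hC.slice (f x)).isTan_div2.div1_eq, ← Finset.sum_add_distrib]
    exact Finset.sum_congr rfl fun i _ => hC.grad_div2_section hf x i i
  have e3 : ∀ j, div2 (D.shearOn f) x j = div2 (D.C (f x)) x j +
      (∑ k, D.news (f x) x j k * grad f x k) + div2 (stf f) x j := by
    intro j
    rw [shearOn_eq, div2_add hCs (isSTF_stf hf), hC.div2_onSection hf]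
    rfl
  have e4 : ∀ j, div2 (stf f) x j = - (grad (lap f) x j + 2 * grad f x j) := by
    intro j
    rw [div2_stf hf, grad_add (by fun_prop) (by fun_prop), grad_const_mul hf]
  have e5 : ∀ j, ∑ i, Y x i * stf f x i j =
      -2 * (∑ i, Y x i * hess f x i j) + lap f x * Y x j := by
    intro j
    have h3 := hY.isTan.tan x
    have h2 : ∑ i, (if i = j then (1 : ℝ) else 0) * Y x i = Y x j := by simp
    simp only [stf, q, Fin.sum_univ_three] at h3 h2 ⊢
    linear_combination lap f x * h2 - lap f x * (x : E3) j * h3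
  have e6 : ∑ i, Y x i * (D.angOn f x i -
        1 / 4 * ∑ j, D.shearOn f x i j * div2 (D.shearOn f) x j) =
      (∑ i, Y x i * D.angOn f x i)
      - 1 / 4 * ∑ i, Y x i * ∑ j, D.C (f x) x i j * div2 (D.shearOn f) x j
      - 1 / 4 * ∑ j, (∑ i, Y x i * stf f x i j) * (div2 (D.C (f x)) x j +
          ∑ k, D.news (f x) x j k * grad f x k)
      - 1 / 4 * ∑ i, Y x i * ∑ j, stf f x i j * div2 (stf f) x j := by
    simp only [e3]
    simp only [D.shearOn_eq f, Fin.sum_univ_three]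
    ring
  have e7 : ddiv (fun x i j => D.C (f x) x i j) x = div1 (div2 fun x i j => D.C (f x) x i j) x :=
    rfl
  rw [e6, D.massOn_eq hf, ← e7]
  have ch := cayley_hamilton (x := fun i => (x : E3) i) (Y := Y x) (f := grad f x)
    (N := D.news (f x) x) (H := hess f x)
    (by have := x.sum_sq; simp only [Fin.sum_univ_three]; linarith) (hN.symm _ x) (hess_symm hf x)
    (hN.tan _ x) (hess_tan hf x) (hN.trace _ x) (hY.isTan.tan x) (grad_tangential hf x)
  rw [hess_trace] at ch
  simp only [e2, e3, e4, e5, hC.div2_onSection hf, hN.div2_onSection hf, hdN,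
    hC.grad_div2_section hf, grad_normSq_grad hf]
  simp only [angOn, dsBase, dsLin, alongD]
  generalize ddiv (fun x i j => D.C (f x) x i j) x = ddW
  have sN := hN.symm (f x) x
  have sC := hC.symm (f x) x
  have sH := hess_symm hf x
  have sdN := hN.timeDeriv.symm (f x) x
  simp only [mul2, Fin.sum_univ_three] at ch ⊢
  rw [sN 1 0, sN 2 0, sN 2 1, sH 1 0, sH 2 0, sH 2 1] at ch
  rw [sN 1 0, sN 2 0, sN 2 1, sC 1 0, sC 2 0, sC 2 1, sH 1 0, sH 2 0, sH 2 1, sdN 1 0, sdN 2 0,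
    sdN 2 1, hY.diag, hY.diag, hY.diag, hY.anti 1 0, hY.anti 2 0, hY.anti 2 1]
  linear_combination (1 / 2) * ch

end BondiData

/-- Terms linear in the gradient of the cross-section are integrated by parts with the help of a
primitive in time. -/
lemma sphereIntegral_onSection_mul_grad {P : Fin 3 → ℝ → S2 → ℝ} (hP : ∀ k, SmoothInTime (P k))
    {f : S2 → ℝ} (hf : SmoothFn f) :
    sphereIntegral (fun x => ∑ k, P k (f x) x * grad f x k) =
      sphereIntegral (fun x => ∑ k, (2 * (prim (P k) (f x) x * (x : E3) k) -
        grad (prim (P k) (f x)) x k)) := by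
  have s1 : ∀ k, SmoothFn (fun x => prim (P k) (f x) x) := fun k => (hP k).prim.onSection hf
  have s2 : ∀ k, SmoothFn (fun x => grad (prim (P k) (f x)) x k) :=
    fun k => ((hP k).prim.grad k).onSection hf
  have s3 : ∀ k, SmoothFn (fun x => P k (f x) x) := fun k => (hP k).onSection hf
  rw [sphereIntegral_sum fun k => ((s3 k).mul (hf.grad k)).continuous,
    sphereIntegral_sum fun k => SmoothFn.continuous (by fun_prop)]
  refine Finset.sum_congr rfl fun k _ => ?_
  have h := sphereIntegral_grad (s1 k) k
  have h1 : ∀ x, grad (fun y => prim (P k) (f y) y) x k =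
      grad (prim (P k) (f x)) x k + P k (f x) x * grad f x k := by
    intro x
    rw [grad_onSection (hP k).prim hf, (prim_hasDerivAt (hP k) _ x).deriv]
  simp only [h1] at h
  rw [sphereIntegral_add (s2 k).continuous ((s3 k).mul (hf.grad k)).continuous] at h
  rw [sphereIntegral_sub (SmoothFn.continuous (by fun_prop)) (SmoothFn.continuous (by fun_prop)), sphereIntegral_const_mul]
  linarith

/-- Evaluation of a smooth function on cross-sections is Lipschitz at `u = 0` in the `C⁰` norm. -/
lemma exists_lipschitz_onSection {G : ℝ → S2 → ℝ} (hG : SmoothInTime G) (R : ℝ) :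
    ∃ K, 0 ≤ K ∧ ∀ u, |u| ≤ R → ∀ x, |G u x - G 0 x| ≤ K * |u| := by
  obtain ⟨K, hK0, hK⟩ := exists_bound hG.deriv (-R) R
  refine ⟨K, hK0, fun u hu x => ?_⟩
  have hu' := abs_le.mp hu
  have h := (convex_Icc (-R) R).norm_image_sub_le_of_norm_hasDerivWithin_le
    (f := fun t => G t x) (f' := fun t => deriv (fun t => G t x) t) (C := K) (x := 0) (y := u)
    (fun t _ => (hG.hasDerivAt t x).hasDerivWithinAt) (fun t ht => hK t ht x)
    ⟨by linarith [abs_nonneg u], by linarith [abs_nonneg u]⟩ hu'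
  simpa using h

/-- The integral of a local density over cross-sections is Lipschitz at `u = 0` in the `C⁰` norm. -/
lemma exists_lipschitz_sphereIntegral {G : ℝ → S2 → ℝ} (hG : SmoothInTime G) (R : ℝ) :
    ∃ K, 0 ≤ K ∧ ∀ f, SmoothFn f → ∀ ε ≤ R, (∀ x, |f x| ≤ ε) →
      |sphereIntegral (fun x => G (f x) x) - sphereIntegral (G 0)| ≤ K * ε := by
  obtain ⟨K, hK0, hK⟩ := exists_lipschitz_onSection hG R
  refine ⟨K * totalArea, mul_nonneg hK0 totalArea_pos.le, fun f hf ε hε hfε => ?_⟩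
  rw [← sphereIntegral_sub (hG.onSection hf).continuous (hG.at 0).continuous]
  have h := abs_sphereIntegral_le (f := fun x => G (f x) x - G 0 x) (g := fun _ => K * ε)
    continuous_const fun x => (hK _ ((hfε x).trans hε) x).trans (by gcongr; exact hfε x)
  rw [sphereIntegral_const] at h
  linarith

lemma smoothInTime_curlD {V : ℝ → Field1} (hV : ∀ i, SmoothInTime (fun u x => V u x i))
    (ht : ∀ u, IsTan (V u)) (i j : Fin 3) : SmoothInTime (fun u x => curlD (V u) x i j) := by
  have h : (fun u x => curlD (V u) x i j) = fun u x =>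
      (grad (fun y => V u y j) x i + (x : E3) j * V u x i) -
      (grad (fun y => V u y i) x j + (x : E3) i * V u x j) := by
    funext u x
    rw [curlD, (ht u).covD1_eq, (ht u).covD1_eq]
  rw [h]
  exact (((hV j).grad i).add ((smoothFn_coord j).time.mul (hV i))).sub
    (((hV i).grad j).add ((smoothFn_coord i).time.mul (hV j)))

namespace BondiData

variable (D : BondiData)

lemma smooth_dsBase {Y : Field1} (hY : ∀ i, SmoothFn (fun x => Y x i)) :
    SmoothInTime (D.dsBase Y) :=
  (SmoothInTime.sum fun i => (hY i).time.mul (D.L_smooth i)).sub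
    ((SmoothInTime.sum fun i => (hY i).time.mul (SmoothInTime.sum fun j =>
      (D.C_smooth i j).mul (D.isSTFTime_C.smooth_div2 j))).const_mul _)

lemma smooth_dsLin {Y : Field1} (hY : ∀ i, SmoothFn (fun x => Y x i)) (B : Fin 3 → Fin 3 → ℝ)
    (k : Fin 3) : SmoothInTime (D.dsLin Y B k) := by
  have hC := D.isSTFTime_C
  have hN := D.isSTFTime_news
  have hcurl := smoothInTime_curlD hC.smooth_div2 fun u => (hC.slice u).isTan_div2
  exact (((((((((D.m_smooth.const_mul 3).mul (hY k).time).add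
    ((SmoothInTime.sum fun i => (hY i).time.mul (hcurl i k)).const_mul _)).add
    ((SmoothInTime.sum fun i => (hY i).time.mul
      (SmoothInTime.sum fun j => (hN.smooth k j).mul (hC.smooth j i))).const_mul _)).sub
    ((SmoothInTime.sum fun i => (hY i).time.mul
      (SmoothInTime.sum fun j => (hC.smooth i j).mul (hN.smooth j k))).const_mul _)).sub
    ((D.smooth_redMass.const_mul 2).mul (hY k).time)).sub
    (hC.smooth_ddiv.mul (hY k).time)).add
    ((SmoothInTime.sum fun j => (hY j).time.mul ((hC.smooth_div2 j).grad k)).const_mul _)).sub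
    (SmoothInTime.sum fun i => (hC.smooth_div2 i).mul (smoothInTime_const (B i k)))).add
    ((SmoothInTime.sum fun j => (hC.smooth k j).mul (hY j).time).const_mul _)

/-- A local density for the Dray-Streubel angular momentum: see `JDS_eq`. -/
def dsDensity (Y : Field1) (B : Fin 3 → Fin 3 → ℝ) (u : ℝ) (x : S2) : ℝ :=
  D.dsBase Y u x + ∑ k, (2 * (prim (D.dsLin Y B k) u x * (x : E3) k) -
    grad (prim (D.dsLin Y B k) u) x k)

lemma smooth_dsDensity {Y : Field1} (hY : ∀ i, SmoothFn (fun x => Y x i))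
    (B : Fin 3 → Fin 3 → ℝ) : SmoothInTime (D.dsDensity Y B) :=
  (D.smooth_dsBase hY).add (SmoothInTime.sum fun k =>
    (((D.smooth_dsLin hY B k).prim.mul (smoothFn_coord k).time).const_mul 2).sub
      ((D.smooth_dsLin hY B k).prim.grad k))

/-- The Dray-Streubel angular momentum of a cross-section is the integral of a density which
depends on the cross-section only through the point of evaluation. -/
lemma JDS_eq {Y : Field1} {B : Fin 3 → Fin 3 → ℝ} (hY : IsRot Y B) {f : S2 → ℝ}
    (hf : SmoothFn f) :
    D.JDS Y f = 1 / (8 * Real.pi) * sphereIntegral (fun x => D.dsDensity Y B (f x) x) := by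
  have hC := D.isSTFTime_C
  have hN := D.isSTFTime_news
  have hNs := hN.onSection hf
  have hCs := hC.onSection hf
  have hV := hC.isTan_div2_section hf
  have hW := hCs.isTan_div2
  have hYf := hY.smooth_alongD hf
  have hYs := hY.smooth
  have n1 := hNs.smooth
  have n2 := hCs.smooth
  have n3 := hV.smooth
  have n4 := hW.smooth
  have n5 := (isSTF_stf hf).smooth
  have n6 := (isSTF_stf hf).isTan_div2.smooth
  have n7 : ∀ k, SmoothFn (fun x => D.dsLin Y B k (f x) x) :=
    fun k => (D.smooth_dsLin hYs B k).onSection hf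
  have n8 : SmoothFn (fun x => D.dsBase Y (f x) x) := (D.smooth_dsBase hYs).onSection hf
  have n9 : SmoothFn (fun x => D.redMass (f x) x) := D.smooth_redMass.onSection hf
  have n10 : ∀ k, SmoothFn (fun x => prim (D.dsLin Y B k) (f x) x) :=
    fun k => (D.smooth_dsLin hYs B k).prim.onSection hf
  have n11 : ∀ k, SmoothFn (fun x => grad (prim (D.dsLin Y B k) (f x)) x k) :=
    fun k => ((D.smooth_dsLin hYs B k).prim.grad k).onSection hf
  have n12 : SmoothFn (D.massOn f) := by
    have h : D.massOn f = fun x =>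
        D.redMass (f x) x + 1 / 4 * ddiv (fun x i j => D.C (f x) x i j) x :=
      funext (D.massOn_eq hf)
    have := hCs.smooth_ddiv
    rw [h]
    fun_prop
  have t1 := ((hNs.isTan_contract hf.grad).mul_right hYf)
  have t2 := ((hNs.isTan_contract hYs).mul_left (φ := fun x => ∑ j, grad f x j ^ 2)
    (by fun_prop))
  have t3 := (hV.mul_right hYf)
  have t4 := ((isTan_grad hf).mul_right (φ := fun y => ∑ j, Y y j * div2 (D.C (f y)) y j)
    (by fun_prop))
  have t5 := (hW.mul_right hYf)
  have t6 := ((hCs.isTan_contract hYs).mul_left hf.lap)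
  have d7 := hY.sphereIntegral_stf_stf hf
  have hL : SmoothFn (fun x => D.dsBase Y (f x) x +
      ∑ k, D.dsLin Y B k (f x) x * grad f x k) := by fun_prop
  have s7 : SmoothFn (fun x => ∑ i, Y x i * ∑ j, stf f x i j * div2 (stf f) x j) := by fun_prop
  -- the seven terms with vanishing integral drop out
  have key : ∀ a b1 b2 b3 b4 b5 b6 b7 : S2 → ℝ, Continuous a → Continuous b1 → Continuous b2 →
      Continuous b3 → Continuous b4 → Continuous b5 → Continuous b6 → Continuous b7 →
      sphereIntegral b1 = 0 → sphereIntegral b2 = 0 → sphereIntegral b3 = 0 →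
      sphereIntegral b4 = 0 → sphereIntegral b5 = 0 → sphereIntegral b6 = 0 →
      sphereIntegral b7 = 0 →
      sphereIntegral (fun x => a x + 1 / 2 * b1 x - 1 / 4 * b2 x + b3 x - 1 / 2 * b4 x
        - 1 / 2 * b5 x + 1 / 4 * b6 x - 1 / 4 * b7 x) = sphereIntegral a := by
    intro a b1 b2 b3 b4 b5 b6 b7 _ _ _ _ _ _ _ _ z1 z2 z3 z4 z5 z6 z7
    rw [sphereIntegral_sub (by fun_prop) (by fun_prop), sphereIntegral_add (by fun_prop)
      (by fun_prop), sphereIntegral_sub (by fun_prop) (by fun_prop), sphereIntegral_sub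
      (by fun_prop) (by fun_prop), sphereIntegral_add (by fun_prop) (by fun_prop),
      sphereIntegral_sub (by fun_prop) (by fun_prop), sphereIntegral_add (by fun_prop)
      (by fun_prop)]
    simp only [sphereIntegral_const_mul, z1, z2, z3, z4, z5, z6, z7]
    ring
  have h1 : sphereIntegral (fun x => (∑ i, Y x i * (D.angOn f x i -
        1 / 4 * ∑ j, D.shearOn f x i j * div2 (D.shearOn f) x j))
        - 2 * (D.massOn f x * alongD Y f x)) =
      sphereIntegral (fun x => D.dsDensity Y B (f x) x) := by
    simp only [D.ds_integrand_eq hY hf]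
    rw [key _ _ _ _ _ _ _ _ hL.continuous t1.smooth_sum_grad.continuous
      t2.smooth_sum_grad.continuous t3.smooth_sum_grad.continuous t4.smooth_sum_grad.continuous
      t5.smooth_sum_grad.continuous t6.smooth_sum_grad.continuous s7.continuous
      t1.sphereIntegral_div t2.sphereIntegral_div t3.sphereIntegral_div t4.sphereIntegral_div
      t5.sphereIntegral_div t6.sphereIntegral_div d7,
      sphereIntegral_add n8.continuous (SmoothFn.continuous (by fun_prop)),
      sphereIntegral_onSection_mul_grad (D.smooth_dsLin hYs B) hf]
    simp only [dsDensity]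
    rw [sphereIntegral_add n8.continuous (SmoothFn.continuous (by fun_prop))]
  have h2 : SmoothFn (fun x => ∑ i, Y x i * (D.angOn f x i -
        1 / 4 * ∑ j, D.shearOn f x i j * div2 (D.shearOn f) x j)) := by
    have h : (fun x => ∑ i, Y x i * (D.angOn f x i -
        1 / 4 * ∑ j, D.shearOn f x i j * div2 (D.shearOn f) x j)) = fun x => _ :=
      funext fun x => eq_add_of_sub_eq (D.ds_integrand_eq hY hf x)
    rw [h]
    exact ((((((((hL.add (t1.smooth_sum_grad.const_mul _)).sub (t2.smooth_sum_grad.const_mul _)).add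
      t3.smooth_sum_grad).sub (t4.smooth_sum_grad.const_mul _)).sub
      (t5.smooth_sum_grad.const_mul _)).add (t6.smooth_sum_grad.const_mul _)).sub
      (s7.const_mul _)).add ((n12.mul hYf).const_mul 2))
  rw [sphereIntegral_sub h2.continuous (SmoothFn.continuous (by fun_prop)), sphereIntegral_const_mul] at h1
  rw [JDS, ← h1]
  ring

/-- The Dray-Streubel angular momentum is Lipschitz at `u = 0` in the `C⁰` norm. -/
lemma exists_lipschitz_JDS {Y : Field1} {B : Fin 3 → Fin 3 → ℝ} (hY : IsRot Y B) (R : ℝ) :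
    ∃ K, 0 ≤ K ∧ ∀ f, SmoothFn f → ∀ ε ≤ R, (∀ x, |f x| ≤ ε) →
      |D.JDS Y f - D.JDS Y (fun _ => 0)| ≤ K * ε := by
  obtain ⟨K, hK0, hK⟩ := exists_lipschitz_sphereIntegral (D.smooth_dsDensity hY.smooth B) R
  have hp := Real.pi_pos
  refine ⟨1 / (8 * Real.pi) * K, by positivity, fun f hf ε hε hfε => ?_⟩
  rw [D.JDS_eq hY hf, D.JDS_eq hY (smoothFn_const 0), ← mul_sub, abs_mul,
    abs_of_nonneg (by positivity), mul_assoc]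
  gcongr
  exact hK f hf ε hε hfε

end BondiData

/-! ### The correction -/

/-- The derivative along a rotation field splits into the part with `ℓ ≥ 2` and an explicit one. -/
lemma IsRot.alongD_eq_projHigh {Y : Field1} {B : Fin 3 → Fin 3 → ℝ} (hY : IsRot Y B) {k : S2 → ℝ}
    (hk : SmoothFn k) (x : S2) :
    alongD Y k x = alongD Y (projHigh k) x +
      3 / totalArea * ∑ i, sphereIntegral (fun y => k y * (y : E3) i) * Y x i := by
  have h1 : ∀ j, grad (projHigh k) x j = grad k x j -
      3 / totalArea * ∑ i, sphereIntegral (fun y => k y * (y : E3) i) * q x j i := by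
    intro j
    unfold projHigh
    rw [grad_sub (by fun_prop) (by fun_prop), grad_sub (by fun_prop) (by fun_prop),
      grad_const, grad_const_mul (by fun_prop), grad_sum (by fun_prop)]
    simp only [grad_const_mul (smoothFn_coord _), grad_coord, sub_zero]
  have h2 : ∀ i, ∑ j, Y x j * q x j i = Y x i := by
    intro i
    have h3 := hY.isTan.tan x
    have h2 : ∑ j, (if j = i then (1 : ℝ) else 0) * Y x j = Y x i := by simp
    simp only [q, Fin.sum_univ_three] at h3 h2 ⊢
    linear_combination h2 - (x : E3) i * h3
  have a0 := h2 0
  have a1 := h2 1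
  have a2 := h2 2
  simp only [alongD, h1, Fin.sum_univ_three] at a0 a1 a2 ⊢
  linear_combination 3 / totalArea * (sphereIntegral (fun y => k y * (y : E3) 0) * a0 +
    sphereIntegral (fun y => k y * (y : E3) 1) * a1 +
    sphereIntegral (fun y => k y * (y : E3) 2) * a2)

namespace BondiData

variable (D : BondiData)

/-- The combination `c' + 2 f` of the potential of the shear on `u = f` and of `f`. It is a potential
of the restriction of `C_AB` to the cross-section, up to `ℓ = 0, 1` parts. -/
def shiftedPotential (f : S2 → ℝ) (x : S2) : ℝ := potential (D.shearOn f) x + 2 * f x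

lemma smooth_shiftedPotential {f : S2 → ℝ} (hf : SmoothFn f) :
    SmoothFn (D.shiftedPotential f) :=
  (D.isSTF_shearOn hf).isPotential_potential.smooth.add (hf.const_mul 2)

lemma lap2_shiftedPotential {f : S2 → ℝ} (hf : SmoothFn f) (x : S2) :
    lap2 (D.shiftedPotential f) x = 2 * ddiv (fun x i j => D.C (f x) x i j) x := by
  have hp := (D.isSTF_shearOn hf).isPotential_potential
  have h : D.shiftedPotential f = fun x => potential (D.shearOn f) x + 2 * f x := rfl
  rw [h, lap2_add hp.smooth (hf.const_mul 2), lap2_const_mul hf, hp.lap2_eq, shearOn_eq,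
    ddiv_add (D.isSTFTime_C.onSection hf) (isSTF_stf hf), ddiv_stf hf]
  ring

lemma sphereIntegral_shiftedPotential_coord {f : S2 → ℝ} (hf : SmoothFn f) (i : Fin 3) :
    sphereIntegral (fun x => D.shiftedPotential f x * (x : E3) i) =
      2 * sphereIntegral (fun x => f x * (x : E3) i) := by
  have hp := (D.isSTF_shearOn hf).isPotential_potential
  have hps := hp.smooth
  simp only [shiftedPotential, add_mul, mul_assoc]
  rw [sphereIntegral_add (by fun_prop) (by fun_prop), hp.no_l1, sphereIntegral_const_mul, zero_add]

/-- The difference of the Chen-Wang-Yau and Dray-Streubel angular momenta. The double divergence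
in the mass aspect drops out, because the rotation field commutes with `D² (D² + 2)`. -/
lemma JCWY_eq {Y : Field1} {B : Fin 3 → Fin 3 → ℝ} (hY : IsRot Y B) {f : S2 → ℝ}
    (hf : SmoothFn f) :
    D.JCWY Y f = D.JDS Y f + 1 / (8 * Real.pi) *
      sphereIntegral (fun x => D.redMass (f x) x * alongD Y (D.shiftedPotential f) x) := by
  have hp := (D.isSTF_shearOn hf).isPotential_potential.smooth
  have hk := D.smooth_shiftedPotential hf
  have n1 : SmoothFn (fun x => D.redMass (f x) x) := D.smooth_redMass.onSection hf
  have n2 := (D.isSTFTime_C.onSection hf).smooth_ddiv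
  have a1 := hY.smooth_alongD hp
  have a2 := hY.smooth_alongD hf
  have a3 := hY.smooth_alongD hk
  have h1 : ∀ x, alongD Y (D.shiftedPotential f) x =
      alongD Y (potential (D.shearOn f)) x + 2 * alongD Y f x := by
    intro x
    rw [← IsRot.alongD_const_mul hf, ← IsRot.alongD_add hp (hf.const_mul 2)]
    rfl
  have h2 : SmoothFn (D.massOn f) := by
    rw [funext (D.massOn_eq hf)]
    exact n1.add (n2.const_mul _)
  have h3 : sphereIntegral (fun x => D.redMass (f x) x * alongD Y (D.shiftedPotential f) x) =
      sphereIntegral (fun x => D.massOn f x * alongD Y (D.shiftedPotential f) x) := by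
    have h4 := hY.sphereIntegral_lap2_alongD hk
    simp only [D.lap2_shiftedPotential hf, mul_assoc] at h4
    rw [sphereIntegral_const_mul] at h4
    simp only [D.massOn_eq hf, add_mul, mul_assoc]
    rw [sphereIntegral_add (n1.mul a3).continuous ((n2.mul a3).const_mul _).continuous,
      sphereIntegral_const_mul]
    linarith
  rw [h3, JCWY]
  simp only [h1, mul_add]
  rw [sphereIntegral_add (h2.mul a1).continuous (h2.mul (a2.const_mul 2)).continuous]
  simp only [mul_left_comm _ (2 : ℝ)]
  rw [sphereIntegral_const_mul]
  ring

/-- The pairing of a fixed function with the derivative of the potential is the integral of a local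
density: the inverse of `D² (D² + 2)` is moved to the fixed function. -/
lemma sphereIntegral_mul_alongD_projHigh {Y : Field1} {B : Fin 3 → Fin 3 → ℝ} (hY : IsRot Y B)
    {f : S2 → ℝ} (hf : SmoothFn f) {μ : S2 → ℝ} (hμ : SmoothFn μ) :
    sphereIntegral (fun x => μ x * alongD Y (projHigh (D.shiftedPotential f)) x) =
      - (1 / totalArea) * sphereIntegral (fun x => ∑ i, ∑ j,
        D.C (f x) x i j * hess (greenOp (alongD Y μ)) x i j) := by
  have hA := totalArea_pos.ne'
  have hk := D.smooth_shiftedPotential hf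
  have ha := hY.smooth_alongD hμ
  have h1 := sphereIntegral_greenOp_symm ha hk.lap2
  simp only [greenOp_lap2_eq_projHigh hk, D.lap2_shiftedPotential hf,
    mul_left_comm _ (2 * totalArea), mul_left_comm _ (2 : ℝ)] at h1
  rw [sphereIntegral_const_mul, sphereIntegral_const_mul,
    sphereIntegral_mul_ddiv (D.isSTFTime_C.onSection hf) ha.greenOp] at h1
  have h2 := hY.sphereIntegral_alongD hμ hk.projHigh
  rw [h2] at h1
  field_simp
  linarith

/-- The splitting of the correction: the change of the reduced mass, the change of the potential,
and the `ℓ = 1` part of the supertranslation. -/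
lemma correction_eq {Y : Field1} {B : Fin 3 → Fin 3 → ℝ} (hY : IsRot Y B) {f : S2 → ℝ}
    (hf : SmoothFn f) :
    D.correction Y f = 1 / (8 * Real.pi) *
      (sphereIntegral (fun x => (D.redMass (f x) x - D.redMass 0 x) *
          alongD Y (projHigh (D.shiftedPotential f)) x)
        - 1 / totalArea * (sphereIntegral (fun x => ∑ i, ∑ j,
            D.C (f x) x i j * hess (greenOp (alongD Y (D.redMass 0))) x i j) -
          sphereIntegral (fun x => ∑ i, ∑ j,
            D.C 0 x i j * hess (greenOp (alongD Y (D.redMass 0))) x i j))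
        + 6 / totalArea * ∑ i, sphereIntegral (fun x => f x * (x : E3) i) *
          sphereIntegral (fun x => D.redMass (f x) x * Y x i)) := by
  have key : ∀ g : S2 → ℝ, SmoothFn g →
      sphereIntegral (fun x => D.redMass (g x) x * alongD Y (D.shiftedPotential g) x) =
      sphereIntegral (fun x => D.redMass (g x) x * alongD Y (projHigh (D.shiftedPotential g)) x) +
        6 / totalArea * ∑ i, sphereIntegral (fun x => g x * (x : E3) i) *
          sphereIntegral (fun x => D.redMass (g x) x * Y x i) := by
    intro g hg
    have hk := D.smooth_shiftedPotential hg
    have hs := hY.smooth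
    have n1 : SmoothFn (fun x => D.redMass (g x) x) := D.smooth_redMass.onSection hg
    have n2 := hY.smooth_alongD hk.projHigh
    have h1 : ∀ x, D.redMass (g x) x * alongD Y (D.shiftedPotential g) x =
        D.redMass (g x) x * alongD Y (projHigh (D.shiftedPotential g)) x +
        6 / totalArea * ∑ i, sphereIntegral (fun x => g x * (x : E3) i) *
          (D.redMass (g x) x * Y x i) := by
      intro x
      rw [hY.alongD_eq_projHigh hk]
      simp only [D.sphereIntegral_shiftedPotential_coord hg, Fin.sum_univ_three]
      ring
    have n3 : ∀ i, SmoothFn (fun x => sphereIntegral (fun x => g x * (x : E3) i) *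
        (D.redMass (g x) x * Y x i)) := fun i => (n1.mul (hs i)).const_mul _
    simp only [h1]
    rw [sphereIntegral_add (n1.mul n2).continuous ((SmoothFn.sum n3).const_mul _).continuous,
      sphereIntegral_const_mul, sphereIntegral_sum fun i => (n3 i).continuous]
    simp only [sphereIntegral_const_mul]
  have h0 := smoothFn_const 0
  have hM := D.smooth_redMass.at 0
  have n1 : SmoothFn (fun x => D.redMass (f x) x) := D.smooth_redMass.onSection hf
  have n2 := hY.smooth_alongD (D.smooth_shiftedPotential hf).projHigh
  have e1 := D.sphereIntegral_mul_alongD_projHigh hY hf hM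
  have e2 := D.sphereIntegral_mul_alongD_projHigh hY h0 hM
  have e3 : sphereIntegral (fun x => (D.redMass (f x) x - D.redMass 0 x) *
      alongD Y (projHigh (D.shiftedPotential f)) x) =
      sphereIntegral (fun x => D.redMass (f x) x *
        alongD Y (projHigh (D.shiftedPotential f)) x) -
      sphereIntegral (fun x => D.redMass 0 x *
        alongD Y (projHigh (D.shiftedPotential f)) x) := by
    simp only [sub_mul]
    exact sphereIntegral_sub (n1.mul n2).continuous (hM.mul n2).continuous
  have e4 : sphereIntegral (fun _ => 0) = 0 := by rw [sphereIntegral_const, zero_mul]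
  rw [correction, D.JCWY_eq hY hf, D.JCWY_eq hY h0, key f hf, key _ h0, e3, e1, e2]
  simp only [zero_mul, e4, Finset.sum_const_zero, mul_zero, add_zero]
  ring

/-- The derivatives of the potentials of the cross-sections with `|f| ≤ R` are bounded in `L²`,
whatever the derivatives of `f`. -/
lemma exists_bound_grad_projHigh (R : ℝ) : ∃ K, 0 ≤ K ∧ ∀ f, SmoothFn f → (∀ x, |f x| ≤ R) →
    sphereIntegral (fun x => ∑ i, grad (projHigh (D.shiftedPotential f)) x i ^ 2) ≤ K := by
  obtain ⟨K, hK0, hK⟩ := exists_energy_bound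
  have hs : SmoothInTime (fun u x => ∑ i, ∑ j, D.C u x i j * D.C u x i j) :=
    SmoothInTime.sum fun i => SmoothInTime.sum fun j => (D.C_smooth i j).mul (D.C_smooth i j)
  obtain ⟨L, hL0, hL⟩ := exists_bound hs (-R) R
  refine ⟨K * (L * totalArea), by have := totalArea_pos; positivity, fun f hf hfR => ?_⟩
  refine (hK _ _ (D.isSTFTime_C.onSection hf) (D.smooth_shiftedPotential hf)
    (D.lap2_shiftedPotential hf)).trans (mul_le_mul_of_nonneg_left ?_ hK0)
  rw [← sphereIntegral_const]
  have hc := (hs.onSection hf).continuous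
  simp only [← sq] at hc hL
  exact sphereIntegral_mono hc continuous_const fun x =>
    (le_abs_self _).trans (hL _ (abs_le.mp (hfR x)) x)

/-- The correction is bounded by the `C⁰` norm of the cross-section. The three parts of
`correction_eq` are estimated separately. -/
lemma exists_lipschitz_correction {Y : Field1} {B : Fin 3 → Fin 3 → ℝ} (hY : IsRot Y B) (R : ℝ) :
    ∃ K, 0 ≤ K ∧ ∀ f, SmoothFn f → ∀ ε ≤ R, (∀ x, |f x| ≤ ε) →
      |D.correction Y f| ≤ K * ε := by
  have hs := hY.smooth
  have hA := totalArea_pos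
  have hg : SmoothFn (greenOp (alongD Y (D.redMass 0))) :=
    (hY.smooth_alongD (D.smooth_redMass.at 0)).greenOp
  have hM : ∀ i, SmoothInTime (fun u x => D.redMass u x * Y x i) :=
    fun i => D.smooth_redMass.mul (hs i).time
  obtain ⟨K1, hK1, h1⟩ := exists_lipschitz_onSection D.smooth_redMass R
  obtain ⟨K2, hK2, h2⟩ := D.exists_bound_grad_projHigh R
  obtain ⟨K3, hK3, h3⟩ := exists_lipschitz_sphereIntegral (G := fun u x => ∑ i, ∑ j,
    D.C u x i j * hess (greenOp (alongD Y (D.redMass 0))) x i j)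
    (SmoothInTime.sum fun i => SmoothInTime.sum fun j =>
      (D.C_smooth i j).mul (hg.hess i j).time) R
  choose K4 hK4 h4 using fun i => exists_bound (hM i) (-R) R
  set y2 := sphereIntegral (fun x => ∑ i, Y x i ^ 2) with hy2
  have hy2' : 0 ≤ y2 := sphereIntegral_nonneg fun x => Finset.sum_nonneg fun i _ => sq_nonneg _
  have hK4' : 0 ≤ ∑ i, K4 i := Finset.sum_nonneg fun i _ => hK4 i
  have hpi := Real.pi_pos
  refine ⟨1 / (8 * Real.pi) * (K1 * (1 / 2 * (y2 + K2)) + 1 / totalArea * K3 +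
    6 / totalArea * (totalArea * totalArea * ∑ i, K4 i)), by positivity, fun f hf ε hε hfε => ?_⟩
  have hε0 : 0 ≤ ε := (abs_nonneg _).trans (hfε (proj 0))
  have hfR : ∀ x, |f x| ≤ R := fun x => (hfε x).trans hε
  have hpk := (D.smooth_shiftedPotential hf).projHigh
  -- the change of the reduced mass
  have b1 : |sphereIntegral (fun x => (D.redMass (f x) x - D.redMass 0 x) *
      alongD Y (projHigh (D.shiftedPotential f)) x)| ≤ K1 * ε * (1 / 2 * (y2 + K2)) := by
    have c : |sphereIntegral (fun x => (D.redMass (f x) x - D.redMass 0 x) *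
        alongD Y (projHigh (D.shiftedPotential f)) x)| ≤ sphereIntegral (fun x =>
        K1 * ε * (1 / 2 * ((∑ i, Y x i ^ 2) +
          ∑ i, grad (projHigh (D.shiftedPotential f)) x i ^ 2))) := by
      refine abs_sphereIntegral_le (by fun_prop) fun x => ?_
      rw [abs_mul]
      refine mul_le_mul ((h1 _ (hfR x) x).trans (by gcongr; exact hfε x)) ?_ (abs_nonneg _)
        (by positivity)
      rw [alongD, ← Finset.sum_add_distrib, Finset.mul_sum]
      refine (Finset.abs_sum_le_sum_abs _ _).trans (Finset.sum_le_sum fun i _ => ?_)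
      rw [abs_le]
      constructor
      · nlinarith [sq_nonneg (Y x i + grad (projHigh (D.shiftedPotential f)) x i)]
      · nlinarith [sq_nonneg (Y x i - grad (projHigh (D.shiftedPotential f)) x i)]
    rw [sphereIntegral_const_mul, sphereIntegral_const_mul,
      sphereIntegral_add (by fun_prop) (by fun_prop)] at c
    refine c.trans ?_
    have := h2 f hf hfR
    gcongr
  -- the change of the potential
  have b2 := h3 f hf ε hε hfε
  -- the `ℓ = 1` part of the supertranslation
  have b3 : ∀ i, |sphereIntegral (fun x => f x * (x : E3) i) *
      sphereIntegral (fun x => D.redMass (f x) x * Y x i)| ≤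
      ε * totalArea * (K4 i * totalArea) := by
    intro i
    rw [abs_mul, ← sphereIntegral_const, ← sphereIntegral_const]
    refine mul_le_mul (abs_sphereIntegral_le continuous_const fun x => ?_)
      (abs_sphereIntegral_le continuous_const fun x => h4 i _ (abs_le.mp (hfR x)) x)
      (abs_nonneg _) (sphereIntegral_nonneg fun x => hε0)
    rw [abs_mul]
    have hx : |(x : E3) i| ≤ 1 := by
      have := PiLp.norm_apply_le (x : E3) i
      rwa [x.norm_eq] at this
    calc |f x| * |(x : E3) i| ≤ ε * 1 := mul_le_mul (hfε x) hx (abs_nonneg _) hε0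
      _ = ε := mul_one ε
  have b4 := (Finset.abs_sum_le_sum_abs (fun i => sphereIntegral (fun x => f x * (x : E3) i) *
      sphereIntegral (fun x => D.redMass (f x) x * Y x i)) Finset.univ).trans
      (Finset.sum_le_sum fun i _ => b3 i)
  rw [D.correction_eq hY hf, abs_mul, abs_of_nonneg (by positivity : 0 ≤ 1 / (8 * Real.pi)),
    mul_assoc]
  refine mul_le_mul_of_nonneg_left ?_ (by positivity)
  refine (abs_add_le _ _).trans ?_
  refine (add_le_add (abs_sub _ _) le_rfl).trans ?_
  rw [abs_mul, abs_mul, abs_of_nonneg (by positivity : 0 ≤ 1 / totalArea),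
    abs_of_nonneg (by positivity : 0 ≤ 6 / totalArea)]
  have b5 : ∑ i, ε * totalArea * (K4 i * totalArea) =
      totalArea * totalArea * (∑ i, K4 i) * ε := by
    rw [Finset.mul_sum, Finset.sum_mul]
    exact Finset.sum_congr rfl fun i _ => by ring
  rw [b5] at b4
  calc _ ≤ K1 * ε * (1 / 2 * (y2 + K2)) + 1 / totalArea * (K3 * ε) +
        6 / totalArea * (totalArea * totalArea * (∑ i, K4 i) * ε) := by gcongr
    _ = _ := by ring

lemma crossSectionContinuous_JCWY {Y : Field1} {B : Fin 3 → Fin 3 → ℝ} (hY : IsRot Y B) :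
    CrossSectionContinuous (D.JCWY Y) := by
  intro f hf hlim
  obtain ⟨K1, hK1, h1⟩ := D.exists_lipschitz_JDS hY 1
  obtain ⟨K2, hK2, h2⟩ := D.exists_lipschitz_correction hY 1
  rw [Metric.tendsto_atTop]
  intro η hη
  set ε := min 1 (η / (2 * (K1 + K2 + 1))) with hεd
  have hε0 : 0 < ε := by positivity
  obtain ⟨N, hN⟩ := eventually_atTop.mp (Metric.tendstoUniformly_iff.mp hlim ε hε0)
  refine ⟨N, fun n hn => ?_⟩
  have hb : ∀ x, |f n x| ≤ ε := fun x => by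
    have := hN n hn x
    rw [dist_comm, Real.dist_eq, sub_zero] at this
    exact this.le
  have e1 := h1 _ (hf n) ε (min_le_left _ _) hb
  have e2 := h2 _ (hf n) ε (min_le_left _ _) hb
  have e3 : D.JCWY Y (f n) - D.JCWY Y (fun _ => 0) =
      (D.JDS Y (f n) - D.JDS Y (fun _ => 0)) + D.correction Y (f n) := by
    rw [correction]
    ring
  rw [Real.dist_eq, e3]
  have e4 : (K1 + K2 + 1) * ε ≤ η / 2 := by
    calc (K1 + K2 + 1) * ε ≤ (K1 + K2 + 1) * (η / (2 * (K1 + K2 + 1))) := by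
          gcongr
          exact min_le_right _ _
      _ = η / 2 := by field_simp
  calc _ ≤ K1 * ε + K2 * ε := (abs_add_le _ _).trans (add_le_add e1 e2)
    _ < η := by linarith

end BondiData

end NullInfinity

end

theorem mainTheorem2 (D : NullInfinity.BondiData) (Y : NullInfinity.Field1)
    (hY : NullInfinity.IsKilling Y) :
    (∀ f : NullInfinity.S2 → ℝ, NullInfinity.SmoothFn f →
      ∃! c : NullInfinity.S2 → ℝ, NullInfinity.IsPotential (D.shearOn f) c) ∧
    NullInfinity.CrossSectionContinuous (D.JCWY Y) ∧
    (∀ R : ℝ, ∃ K : ℝ, ∀ f : NullInfinity.S2 → ℝ, NullInfinity.SmoothFn f →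
      (⨆ x, |f x|) ≤ R → |D.correction Y f| ≤ K * ⨆ x, |f x|) := by
  obtain ⟨B, hB⟩ := hY.exists_isRot
  refine ⟨fun f hf => ?_, D.crossSectionContinuous_JCWY hB, fun R => ?_⟩
  · obtain ⟨c, hc⟩ := (D.isSTF_shearOn hf).exists_isPotential
    exact ⟨c, hc, fun d hd => hd.eq hc⟩
  · obtain ⟨K, -, hK⟩ := D.exists_lipschitz_correction hB R
    refine ⟨K, fun f hf hR => hK f hf _ hR fun x => ?_⟩
    -- the supremum is finite by compactness of the sphere
    exact le_ciSup (f := fun x => |f x|)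
      (isCompact_range hf.continuous.abs).bddAbove x
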